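/- Let $g\ge 1$. Consider parameters $p=(\ell_1,\dots,\ell_g,b)\in\mathbb R^{g+1}$ with all $\ell_j>0$; put $a=\ell_1+\dots+\ell_g$, $P_0=(0,-a)$, and let $P_0,P_1,\dots,P_{2g}$ be the vertices of the staircase whose segments $P_{j-1}P_j$ point alternately to the right ($j$ odd) and upwards ($j$ even) and have lengths $|P_{j-1}P_j|=|P_{2g-j}P_{2g+1-j}|=\ell_j$ for $1\le j\le g$. The staircase is symmetric in the line $y=-x$, it ends at $P_{2g}=(a,0)$, and $P_g=(c,-c)$ with $c=\sum_{j\text{ odd}}\ell_j$. Let $\widetilde\Delta_g$ be the set of all such $p$ with $b>c$. The space $\Delta_g$ of geometric coordinates (of dimension $g$) is the quotient of $\widetilde\Delta_g$ by the homotheties $p\mapsto rp$, $r>0$. Adjoining to the staircase the edge $E_2P_0=\{0\}\times(-\infty,-a)$ and the edge $P_{2g}E_1=(a,\infty)\times\{0\}$ (with $E_1,E_2$ at infinity) gives a zigzag that separates the plane into an upper left region $U$ and a lower right region $L$. Put $$\Omega_+=U\cap\{x>-b\}\cap\{y<b\},\qquad \Omega_-=L\cap\big(\{x<b\}\cup\{y>-b\}\big).$$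 Of these two domains, $\Omega_{Gdh}$ is the one whose interior angle at $P_g$ is $3\pi/2$ (so $\Omega_+$ for even $g$ and $\Omega_-$ for odd $g$), and $\Omega_{G^{-1}dh}$ is the other one. Number the consecutive edges of the zigzag by $e_0=E_2P_0$, $e_j=P_{j-1}P_j$ for $1\le j\le 2g$, and $e_{2g+1}=P_{2g}E_1$. Let $c_i$ be the class of arcs joining $e_{i-1}$ to $e_{i+1}$ in the domain (the arcs that encircle $P_{i-1}P_i$), let $\gamma_i=c_i+c_{2g+1-i}$ for $1\le i\le g-1$ (a member is a pair of arcs, one from each class, and its length is the sum of the two lengths), and let $\delta$ be the class of arcs joining $e_0$ to $e_{2g+1}$. For such a class $\Gamma$ in a domain $\Omega$ let $$\operatorname{Ext}_\Omega(\Gamma)=\sup_\rho \frac{\ell_\rho(\Gamma)^2}{\operatorname{Area}(\rho)},$$ where $\rho\,|dz|$ ranges over the (Borel) conformal metrics on $\Omega$ with $0<\operatorname{Area}(\rho)<\infty$, and $\ell_\rho(\Gamma)$ is the infimum of the $\rho$-lengths of the members of $\Gamma$. Put $$\mathcal H(\Gamma)=\Big|e^{1/\operatorname{Ext}_{\Omega_{Gdh}}(\Gamma)}-e^{1/\operatorname{Ext}_{\Omega_{G^{-1}dh}}(\Gamma)}\Big|^2+\Big|e^{\operatorname{Ext}_{\Omega_{Gdh}}(\Gamma)}-e^{\operatorname{Ext}_{\Omega_{G^{-1}dh}}(\Gamma)}\Big|^2,\qquad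 \mathcal H=\sum_{i=1}^{g-1}\mathcal H(\gamma_i)+\mathcal H(\delta).$$ Then for each of the classes $\Gamma=\delta,\gamma_1,\dots,\gamma_{g-1}$ the extremal lengths $\operatorname{Ext}_{\Omega_{Gdh}}(\Gamma)$ and $\operatorname{Ext}_{\Omega_{G^{-1}dh}}(\Gamma)$ are positive and finite at every point of $\widetilde\Delta_g$, and they are real analytic functions of the geometric coordinates $p\in\widetilde\Delta_g$. The height function $\mathcal H$ is invariant under homotheties, and it is real analytic on $\widetilde\Delta_g$; that is, $\mathcal H$ is a real analytic function on $\Delta_g$. -/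

import Mathlib

open Set MeasureTheory
open scoped ENNReal NNReal

noncomputable section

namespace Scherk

/-! ### Extremal length of systems of arcs in a plane domain -/

/-- The arcs in `Ω` that join `A` to `B`: continuous on `[0,1]`, starting on `A`, ending on `B`,
and running inside `Ω`, continuously differentiably, at all intermediate times. -/
def arcsJoining (Ω A B : Set ℂ) : Set (ℝ → ℂ) :=
  {α | ContinuousOn α (Icc 0 1) ∧ ContDiffOn ℝ 1 α (Ioo 0 1) ∧ MapsTo α (Ioo 0 1) Ω ∧
    α 0 ∈ A ∧ α 1 ∈ B}

/-- The length of an arc for the conformal metric `ρ |dz|`. -/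
def arcLength (ρ : ℂ → ℝ≥0) (α : ℝ → ℂ) : ℝ≥0∞ :=
  ∫⁻ t in Ioo (0 : ℝ) 1, (ρ (α t) : ℝ≥0∞) * ‖deriv α t‖ₑ

/-- The length of a system of arcs is the sum of the lengths of its members. -/
def systemLength (ρ : ℂ → ℝ≥0) (L : List (ℝ → ℂ)) : ℝ≥0∞ :=
  (L.map (arcLength ρ)).sum

/-- The area of `Ω` for the conformal metric `ρ |dz|`. -/
def area (ρ : ℂ → ℝ≥0) (Ω : Set ℂ) : ℝ≥0∞ :=
  ∫⁻ z in Ω, (ρ z : ℝ≥0∞) ^ 2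

/-- The extremal length `sup_ρ ℓ_ρ(Γ)² / Area(ρ)` of a class `Γ` of systems of arcs in `Ω`; the
supremum is over Borel conformal metrics `ρ |dz|` with `0 < Area(ρ) < ∞`, and `ℓ_ρ(Γ)` is the
infimum of the `ρ`-lengths of the members of `Γ`. -/
def extremalLength (Ω : Set ℂ) (Γ : Set (List (ℝ → ℂ))) : ℝ≥0∞ :=
  ⨆ (ρ : ℂ → ℝ≥0) (_ : Measurable ρ ∧ 0 < area ρ Ω ∧ area ρ Ω < ∞),
    (⨅ L ∈ Γ, systemLength ρ L) ^ 2 / area ρ Ω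

/-! ### Geometric coordinates and the pair of orthodisks

A point `p` consists of `g` edge lengths `p.1` and the strip width `p.2 = b`. -/

/-- The length of the segment from `P_i` to `P_{i+1}`, for `0 ≤ i < 2g`. The first `g` lengths are
the coordinates; the others are determined by the symmetry in the line `y = -x`, which takes the
segment from `P_i` to `P_{i+1}` to the one from `P_{2g-1-i}` to `P_{2g-i}`. -/
def segLength {g : ℕ} (p : (Fin g → ℝ) × ℝ) (i : ℕ) : ℝ :=
  if h : min i (2 * g - 1 - i) < g then p.1 ⟨min i (2 * g - 1 - i), h⟩ else 0

/-- The number `a` for which the staircase runs from `(0,-a)` to `(a,0)`. -/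
def cornerDist {g : ℕ} (p : (Fin g → ℝ) × ℝ) : ℝ := ∑ i, p.1 i

/-- The vertices `P_0, …, P_{2g}` of the staircase: `P_0 = (0,-a)`, and the following segments
point alternately to the right and upwards. -/
def vertex {g : ℕ} (p : (Fin g → ℝ) × ℝ) (j : ℕ) : ℂ :=
  -(cornerDist p : ℂ) * Complex.I +
    ∑ i ∈ Finset.range j, (segLength p i : ℂ) * (if Even i then 1 else Complex.I)

/-- The (open) edges of the staircase: edge `0` is `E_2 P_0`, part of the negative `y`-axis;
edge `j` is `P_{j-1} P_j` for `1 ≤ j ≤ 2g`; edge `2g+1` is `P_{2g} E_1`, part of the positive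
`x`-axis. The ends `E_2` and `E_1` are at infinity. -/
def edge {g : ℕ} (p : (Fin g → ℝ) × ℝ) (j : ℕ) : Set ℂ :=
  if j = 0 then {z | z.re = 0 ∧ z.im < -cornerDist p}
  else if j ≤ 2 * g then openSegment ℝ (vertex p (j - 1)) (vertex p j)
  else {z | cornerDist p < z.re ∧ z.im = 0}

/-- The staircase (zigzag), a properly embedded arc. -/
def zigzag {g : ℕ} (p : (Fin g → ℝ) × ℝ) : Set ℂ :=
  closure (⋃ j ∈ Finset.range (2 * g + 2), edge p j)

/-- The component of the complement of the zigzag to its upper left; it is described so because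
both coordinates are monotone along the zigzag. -/
def upperLeft {g : ℕ} (p : (Fin g → ℝ) × ℝ) : Set ℂ :=
  {z | ∃ w ∈ zigzag p, z.re < w.re ∧ w.im < z.im}

/-- The component of the complement of the zigzag to its lower right. -/
def lowerRight {g : ℕ} (p : (Fin g → ℝ) × ℝ) : Set ℂ :=
  {z | ∃ w ∈ zigzag p, w.re < z.re ∧ z.im < w.im}

/-- The upper left orthodisk: a half-infinite vertical and a half-infinite horizontal strip of
width `b`, with outer boundary consisting of two rays that meet at `(-b,b)` at an inner angle
of `π/2`. -/
def upperOrthodisk {g : ℕ} (p : (Fin g → ℝ) × ℝ) : Set ℂ :=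
  upperLeft p ∩ ({z | -p.2 < z.re} ∩ {z | z.im < p.2})

/-- The lower right orthodisk: a half-infinite vertical and a half-infinite horizontal strip of
width `b`, with outer boundary consisting of two rays that meet at `(b,-b)` at an inner angle
of `3π/2`. -/
def lowerOrthodisk {g : ℕ} (p : (Fin g → ℝ) × ℝ) : Set ℂ :=
  lowerRight p ∩ ({z | z.re < p.2} ∪ {z | -p.2 < z.im})

/-- `Ω_{G dh}` is the orthodisk in which the angle at the central vertex `P_g` is `3π/2`. -/
def OmegaGdh {g : ℕ} (p : (Fin g → ℝ) × ℝ) : Set ℂ :=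
  if Even g then upperOrthodisk p else lowerOrthodisk p

/-- `Ω_{G⁻¹ dh}` is the other orthodisk of the pair, with angle `π/2` at `P_g`. -/
def OmegaInvGdh {g : ℕ} (p : (Fin g → ℝ) × ℝ) : Set ℂ :=
  if Even g then lowerOrthodisk p else upperOrthodisk p

/-- The space of geometric coordinates, before division by homotheties: positive edge lengths and
a strip width `b > c`, where `P_g = (c,-c)`. -/
def Delta (g : ℕ) : Set ((Fin g → ℝ) × ℝ) :=
  {p | (∀ i, 0 < p.1 i) ∧ (vertex p g).re < p.2}

/-! ### Cycles and the height function

A cycle is a formal sum (a list) of pairs of edges; it stands for the systems of arcs in which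
each arc joins the two edges of the corresponding pair. As the orthodisks are simply connected,
these systems form one homotopy class. -/

/-- `c_i` encircles the segment `P_{i-1} P_i`: it joins the preceding edge to the following one. -/
def cycleC (i : ℕ) : List (ℕ × ℕ) := [(i - 1, i + 1)]

/-- `γ_i = c_i + c_{2g+1-i}`. -/
def cycleGamma (g i : ℕ) : List (ℕ × ℕ) := cycleC i ++ cycleC (2 * g + 1 - i)

/-- `δ` joins `E_2 P_0` to `P_{2g} E_1`. -/
def cycleDelta (g : ℕ) : List (ℕ × ℕ) := [(0, 2 * g + 1)]

/-- The cycles `δ` and `γ_1, …, γ_{g-1}`. -/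
def chosenCycles (g : ℕ) : Set (List (ℕ × ℕ)) :=
  {c | c = cycleDelta g ∨ ∃ i ∈ Finset.Icc 1 (g - 1), c = cycleGamma g i}

/-- The class of systems of arcs in `Ω` represented by a cycle. -/
def cycleClass {g : ℕ} (p : (Fin g → ℝ) × ℝ) (Ω : Set ℂ) (c : List (ℕ × ℕ)) :
    Set (List (ℝ → ℂ)) :=
  {L | List.Forall₂ (fun α e => α ∈ arcsJoining Ω (edge p e.1) (edge p e.2)) L c}

/-- The extremal length of a cycle in `Ω_{G dh}`. -/
def extGdh {g : ℕ} (c : List (ℕ × ℕ)) (p : (Fin g → ℝ) × ℝ) : ℝ≥0∞ :=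
  extremalLength (OmegaGdh p) (cycleClass p (OmegaGdh p) c)

/-- The extremal length of a cycle in `Ω_{G⁻¹ dh}`. -/
def extInvGdh {g : ℕ} (c : List (ℕ × ℕ)) (p : (Fin g → ℝ) × ℝ) : ℝ≥0∞ :=
  extremalLength (OmegaInvGdh p) (cycleClass p (OmegaInvGdh p) c)

/-- The height of a single cycle. -/
def cycleHeight {g : ℕ} (c : List (ℕ × ℕ)) (p : (Fin g → ℝ) × ℝ) : ℝ :=
  |Real.exp (1 / (extGdh c p).toReal) - Real.exp (1 / (extInvGdh c p).toReal)| ^ 2 +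
    |Real.exp (extGdh c p).toReal - Real.exp (extInvGdh c p).toReal| ^ 2

/-- The height function `∑_{i=1}^{g-1} H(γ_i) + H(δ)`. -/
def height (g : ℕ) (p : (Fin g → ℝ) × ℝ) : ℝ :=
  ∑ i ∈ Finset.Icc 1 (g - 1), cycleHeight (cycleGamma g i) p + cycleHeight (cycleDelta g) p

end Scherk

end

/-! The extremal length of the arcs joining two boundary sets `A`, `B` of a plane domain is the
reciprocal of a least Dirichlet energy. A least energy depends analytically on the domain, because
after pulling back to a fixed domain it is the infimum of a quadratic form with analytic
coefficients over a fixed affine subspace of a Hilbert space.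

Duality (`extremalLength_eq_inv_minEnergy`). The boundary condition is expressed through arcs: a
potential increases by 1 along every arc from `A` to `B`, except for arcs of infinite length in some
metric of finite area. This needs no regularity of the boundary. The gradient of a potential, plus a
small multiple of the exceptional metric, is an admissible metric, which gives one inequality. For
the other, an admissible metric is averaged over disks whose radius varies smoothly and vanishes off
the domain. The averaging displacements are then injective maps that preserve the domain and fix the
boundary, so they permute admissible arcs and change lengths and areas by factors close to 1. The
averaged metric is continuous; its distance from `A`, truncated at 1 and averaged again, is a `C¹`
potential with almost no more energy than the area of the original metric.

Analyticity (`exists_analyticAt_minEnergy`). Close to a parameter `p₀` the domains and edges are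
images of those at `p₀` under diffeomorphisms of the plane `z + ∑ x_k Y_k(z)`, with `x` analytic in
`p` (`IsDeformable`). Composition with them identifies the potentials and turns the energy into a
form `⟨Q(x) f, f⟩` on `L²` with `Q` analytic and `Q(0) = 1`. The minimizer solves a linear equation
with analytic, invertible coefficients (`exists_analyticAt_isGLB`).

Positivity and finiteness. An explicit function of `x + y` has finite energy, so extremal lengths
are positive. Families of polygonal arcs that sweep out corridors along the staircase bound extremal
lengths from above (`extremalLength_lt_top_of_sweep`).

The cycles `γ_i` consist of pairs of arcs. Symmetrizing metrics in the line `y = -x`, and reflecting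
the part of an arc beyond that line, reduces them to single arcs joining symmetric unions of edges,
with a factor 4 (`extremalLength_mirrorPairs`). Homothety invariance is the conformal invariance of
the Dirichlet energy, and in the height the squares absorb the absolute values. -/

noncomputable section
namespace Scherk

/-! ### Smooth variable-radius perturbations of the identity -/

/-- A `C¹` function that is positive exactly on `Ω` and has slope at most `ε`. -/
structure IsRadius (Ω : Set ℂ) (ε : ℝ) (r : ℂ → ℝ) : Prop where
  contDiff : ContDiff ℝ 1 r
  pos : ∀ z ∈ Ω, 0 < r z
  eq_zero : ∀ z ∉ Ω, r z = 0
  norm_fderiv_le : ∀ z, ‖fderiv ℝ r z‖ ≤ ε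

/-- The set is exhausted by bounded open pieces, each of which is the support of a nonnegative
function with compact support. A sum of these with small enough weights converges together with its
derivatives. -/
theorem exists_isRadius {Ω : Set ℂ} (hΩ : IsOpen Ω) {ε : ℝ} (hε : 0 < ε) :
    ∃ r, IsRadius Ω ε r := by
  have h1 : ∀ n : ℕ, ∃ f : ℂ → ℝ, f.support = Ω ∩ Metric.ball 0 n ∧ ContDiff ℝ 1 f ∧
      (∀ z, 0 ≤ f z) ∧ HasCompactSupport f := by
    intro n
    obtain ⟨f, hs, hf, hr⟩ :=
      (hΩ.inter (Metric.isOpen_ball (x := (0 : ℂ)) (ε := n))).exists_contDiff_support_eq (n := 1)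
    refine ⟨f, hs, hf, fun z => (hr (mem_range_self z)).1, ?_⟩
    refine HasCompactSupport.of_support_subset_isCompact
      (isCompact_closedBall (0 : ℂ) n) ?_
    rw [hs]
    exact inter_subset_right.trans Metric.ball_subset_closedBall
  choose f hs hf hf0 hfc using h1
  have h2 : ∀ n, ∃ C : ℝ, 0 < C ∧ ∀ k ≤ 1, ∀ z, ‖iteratedFDeriv ℝ k (f n) z‖ ≤ C := by
    intro n
    have : ∀ k : ℕ, k ≤ 1 → ∃ C : ℝ, ∀ z, ‖iteratedFDeriv ℝ k (f n) z‖ ≤ C := by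
      intro k hk
      exact ((hfc n).iteratedFDeriv k).exists_bound_of_continuous
        ((hf n).continuous_iteratedFDeriv (by exact_mod_cast hk))
    obtain ⟨C0, h0⟩ := this 0 zero_le_one
    obtain ⟨C1, h1⟩ := this 1 le_rfl
    refine ⟨|C0| + |C1| + 1, by positivity, fun k hk z => ?_⟩
    interval_cases k
    · linarith [h0 z, le_abs_self C0, abs_nonneg C1]
    · linarith [h1 z, le_abs_self C1, abs_nonneg C0]
  choose C hC hCb using h2
  -- With these weights the `n`-th term and its derivative are at most `ε / 2 ^ (n + 1)`, and these
  -- bounds add up to `ε`.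
  set c : ℕ → ℝ := fun n => ε * (1 / 2) ^ (n + 1) / C n with hc
  have hcpos : ∀ n, 0 < c n := fun n => by have := hC n; simp only [hc]; positivity
  have hb : ∀ k : ℕ, ∀ n z, k ≤ 1 →
      ‖iteratedFDeriv ℝ k (fun z => c n * f n z) z‖ ≤ ε * (1 / 2) ^ (n + 1) := by
    intro k n z hk
    have : iteratedFDeriv ℝ k (fun z => c n * f n z) z = c n • iteratedFDeriv ℝ k (f n) z := by
      change iteratedFDeriv ℝ k (c n • f n) z = _
      exact iteratedFDeriv_const_smul_apply
        ((hf n).contDiffAt.of_le (by exact_mod_cast hk))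
    rw [this, norm_smul, Real.norm_of_nonneg (hcpos n).le]
    calc c n * _ ≤ c n * C n := by gcongr; exacts [(hcpos n).le, hCb n k hk z]
      _ = _ := by simp only [hc]; field_simp [(hC n).ne']
  have hsum : HasSum (fun n : ℕ => ε * (1 / 2 : ℝ) ^ (n + 1)) ε := by
    have := (hasSum_geometric_two' ε)
    convert this using 2 with n
    rw [pow_succ]; field_simp; rw [← mul_pow]; norm_num
  have hcd : ContDiff ℝ ((1 : ℕ∞) : WithTop ℕ∞) (fun z => ∑' n, c n * f n z) :=
    contDiff_tsum (v := fun _ n => ε * (1 / 2) ^ (n + 1))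
      (fun n => contDiff_const.mul (hf n)) (fun _ _ => hsum.summable)
      (fun k n z hk => hb k n z (by exact_mod_cast hk))
  have hS : ∀ z, Summable fun n => c n * f n z := fun z =>
    Summable.of_norm_bounded hsum.summable (fun n => by simpa using hb 0 n z zero_le_one)
  refine ⟨fun z => ∑' n, c n * f n z, hcd, fun z hz => ?_, fun z hz => ?_, fun z => ?_⟩
  · obtain ⟨n, hn⟩ := exists_nat_gt ‖z‖
    have : z ∈ (f n).support := by rw [hs]; exact ⟨hz, by simpa using hn⟩
    exact (hS z).tsum_pos (fun i => mul_nonneg (hcpos i).le (hf0 i z)) n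
      (mul_pos (hcpos n) (lt_of_le_of_ne (hf0 n z) (Ne.symm this)))
  · have : ∀ n, f n z = 0 := fun n => by
      by_contra h
      have : z ∈ (f n).support := h
      rw [hs] at this
      exact hz this.1
    simp [this]
  · have hd := fun n => ((contDiff_const (c := c n)).mul (hf n)).differentiable one_ne_zero
    have hb1 : ∀ n z, ‖fderiv ℝ (fun z => c n * f n z) z‖ ≤ ε * (1 / 2) ^ (n + 1) := fun n z => by
      simpa using hb 1 n z le_rfl
    rw [fderiv_tsum (u := fun n => ε * (1 / 2) ^ (n + 1)) hsum.summable hd hb1 (hS 0)]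
    exact tsum_of_norm_bounded hsum (fun n => hb1 n z)

/-- Moving `z` by `r z` in the direction `w`. -/
def push (r : ℂ → ℝ) (w z : ℂ) : ℂ := z + r z • w

namespace IsRadius

variable {Ω : Set ℂ} {ε : ℝ} {r : ℂ → ℝ}

theorem abs_sub_le (hr : IsRadius Ω ε r) (z z' : ℂ) : |r z' - r z| ≤ ε * ‖z' - z‖ :=
  Convex.norm_image_sub_le_of_norm_fderiv_le (𝕜 := ℝ) (s := univ)
    (fun x _ => (hr.contDiff.differentiable one_ne_zero) x)
    (fun x _ => hr.norm_fderiv_le x) convex_univ (mem_univ _) (mem_univ _)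

theorem push_of_notMem (hr : IsRadius Ω ε r) {z : ℂ} (hz : z ∉ Ω) (w : ℂ) : push r w z = z := by
  simp [push, hr.eq_zero z hz]

/-- A radius with slope at most 1 that vanishes off `Ω` never exceeds the distance to the
complement, so a displacement shorter than the radius cannot leave `Ω`. -/
theorem push_mem (hr : IsRadius Ω ε r) (hε : ε ≤ 1) {w z : ℂ} (hw : ‖w‖ < 1)
    (hz : z ∈ Ω) : push r w z ∈ Ω := by
  by_contra h
  have h1 := hr.abs_sub_le (push r w z) z
  have hp := hr.pos z hz
  rw [hr.eq_zero _ h, sub_zero, abs_of_pos hp] at h1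
  simp only [push, sub_add_cancel_left, norm_neg, norm_smul, Real.norm_of_nonneg hp.le] at h1
  have h2 : ε * (r z * ‖w‖) ≤ 1 * (r z * ‖w‖) := by gcongr
  nlinarith

theorem hasFDerivAt_push (hr : IsRadius Ω ε r) (w z : ℂ) :
    HasFDerivAt (push r w) (1 + (fderiv ℝ r z).smulRight w) z :=
  (hasFDerivAt_id z).add
    (((hr.contDiff.differentiable one_ne_zero) z).hasFDerivAt.smul_const w)

theorem contDiff_push (hr : IsRadius Ω ε r) (w : ℂ) : ContDiff ℝ 1 (push r w) :=
  contDiff_id.add (hr.contDiff.smul contDiff_const)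

theorem norm_smulRight_le (hr : IsRadius Ω ε r) {w : ℂ} (hw : ‖w‖ ≤ 1) (z : ℂ) :
    ‖(fderiv ℝ r z).smulRight w‖ ≤ ε := by
  rw [ContinuousLinearMap.norm_smulRight_apply]
  have := hr.norm_fderiv_le z
  nlinarith [norm_nonneg w, norm_nonneg (fderiv ℝ r z)]

/-- The displacement `r z • w` is a contraction as a function of `z`, and the identity plus a
contraction is injective. -/
theorem push_injective (hr : IsRadius Ω ε r) (hε : ε < 1) {w : ℂ} (hw : ‖w‖ ≤ 1) :
    Function.Injective (push r w) := by
  intro z z' h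
  by_contra hne
  have h1 : z' - z = (r z - r z') • w := by
    rw [sub_smul]; simp only [push] at h; linear_combination -h
  have h2 : ‖z' - z‖ ≤ ε * ‖z' - z‖ := by
    calc ‖z' - z‖ = |r z - r z'| * ‖w‖ := by rw [h1, norm_smul]; rfl
      _ ≤ ε * ‖z - z'‖ * 1 := by
        gcongr
        · exact (abs_nonneg _).trans (hr.abs_sub_le z' z)
        · exact hr.abs_sub_le z' z
      _ = _ := by rw [mul_one, norm_sub_rev]
  have : 0 < ‖z' - z‖ := norm_pos_iff.2 (sub_ne_zero.2 (Ne.symm hne))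
  nlinarith

end IsRadius

/-! ### Determinants of perturbations of the identity of the plane -/

theorem det_eq (L : ℂ →L[ℝ] ℂ) :
    L.det = (L 1).re * (L Complex.I).im - (L Complex.I).re * (L 1).im := by
  rw [ContinuousLinearMap.det, ← LinearMap.det_toMatrix Complex.basisOneI, Matrix.det_fin_two]
  simp [LinearMap.toMatrix_apply]

theorem abs_det_le (L : ℂ →L[ℝ] ℂ) : |L.det| ≤ 2 * ‖L‖ ^ 2 := by
  have h1 : ‖L 1‖ ≤ ‖L‖ := by simpa using L.le_opNorm 1
  have h2 : ‖L Complex.I‖ ≤ ‖L‖ := by simpa using L.le_opNorm Complex.I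
  have a := (Complex.abs_re_le_norm (L 1)).trans h1
  have b := (Complex.abs_im_le_norm (L 1)).trans h1
  have c := (Complex.abs_re_le_norm (L Complex.I)).trans h2
  have d := (Complex.abs_im_le_norm (L Complex.I)).trans h2
  rw [det_eq]
  refine (abs_sub _ _).trans ?_
  rw [abs_mul, abs_mul]
  nlinarith [mul_le_mul a d (abs_nonneg _) (norm_nonneg _),
    mul_le_mul c b (abs_nonneg _) (norm_nonneg _)]

/-- In dimension two `det (1 + L) = 1 + tr L + det L`. -/
theorem abs_det_one_add_sub_one_le (L : ℂ →L[ℝ] ℂ) :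
    |(1 + L).det - 1| ≤ 2 * ‖L‖ + 2 * ‖L‖ ^ 2 := by
  have h1 : ‖L 1‖ ≤ ‖L‖ := by simpa using L.le_opNorm 1
  have h2 : ‖L Complex.I‖ ≤ ‖L‖ := by simpa using L.le_opNorm Complex.I
  have a := (Complex.abs_re_le_norm (L 1)).trans h1
  have d := (Complex.abs_im_le_norm (L Complex.I)).trans h2
  have h : (1 + L).det - 1 = (L 1).re + (L Complex.I).im + L.det := by
    rw [det_eq, det_eq]; simp; ring
  rw [h]
  linarith [abs_add_le ((L 1).re + (L Complex.I).im) L.det,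
    abs_add_le (L 1).re (L Complex.I).im, abs_det_le L]

end Scherk
end

noncomputable section
namespace Scherk

/-! ### Images of arcs under differentiable maps -/

theorem comp_mem_arcsJoining {Ω A B Ω' A' B' : Set ℂ} {Φ : ℂ → ℂ} (hΦ : ContDiff ℝ 1 Φ)
    (hΩ : MapsTo Φ Ω Ω') (hA : MapsTo Φ A A') (hB : MapsTo Φ B B') {α : ℝ → ℂ}
    (hα : α ∈ arcsJoining Ω A B) : Φ ∘ α ∈ arcsJoining Ω' A' B' :=
  ⟨hΦ.continuous.comp_continuousOn hα.1, hΦ.comp_contDiffOn hα.2.1,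
    fun _ ht => hΩ (hα.2.2.1 ht), hA hα.2.2.2.1, hB hα.2.2.2.2⟩

theorem hasDerivAt_of_contDiffOn {α : ℝ → ℂ} {s : Set ℝ} (hs : IsOpen s)
    (hα : ContDiffOn ℝ 1 α s) {t : ℝ} (ht : t ∈ s) : HasDerivAt α (deriv α t) t :=
  ((hα.differentiableOn one_ne_zero).differentiableAt (hs.mem_nhds ht)).hasDerivAt

theorem enorm_deriv_comp_le {α : ℝ → ℂ} {Φ : ℂ → ℂ} {t : ℝ} {C : ℝ≥0}
    (hα : HasDerivAt α (deriv α t) t) (hΦ : DifferentiableAt ℝ Φ (α t))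
    (hC : ‖fderiv ℝ Φ (α t)‖ ≤ C) : ‖deriv (Φ ∘ α) t‖ₑ ≤ C * ‖deriv α t‖ₑ := by
  rw [(hΦ.hasFDerivAt.comp_hasDerivAt t hα).deriv]
  have h : ‖fderiv ℝ Φ (α t) (deriv α t)‖₊ ≤ C * ‖deriv α t‖₊ := by
    rw [← NNReal.coe_le_coe]
    push_cast
    exact (ContinuousLinearMap.le_opNorm _ _).trans (by gcongr)
  simp only [enorm_eq_nnnorm]
  exact_mod_cast h

/-- The length of the part of an arc with parameter in `s`. -/
def pathLength (ρ : ℂ → ℝ≥0) (α : ℝ → ℂ) (s : Set ℝ) : ℝ≥0∞ :=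
  ∫⁻ t in s, (ρ (α t) : ℝ≥0∞) * ‖deriv α t‖ₑ

theorem arcLength_eq_pathLength (ρ : ℂ → ℝ≥0) (α : ℝ → ℂ) :
    arcLength ρ α = pathLength ρ α (Ioo 0 1) := rfl

theorem pathLength_comp_le {Φ : ℂ → ℂ} {Ω : Set ℂ} {α : ℝ → ℂ} {C : ℝ≥0} {s : Set ℝ}
    (ρ : ℂ → ℝ≥0) (hs : IsOpen s) (hα : ContDiffOn ℝ 1 α s) (hαΩ : MapsTo α s Ω)
    (hΦ : ContDiff ℝ 1 Φ) (hC : ∀ z ∈ Ω, ‖fderiv ℝ Φ z‖ ≤ C) :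
    pathLength ρ (Φ ∘ α) s ≤ C * pathLength (ρ ∘ Φ) α s := by
  rw [pathLength, pathLength, ← lintegral_const_mul' _ _ ENNReal.coe_ne_top]
  refine setLIntegral_mono' hs.measurableSet fun t ht => ?_
  calc (ρ ((Φ ∘ α) t) : ℝ≥0∞) * ‖deriv (Φ ∘ α) t‖ₑ
      ≤ (ρ ((Φ ∘ α) t) : ℝ≥0∞) * (C * ‖deriv α t‖ₑ) := by
        gcongr
        exact enorm_deriv_comp_le (hasDerivAt_of_contDiffOn hs hα ht)
          (hΦ.differentiable one_ne_zero _) (hC _ (hαΩ ht))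
    _ = _ := by rw [mul_left_comm]; rfl

theorem arcLength_const_mul (c : ℝ≥0) (ρ : ℂ → ℝ≥0) (α : ℝ → ℂ) :
    arcLength (fun z => c * ρ z) α = c * arcLength ρ α := by
  rw [arcLength, arcLength, ← lintegral_const_mul' _ _ ENNReal.coe_ne_top]
  simp only [ENNReal.coe_mul, mul_assoc]

theorem area_const_mul (c : ℝ≥0) (ρ : ℂ → ℝ≥0) (Ω : Set ℂ) :
    area (fun z => c * ρ z) Ω = (c : ℝ≥0∞) ^ 2 * area ρ Ω := by
  rw [area, area, ← lintegral_const_mul' _ _ (by simp)]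
  simp only [ENNReal.coe_mul, mul_pow]

theorem aemeasurable_comp_arc {α : ℝ → ℂ} {s : Set ℝ} (hs : MeasurableSet s)
    (hα : ContinuousOn α s) : AEMeasurable α (volume.restrict s) :=
  hα.aemeasurable hs

theorem arcLength_add {α : ℝ → ℂ} (hα : ContDiffOn ℝ 1 α (Ioo 0 1)) {ρ : ℂ → ℝ≥0}
    (hρ : Measurable ρ) (ρ' : ℂ → ℝ≥0) :
    arcLength (fun z => ρ z + ρ' z) α = arcLength ρ α + arcLength ρ' α := by
  rw [arcLength, arcLength, arcLength, ← lintegral_add_left']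
  · simp only [ENNReal.coe_add, add_mul]
  · exact ((hρ.coe_nnreal_ennreal.comp_aemeasurable
      (aemeasurable_comp_arc measurableSet_Ioo hα.continuousOn))).mul
      (measurable_deriv α).enorm.aemeasurable

/-! ### Mollification with a variable radius -/

/-- A smooth bump function supported in the unit disk. -/
def bump : ContDiffBump (0 : ℂ) := ⟨1 / 2, 1, by norm_num, by norm_num⟩

/-- A probability measure on the unit disk with smooth density. -/
def bumpMeasure : Measure ℂ :=
  volume.withDensity fun w => ENNReal.ofReal (bump.normed volume w)

theorem measurable_bump_normed : Measurable fun w => bump.normed (volume : Measure ℂ) w :=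
  bump.continuous_normed.measurable

instance : IsProbabilityMeasure bumpMeasure := by
  refine ⟨?_⟩
  rw [bumpMeasure, withDensity_apply _ MeasurableSet.univ, Measure.restrict_univ,
    ← ofReal_integral_eq_lintegral_ofReal bump.integrable_normed
      (Filter.Eventually.of_forall bump.nonneg_normed), bump.integral_normed, ENNReal.ofReal_one]

theorem ae_norm_lt_one : ∀ᵐ w ∂bumpMeasure, ‖w‖ < 1 := by
  rw [bumpMeasure, ae_withDensity_iff measurable_bump_normed.ennreal_ofReal]
  refine Filter.Eventually.of_forall fun w hw => ?_
  by_contra h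
  apply hw
  have : w ∉ Function.support (bump.normed (volume : Measure ℂ)) := by
    rw [bump.support_normed_eq]
    simpa [bump] using h
  rw [Function.notMem_support.1 this, ENNReal.ofReal_zero]

theorem integral_bumpMeasure (f : ℂ → ℝ) :
    ∫ w, f w ∂bumpMeasure = ∫ w, bump.normed volume w * f w := by
  rw [bumpMeasure, integral_withDensity_eq_integral_toReal_smul
    measurable_bump_normed.ennreal_ofReal (by simp)]
  refine integral_congr_ae (Filter.Eventually.of_forall fun w => ?_)
  simp [ENNReal.toReal_ofReal (bump.nonneg_normed w)]

/-- The average of `f` over the disk of radius `r z` at `z`, weighted with a smooth bump. -/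
def mollify (r : ℂ → ℝ) (f : ℂ → ℝ) (z : ℂ) : ℝ := ∫ w, f (push r w z) ∂bumpMeasure

/-- Substituting `t = -r z • w` turns the average into a convolution evaluated at `z`, with the
radius as a parameter of the kernel. In this form smoothness in `z` can be read off, although `f` is
only locally integrable. -/
theorem mollify_eq_convolution {r : ℂ → ℝ} {f : ℂ → ℝ} {z : ℂ} (hz : 0 < r z) :
    mollify r f z = convolution f
      (fun x => (r z)⁻¹ ^ 2 * bump.normed volume ((r z)⁻¹ • x)) (ContinuousLinearMap.mul ℝ ℝ)
      volume z := by
  rw [convolution_eq_swap, mollify, integral_bumpMeasure]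
  have h := Measure.integral_comp_smul (volume : Measure ℂ) (fun t => (ContinuousLinearMap.mul ℝ ℝ)
    (f (z - t)) ((r z)⁻¹ ^ 2 * bump.normed volume ((r z)⁻¹ • t))) (-(r z))
  rw [Complex.finrank_real_complex, neg_sq, abs_of_pos (inv_pos.2 (pow_pos hz 2)),
    smul_eq_mul] at h
  rw [← mul_right_inj' (inv_ne_zero (pow_pos hz 2).ne'), ← h, ← integral_const_mul]
  congr 1
  ext w
  have e1 : (r z)⁻¹ • (-(r z) • w) = -w := by rw [smul_smul]; field_simp [hz.ne']; simp
  simp only [e1, bump.normed_neg, push, ContinuousLinearMap.mul_apply']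
  rw [neg_smul, sub_neg_eq_add]
  ring

/-- The convolution is `C¹` jointly in the radius and the point; the mollification is its
composition with `z ↦ (r z, z)`. -/
theorem contDiffOn_mollify {Ω : Set ℂ} (hΩ : IsOpen Ω) {ε : ℝ} {r : ℂ → ℝ} (hr : IsRadius Ω ε r)
    {f : ℂ → ℝ} (hf : LocallyIntegrable f) : ContDiffOn ℝ 1 (mollify r f) Ω := by
  intro z hz
  refine ContDiffAt.contDiffWithinAt ?_
  -- A bound for the radii close to `z`: all the kernels in question then vanish outside one compact
  -- disk.
  set R := r z + 1
  have hR : 0 < R := by have := hr.pos z hz; positivity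
  have h := contDiffOn_convolution_right_with_param (𝕜 := ℝ) (P := ℝ) (n := 1) (μ := volume)
    (f := f) (ContinuousLinearMap.mul ℝ ℝ)
    (g := fun p x => p⁻¹ ^ 2 * bump.normed volume (p⁻¹ • x)) (s := Ioo 0 R)
    (k := Metric.closedBall (0 : ℂ) R) isOpen_Ioo (isCompact_closedBall _ _)
    (by
      intro p x hp hx
      have : p⁻¹ • x ∉ Function.support (bump.normed (volume : Measure ℂ)) := by
        rw [bump.support_normed_eq]
        simp only [Metric.mem_closedBall, dist_zero_right, not_le] at hx
        simp only [bump, Metric.mem_ball, dist_zero_right, norm_smul, norm_inv, not_lt,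
          Real.norm_of_nonneg hp.1.le]
        rw [← div_eq_inv_mul, le_div_iff₀ hp.1]
        linarith [hp.2]
      rw [Function.notMem_support.1 this, mul_zero])
    hf
    (by
      have hi : ContDiffOn ℝ ((1 : ℕ∞) : WithTop ℕ∞) (fun q : ℝ × ℂ => q.1⁻¹) (Ioo 0 R ×ˢ univ) :=
        contDiff_fst.contDiffOn.inv fun q hq => hq.1.1.ne'
      exact (hi.pow 2).mul (bump.contDiff_normed.comp_contDiffOn (hi.smul contDiff_snd.contDiffOn)))
  have hmem : (r z, z) ∈ Ioo 0 R ×ˢ (univ : Set ℂ) :=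
    ⟨⟨hr.pos z hz, by simp [R]⟩, mem_univ _⟩
  have h1 := ContDiffAt.comp (f := fun z' => (r z', z')) z
    (h.contDiffAt ((isOpen_Ioo.prod isOpen_univ).mem_nhds hmem))
    ((hr.contDiff.contDiffAt (x := z)).prodMk contDiffAt_id)
  refine h1.congr_of_eventuallyEq ?_
  filter_upwards [hΩ.mem_nhds hz] with z' hz'
  exact mollify_eq_convolution (hr.pos z' hz')

theorem measurable_push {r : ℂ → ℝ} (hr : Continuous r) :
    Measurable fun q : ℂ × ℂ => push r q.1 q.2 := by
  have : Continuous fun q : ℂ × ℂ => push r q.1 q.2 := by unfold push; fun_prop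
  exact this.measurable

/-- The mollification of a conformal metric on `Ω`. -/
def mollifyMetric (Ω : Set ℂ) (r : ℂ → ℝ) (ρ : ℂ → ℝ≥0) (z : ℂ) : ℝ≥0 :=
  (∫⁻ w, ((Ω.indicator ρ (push r w z) : ℝ≥0) : ℝ≥0∞) ∂bumpMeasure).toNNReal

/-- Finite area says that the metric, extended by zero, lies in `L²`. -/
theorem locallyIntegrable_indicator {Ω : Set ℂ} (hΩ : MeasurableSet Ω) {ρ : ℂ → ℝ≥0}
    (hρ : Measurable ρ) (ha : area ρ Ω < ∞) :
    LocallyIntegrable (fun z => ((Ω.indicator ρ z : ℝ≥0) : ℝ)) := by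
  have hm : Measurable fun z => ((Ω.indicator ρ z : ℝ≥0) : ℝ) :=
    (hρ.indicator hΩ).coe_nnreal_real
  have : MemLp (fun z => ((Ω.indicator ρ z : ℝ≥0) : ℝ)) 2 := by
    refine ⟨hm.aestronglyMeasurable, ?_⟩
    rw [eLpNorm_lt_top_iff_lintegral_rpow_enorm_lt_top two_ne_zero ENNReal.ofNat_ne_top]
    refine lt_of_eq_of_lt ?_ ha
    rw [area, ← lintegral_indicator hΩ]
    refine lintegral_congr fun z => ?_
    by_cases hz : z ∈ Ω <;> simp [hz, enorm_eq_nnnorm]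
  exact this.locallyIntegrable (by norm_num)

section

variable {Ω : Set ℂ} {ε : ℝ} {r : ℂ → ℝ} {ρ : ℂ → ℝ≥0}

/-- The bump density is bounded and supported in the unit disk, so only the values of `f` on the
compact disk of radius `r z` about `z` matter. -/
theorem integrable_comp_push (hr : IsRadius Ω ε r) {f : ℂ → ℝ} (hf : LocallyIntegrable f)
    (hfm : Measurable f) {z : ℂ} (hz : z ∈ Ω) :
    Integrable (fun w => f (push r w z)) bumpMeasure := by
  have hrz := hr.pos z hz
  have h1 : IntegrableOn (fun w => f (push r w z)) (Metric.closedBall 0 1) := by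
    have h := hf.integrableOn_isCompact (isCompact_closedBall z (r z))
    rw [← integrable_indicator_iff Metric.isClosed_closedBall.measurableSet] at h ⊢
    have h2 := (h.comp_add_left z).comp_smul hrz.ne'
    refine h2.congr (Filter.Eventually.of_forall fun w => ?_)
    have : z + r z • w ∈ Metric.closedBall z (r z) ↔ w ∈ Metric.closedBall (0 : ℂ) 1 := by
      simp only [Metric.mem_closedBall, dist_self_add_left, norm_smul, Real.norm_of_nonneg hrz.le,
        dist_zero_right]
      exact ⟨fun h => by nlinarith, fun h => by nlinarith⟩
    by_cases hw : w ∈ Metric.closedBall (0 : ℂ) 1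
    · simp only [indicator, this, hw, if_true, push]
    · simp only [indicator, this, hw, if_false]
  have hm : Measurable fun w => f (push r w z) :=
    hfm.comp ((measurable_push hr.contDiff.continuous).comp (measurable_id.prodMk measurable_const))
  obtain ⟨C, hC⟩ := bump.continuous_normed.norm.bddAbove_range_of_hasCompactSupport
    (bump.hasCompactSupport_normed (μ := (volume : Measure ℂ))).norm
  rw [bumpMeasure, integrable_withDensity_iff_integrable_smul']
  · have h3 : Integrable (fun w => bump.normed volume w * (Metric.closedBall 0 1).indicator
        (fun w => f (push r w z)) w) := by
      refine ((integrable_indicator_iff Metric.isClosed_closedBall.measurableSet).2 h1).bdd_mul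
        (c := C) bump.continuous_normed.aestronglyMeasurable
        (Filter.Eventually.of_forall fun w => hC (mem_range_self w))
    refine h3.congr (Filter.Eventually.of_forall fun w => ?_)
    simp only [ENNReal.toReal_ofReal (bump.nonneg_normed w), smul_eq_mul]
    by_cases hw : w ∈ Metric.closedBall (0 : ℂ) 1
    · rw [indicator_of_mem hw]
    · have : w ∉ Function.support (bump.normed (volume : Measure ℂ)) := by
        rw [bump.support_normed_eq]
        exact fun h => hw (Metric.ball_subset_closedBall (by simpa [bump] using h))
      rw [Function.notMem_support.1 this, zero_mul, zero_mul]
  · exact measurable_bump_normed.ennreal_ofReal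
  · simp

theorem measurable_mollifyMetric (hΩ : MeasurableSet Ω) (hr : Continuous r) (hρ : Measurable ρ) :
    Measurable (mollifyMetric Ω r ρ) := by
  refine Measurable.ennreal_toNNReal ?_
  refine Measurable.lintegral_prod_right' (f := fun q : ℂ × ℂ =>
    ((Ω.indicator ρ (push r q.2 q.1) : ℝ≥0) : ℝ≥0∞)) ?_
  exact ((hρ.indicator hΩ).comp ((measurable_push hr).comp measurable_swap)).coe_nnreal_ennreal

/-- The average is finite at every point of `Ω`, so truncating it to a nonnegative real loses
nothing, and it agrees with the real-valued mollification. -/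
theorem mollifyMetric_coe (hΩ : MeasurableSet Ω) (hr : IsRadius Ω ε r) (hρ : Measurable ρ)
    (ha : area ρ Ω < ∞) {z : ℂ} (hz : z ∈ Ω) :
    (mollifyMetric Ω r ρ z : ℝ≥0∞) = ∫⁻ w, ((Ω.indicator ρ (push r w z) : ℝ≥0) : ℝ≥0∞) ∂bumpMeasure ∧
    (mollifyMetric Ω r ρ z : ℝ) = mollify r (fun z => ((Ω.indicator ρ z : ℝ≥0) : ℝ)) z := by
  have hm := (hρ.indicator hΩ).coe_nnreal_real
  have hi := integrable_comp_push hr (locallyIntegrable_indicator hΩ hρ ha) hm hz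
  have h := ofReal_integral_eq_lintegral_ofReal hi
    (Filter.Eventually.of_forall fun w => NNReal.coe_nonneg _)
  simp only [ENNReal.ofReal_coe_nnreal] at h
  constructor
  · rw [mollifyMetric, ENNReal.coe_toNNReal]
    rw [← h]; exact ENNReal.ofReal_ne_top
  · rw [mollifyMetric, mollify, ← h, ENNReal.ofReal, ENNReal.toNNReal_coe]
    exact Real.coe_toNNReal _ (integral_nonneg fun w => NNReal.coe_nonneg _)

theorem continuousOn_mollifyMetric (hΩ : IsOpen Ω) (hr : IsRadius Ω ε r) (hρ : Measurable ρ)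
    (ha : area ρ Ω < ∞) : ContinuousOn (mollifyMetric Ω r ρ) Ω := by
  have h := (contDiffOn_mollify hΩ hr
    (locallyIntegrable_indicator hΩ.measurableSet hρ ha)).continuousOn
  refine NNReal.isEmbedding_coe.continuousOn_iff.2 (h.congr fun z hz => ?_)
  exact (mollifyMetric_coe hΩ.measurableSet hr hρ ha hz).2

end

end Scherk
end

/-! ### Area and length estimates for mollified metrics -/

noncomputable section
namespace Scherk

theorem sq_lintegral_le {X : Type*} [MeasurableSpace X] {ν : Measure X} [IsProbabilityMeasure ν]
    {f : X → ℝ≥0∞} (hf : AEMeasurable f ν) : (∫⁻ x, f x ∂ν) ^ 2 ≤ ∫⁻ x, f x ^ 2 ∂ν := by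
  have h := ENNReal.lintegral_mul_le_Lp_mul_Lq ν Real.HolderConjugate.two_two hf
    (aemeasurable_const (b := (1 : ℝ≥0∞)))
  simp only [Pi.mul_apply, mul_one, ENNReal.one_rpow, lintegral_const, measure_univ] at h
  calc (∫⁻ x, f x ∂ν) ^ 2 ≤ ((∫⁻ x, f x ^ (2 : ℝ) ∂ν) ^ (1 / 2 : ℝ)) ^ 2 := by gcongr
    _ = ∫⁻ x, f x ^ 2 ∂ν := by
      rw [← ENNReal.rpow_natCast, ← ENNReal.rpow_mul]
      norm_num

section

variable {Ω : Set ℂ} {ε : ℝ} {r : ℂ → ℝ} {ρ : ℂ → ℝ≥0}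

/-- Change of variables: the displacement maps `Ω` injectively into itself, with Jacobian at least
`1 - (2 * ε + 2 * ε ^ 2)`. -/
theorem lintegral_comp_push_le (hΩ : MeasurableSet Ω) (hr : IsRadius Ω ε r)
    (hε : 2 * ε + 2 * ε ^ 2 < 1) {w : ℂ} (hw : ‖w‖ < 1) (f : ℂ → ℝ≥0∞) :
    ∫⁻ z in Ω, f (push r w z) ≤
      ENNReal.ofReal (1 - (2 * ε + 2 * ε ^ 2))⁻¹ * ∫⁻ z in Ω, f z := by
  have hε1 : ε < 1 := by nlinarith
  have h0 : 0 < 1 - (2 * ε + 2 * ε ^ 2) := by linarith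
  have h := lintegral_image_eq_lintegral_abs_det_fderiv_mul volume hΩ
    (fun z _ => (hr.hasFDerivAt_push w z).hasFDerivWithinAt)
    ((hr.push_injective hε1 hw.le).injOn) f
  have h1 : ENNReal.ofReal (1 - (2 * ε + 2 * ε ^ 2)) * ∫⁻ z in Ω, f (push r w z) ≤
      ∫⁻ z in Ω, f z := by
    calc _ = ∫⁻ z in Ω, ENNReal.ofReal (1 - (2 * ε + 2 * ε ^ 2)) * f (push r w z) :=
          (lintegral_const_mul' _ _ ENNReal.ofReal_ne_top).symm
      _ ≤ ∫⁻ z in push r w '' Ω, f z := by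
          rw [h]
          refine lintegral_mono fun z => ?_
          gcongr
          have hb := hr.norm_smulRight_le hw.le z
          have hd := abs_det_one_add_sub_one_le ((fderiv ℝ r z).smulRight w)
          have : 2 * ‖(fderiv ℝ r z).smulRight w‖ + 2 * ‖(fderiv ℝ r z).smulRight w‖ ^ 2 ≤
              2 * ε + 2 * ε ^ 2 := by gcongr
          have h2 := (abs_le.1 (hd.trans this)).1
          exact le_trans (by linarith) (le_abs_self _)
      _ ≤ _ := lintegral_mono_set (image_subset_iff.2 fun z hz => hr.push_mem hε1.le hw hz)
  rw [ENNReal.ofReal_inv_of_pos h0, mul_comm, ← ENNReal.div_eq_inv_mul.trans (mul_comm _ _),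
    ENNReal.le_div_iff_mul_le (Or.inl (by simpa using h0)) (Or.inl ENNReal.ofReal_ne_top), mul_comm]
  exact h1

theorem measurable_indicator_push (hΩ : MeasurableSet Ω) (hr : Continuous r) (hρ : Measurable ρ) :
    Measurable fun q : ℂ × ℂ => ((Ω.indicator ρ (push r q.1 q.2) : ℝ≥0) : ℝ≥0∞) :=
  ((hρ.indicator hΩ).comp (measurable_push hr)).coe_nnreal_ennreal

/-- By Cauchy–Schwarz the square of an average is at most the average of the squares; after
exchanging the integrals, each displacement distorts area by a controlled factor. -/
theorem area_mollifyMetric_le (hΩ : MeasurableSet Ω) (hr : IsRadius Ω ε r)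
    (hε : 2 * ε + 2 * ε ^ 2 < 1) (hρ : Measurable ρ) (ha : area ρ Ω < ∞) :
    area (mollifyMetric Ω r ρ) Ω ≤ ENNReal.ofReal (1 - (2 * ε + 2 * ε ^ 2))⁻¹ * area ρ Ω := by
  have hm := measurable_indicator_push hΩ hr.contDiff.continuous hρ
  calc area (mollifyMetric Ω r ρ) Ω
      ≤ ∫⁻ z in Ω, ∫⁻ w, ((Ω.indicator ρ (push r w z) : ℝ≥0) : ℝ≥0∞) ^ 2 ∂bumpMeasure := by
        refine setLIntegral_mono' hΩ fun z hz => ?_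
        rw [(mollifyMetric_coe hΩ hr hρ ha hz).1]
        exact sq_lintegral_le (hm.comp (measurable_id.prodMk measurable_const)).aemeasurable
    _ = ∫⁻ w, (∫⁻ z in Ω, ((Ω.indicator ρ (push r w z) : ℝ≥0) : ℝ≥0∞) ^ 2) ∂bumpMeasure :=
        lintegral_lintegral_swap ((hm.comp measurable_swap).pow_const 2).aemeasurable
    _ ≤ ∫⁻ _w, ENNReal.ofReal (1 - (2 * ε + 2 * ε ^ 2))⁻¹ * area ρ Ω ∂bumpMeasure := by
        refine lintegral_mono_ae ?_
        filter_upwards [ae_norm_lt_one] with w hw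
        refine (lintegral_comp_push_le hΩ hr hε hw
          (fun z => ((Ω.indicator ρ z : ℝ≥0) : ℝ≥0∞) ^ 2)).trans_eq ?_
        congr 1
        exact setLIntegral_congr_fun hΩ fun z hz => by simp [hz]
    _ = _ := by simp

theorem norm_fderiv_push_le (hr : IsRadius Ω ε r) {w : ℂ} (hw : ‖w‖ < 1) (z : ℂ) :
    ‖fderiv ℝ (push r w) z‖ ≤ 1 + ε := by
  rw [(hr.hasFDerivAt_push w z).fderiv]
  refine (norm_add_le _ _).trans (add_le_add ?_ (hr.norm_smulRight_le hw.le z))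
  exact ContinuousLinearMap.norm_id_le

/-- A displacement stretches tangent vectors by at most `1 + ε`. Exchanging the average over
displacements with the integral along the arc makes the averaged metric appear. -/
theorem lintegral_pathLength_push_le (hΩ : IsOpen Ω) (hr : IsRadius Ω ε r) (hε0 : 0 ≤ ε)
    (hε1 : ε ≤ 1) (hρ : Measurable ρ) (ha : area ρ Ω < ∞) {α : ℝ → ℂ} {s : Set ℝ}
    (hs : IsOpen s) (hα : ContDiffOn ℝ 1 α s) (hαΩ : MapsTo α s Ω) :
    ∫⁻ w, pathLength ρ (push r w ∘ α) s ∂bumpMeasure ≤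
      ENNReal.ofReal (1 + ε) * pathLength (mollifyMetric Ω r ρ) α s := by
  have hm := measurable_indicator_push hΩ.measurableSet hr.contDiff.continuous hρ
  have hae : AEMeasurable (fun q : ℝ × ℂ => (q.2, α q.1))
      ((volume.restrict s).prod bumpMeasure) :=
    measurable_snd.aemeasurable.prodMk
      ((aemeasurable_comp_arc hs.measurableSet hα.continuousOn).comp_fst)
  have hsw : AEMeasurable (Function.uncurry fun (t : ℝ) (w : ℂ) =>
      ((Ω.indicator ρ (push r w (α t)) : ℝ≥0) : ℝ≥0∞) * ‖deriv α t‖ₑ)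
      ((volume.restrict s).prod bumpMeasure) :=
    (hm.comp_aemeasurable hae).mul
      ((measurable_deriv α).enorm.comp measurable_fst).aemeasurable
  calc ∫⁻ w, pathLength ρ (push r w ∘ α) s ∂bumpMeasure
      ≤ ∫⁻ w, (ENNReal.ofReal (1 + ε) * ∫⁻ t in s,
          ((Ω.indicator ρ (push r w (α t)) : ℝ≥0) : ℝ≥0∞) * ‖deriv α t‖ₑ) ∂bumpMeasure := by
        refine lintegral_mono_ae ?_
        filter_upwards [ae_norm_lt_one] with w hw
        refine (pathLength_comp_le (C := (1 + ε).toNNReal) ρ hs hα hαΩ (hr.contDiff_push w)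
          fun z _ => ?_).trans_eq ?_
        · rw [Real.coe_toNNReal _ (by linarith)]
          exact norm_fderiv_push_le hr hw z
        · rw [pathLength]
          congr 1
          refine setLIntegral_congr_fun hs.measurableSet fun t ht => ?_
          simp [hr.push_mem hε1 hw (hαΩ ht)]
    _ = ENNReal.ofReal (1 + ε) * ∫⁻ t in s, ∫⁻ w,
          ((Ω.indicator ρ (push r w (α t)) : ℝ≥0) : ℝ≥0∞) * ‖deriv α t‖ₑ ∂bumpMeasure := by
        rw [lintegral_const_mul' _ _ ENNReal.ofReal_ne_top, lintegral_lintegral_swap hsw]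
    _ = _ := by
        rw [pathLength]
        congr 1
        refine setLIntegral_congr_fun hs.measurableSet fun t ht => ?_
        rw [lintegral_mul_const' _ _ (by simp), (mollifyMetric_coe hΩ.measurableSet hr hρ ha (hαΩ ht)).1]

theorem push_comp_mem_arcsJoining {A B : Set ℂ} (hr : IsRadius Ω ε r) (hε1 : ε ≤ 1)
    (hA : A ⊆ Ωᶜ) (hB : B ⊆ Ωᶜ) {w : ℂ} (hw : ‖w‖ < 1) {α : ℝ → ℂ}
    (hα : α ∈ arcsJoining Ω A B) : push r w ∘ α ∈ arcsJoining Ω A B :=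
  comp_mem_arcsJoining (hr.contDiff_push w) (fun _ hz => hr.push_mem hε1 hw hz)
    (fun z hz => by rwa [hr.push_of_notMem (hA hz)])
    (fun z hz => by rwa [hr.push_of_notMem (hB hz)]) hα

/-- Displacements fix the complement of `Ω`, hence the ends of the arc. Each displaced arc thus
competes in the same class and has length at least 1, and so has their average. -/
theorem le_arcLength_mollifyMetric {A B : Set ℂ} (hΩ : IsOpen Ω) (hr : IsRadius Ω ε r)
    (hε0 : 0 ≤ ε) (hε1 : ε ≤ 1) (hA : A ⊆ Ωᶜ) (hB : B ⊆ Ωᶜ) (hρ : Measurable ρ)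
    (ha : area ρ Ω < ∞) (h1 : ∀ α ∈ arcsJoining Ω A B, 1 ≤ arcLength ρ α) {α : ℝ → ℂ}
    (hα : α ∈ arcsJoining Ω A B) :
    1 ≤ ENNReal.ofReal (1 + ε) * arcLength (mollifyMetric Ω r ρ) α := by
  refine le_trans ?_ (lintegral_pathLength_push_le hΩ hr hε0 hε1 hρ ha isOpen_Ioo hα.2.1 hα.2.2.1)
  calc (1 : ℝ≥0∞) = ∫⁻ _w, 1 ∂bumpMeasure := by simp
    _ ≤ _ := by
      refine lintegral_mono_ae ?_
      filter_upwards [ae_norm_lt_one] with w hw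
      exact h1 _ (push_comp_mem_arcsJoining hr hε1 hA hB hw hα)

end

end Scherk
end

noncomputable section
namespace Scherk

/-! ### Reparametrization and concatenation of arcs -/

/-- Injectivity of `τ` is not needed: stretches on which it is constant contribute nothing to either
side. This allows reparametrizations that wait at their ends. -/
theorem pathLength_comp_monotoneOn (ρ : ℂ → ℝ≥0) {α : ℝ → ℂ} {τ : ℝ → ℝ} {s : Set ℝ}
    (hs : MeasurableSet s) (hτ : Differentiable ℝ τ) (hm : MonotoneOn τ s)
    (hso : ∀ t ∈ s, 0 ≤ deriv τ t)
    (hα : ∀ t ∈ s, DifferentiableAt ℝ α (τ t)) :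
    pathLength ρ (α ∘ τ) s = pathLength ρ α (τ '' s) := by
  rw [pathLength, pathLength, lintegral_image_eq_lintegral_deriv_mul_of_monotoneOn hs
    (fun t _ => (hτ t).hasDerivAt.hasDerivWithinAt) hm]
  refine setLIntegral_congr_fun hs fun t ht => ?_
  have h : deriv (α ∘ τ) t = deriv τ t • deriv α (τ t) :=
    ((hα t ht).hasDerivAt.scomp t (hτ t).hasDerivAt).deriv
  simp only [h, enorm_smul, Function.comp_apply, Real.enorm_eq_ofReal (hso t ht)]
  ring

theorem pathLength_comp_antitoneOn (ρ : ℂ → ℝ≥0) {α : ℝ → ℂ} {τ : ℝ → ℝ} {s : Set ℝ}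
    (hs : MeasurableSet s) (hτ : Differentiable ℝ τ) (hm : AntitoneOn τ s)
    (hso : ∀ t ∈ s, deriv τ t ≤ 0)
    (hα : ∀ t ∈ s, DifferentiableAt ℝ α (τ t)) :
    pathLength ρ (α ∘ τ) s = pathLength ρ α (τ '' s) := by
  rw [pathLength, pathLength, lintegral_image_eq_lintegral_deriv_mul_of_antitoneOn hs
    (fun t _ => (hτ t).hasDerivAt.hasDerivWithinAt) hm]
  refine setLIntegral_congr_fun hs fun t ht => ?_
  have h : deriv (α ∘ τ) t = deriv τ t • deriv α (τ t) :=
    ((hα t ht).hasDerivAt.scomp t (hτ t).hasDerivAt).deriv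
  have h2 : ‖deriv τ t‖ₑ = ENNReal.ofReal (-deriv τ t) := by
    rw [← enorm_neg, Real.enorm_eq_ofReal (by linarith [hso t ht])]
  simp only [h, enorm_smul, Function.comp_apply, h2]
  ring

theorem pathLength_mono (ρ : ℂ → ℝ≥0) (α : ℝ → ℂ) {s t : Set ℝ} (h : s ⊆ t) :
    pathLength ρ α s ≤ pathLength ρ α t := lintegral_mono_set h

theorem pathLength_congr_ae (ρ : ℂ → ℝ≥0) (α : ℝ → ℂ) {s t : Set ℝ} (h : s =ᵐ[volume] t) :
    pathLength ρ α s = pathLength ρ α t := setLIntegral_congr h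

theorem pathLength_union_le (ρ : ℂ → ℝ≥0) (α : ℝ → ℂ) (s t : Set ℝ) :
    pathLength ρ α (s ∪ t) ≤ pathLength ρ α s + pathLength ρ α t := lintegral_union_le _ _ _

theorem pathLength_congr (ρ : ℂ → ℝ≥0) {α β : ℝ → ℂ} {s : Set ℝ} (hs : IsOpen s)
    (h : EqOn α β s) : pathLength ρ α s = pathLength ρ β s := by
  refine setLIntegral_congr_fun hs.measurableSet fun t ht => ?_
  have h1 : α =ᶠ[nhds t] β := Filter.eventuallyEq_of_mem (hs.mem_nhds ht) h
  simp only [h ht, h1.deriv_eq]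

/-- The concatenation of `α`, which stays at `z` from time `1` on, with `β`, which stays at `z`
until time `1`; run through at double speed. -/
def concat (α β : ℝ → ℂ) (z : ℂ) (t : ℝ) : ℂ := α (2 * t) + β (2 * t) - z

theorem concat_of_le {α β : ℝ → ℂ} {z : ℂ} (hβ : ∀ t ≤ 1, β t = z) {t : ℝ} (ht : t ≤ 1 / 2) :
    concat α β z t = α (2 * t) := by
  rw [concat, hβ _ (by linarith), add_sub_cancel_right]

theorem concat_of_ge {α β : ℝ → ℂ} {z : ℂ} (hα : ∀ t, 1 ≤ t → α t = z) {t : ℝ} (ht : 1 / 2 ≤ t) :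
    concat α β z t = β (2 * t) := by
  rw [concat, hα _ (by linarith), add_sub_cancel_left]

theorem contDiffOn_concat {α β : ℝ → ℂ} (z : ℂ) {s s' : Set ℝ} (hα : ContDiffOn ℝ 1 α s)
    (hβ : ContDiffOn ℝ 1 β s) (hs : ∀ t ∈ s', 2 * t ∈ s) : ContDiffOn ℝ 1 (concat α β z) s' := by
  have h : ContDiffOn ℝ 1 (fun t : ℝ => 2 * t) s' := (contDiff_const.mul contDiff_id).contDiffOn
  exact ((hα.comp h hs).add (hβ.comp h hs)).sub contDiffOn_const

theorem pathLength_comp_two_mul (ρ : ℂ → ℝ≥0) {α : ℝ → ℂ} {s : Set ℝ} (hs : IsOpen s)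
    (hα : ContDiffOn ℝ 1 α ((fun t => 2 * t) '' s)) :
    pathLength ρ (fun t => α (2 * t)) s = pathLength ρ α ((fun t => 2 * t) '' s) := by
  have hd : ∀ t : ℝ, HasDerivAt (fun t : ℝ => 2 * t) 2 t := fun t => by
    simpa using (hasDerivAt_id t).const_mul 2
  have ho : IsOpen ((fun t : ℝ => 2 * t) '' s) :=
    (Homeomorph.mulLeft₀ (2 : ℝ) two_ne_zero).isOpenMap s hs
  refine pathLength_comp_monotoneOn ρ hs.measurableSet (fun t => (hd t).differentiableAt)
    (fun a _ b _ h => by simpa using h) (fun t _ => ?_) fun t ht => ?_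
  · rw [(hd t).deriv]; norm_num
  · exact (hα.differentiableOn one_ne_zero).differentiableAt (ho.mem_nhds (mem_image_of_mem _ ht))

/-- The parameter interval is cut at `1 / 2`. Before it the curve is `α (2 * t)`, after it `β (2 *
t)`, and the cut point has measure zero. -/
theorem pathLength_concat_le (ρ : ℂ → ℝ≥0) {α β : ℝ → ℂ} {z : ℂ} {T : Set ℝ} (hT : IsOpen T)
    (hα1 : ∀ t, 1 ≤ t → α t = z) (hβ1 : ∀ t ≤ 1, β t = z)
    (hα : ContDiffOn ℝ 1 α (Ioi 0)) (hβ : ContDiffOn ℝ 1 β ((fun t => 2 * t) '' T))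
    (hT0 : T ⊆ Ioi 0) :
    pathLength ρ (concat α β z) T ≤
      pathLength ρ α (Ioi 0) + pathLength ρ β ((fun t => 2 * t) '' T ∩ Ioi 1) := by
  have h1 : pathLength ρ (concat α β z) T ≤
      pathLength ρ (concat α β z) (Ioo 0 (1 / 2)) +
        pathLength ρ (concat α β z) (T ∩ Ioi (1 / 2)) := by
    rw [pathLength_congr_ae ρ _ (s := Ioo 0 (1 / 2)) Ioo_ae_eq_Ioc]
    refine (pathLength_mono _ _ fun t ht => ?_).trans (pathLength_union_le _ _ _ _)
    rcases le_or_gt t (1 / 2) with h | h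
    · exact Or.inl ⟨hT0 ht, h⟩
    · exact Or.inr ⟨ht, h⟩
  refine h1.trans (add_le_add ?_ ?_)
  · rw [pathLength_congr ρ isOpen_Ioo fun t ht => concat_of_le hβ1 ht.2.le,
      pathLength_comp_two_mul ρ isOpen_Ioo (hα.mono ?_)]
    · refine pathLength_mono _ _ ?_
      rintro _ ⟨t, ht, rfl⟩
      simpa using ht.1
    · rintro _ ⟨t, ht, rfl⟩
      simpa using ht.1
  · rw [pathLength_congr ρ (hT.inter isOpen_Ioi) fun t ht => concat_of_ge hα1 (le_of_lt ht.2),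
      pathLength_comp_two_mul ρ (hT.inter isOpen_Ioi) (hβ.mono (image_mono inter_subset_left))]
    refine pathLength_mono _ _ ?_
    rintro _ ⟨t, ht, rfl⟩
    refine ⟨mem_image_of_mem _ ht.1, ?_⟩
    have := ht.2
    simp only [mem_Ioi] at this ⊢
    linarith

/-- The monotone reparametrization that stays at `c` until time `k` and is at `d` from time
`k + 1` on. -/
def ramp (c d k t : ℝ) : ℝ := c + (d - c) * Real.smoothTransition (t - k)

theorem contDiff_ramp (c d k : ℝ) : ContDiff ℝ 1 (ramp c d k) :=
  contDiff_const.add (contDiff_const.mul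
    (Real.smoothTransition.contDiff.comp (contDiff_id.sub contDiff_const)))

theorem ramp_of_le {c d k t : ℝ} (h : t ≤ k) : ramp c d k t = c := by
  simp [ramp, Real.smoothTransition.zero_of_nonpos (sub_nonpos.2 h)]

theorem ramp_of_ge {c d k t : ℝ} (h : k + 1 ≤ t) : ramp c d k t = d := by
  simp [ramp, Real.smoothTransition.one_of_one_le (x := t - k) (by linarith)]

theorem ramp_mem_uIcc (c d k t : ℝ) : ramp c d k t ∈ uIcc c d := by
  have h0 := Real.smoothTransition.nonneg (t - k)
  have h1 := Real.smoothTransition.le_one (t - k)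
  rw [mem_uIcc]
  unfold ramp
  rcases le_total c d with h | h
  · exact Or.inl ⟨by nlinarith, by nlinarith⟩
  · exact Or.inr ⟨by nlinarith, by nlinarith⟩

theorem monotone_ramp {c d : ℝ} (k : ℝ) (h : c ≤ d) : Monotone (ramp c d k) := fun s t hst => by
  have := Real.smoothTransition.monotone (sub_le_sub_right hst k)
  unfold ramp
  nlinarith

theorem antitone_ramp {c d : ℝ} (k : ℝ) (h : d ≤ c) : Antitone (ramp c d k) := fun s t hst => by
  have := Real.smoothTransition.monotone (sub_le_sub_right hst k)
  unfold ramp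
  nlinarith

theorem pathLength_comp_ramp (ρ : ℂ → ℝ≥0) {γ : ℝ → ℂ} {c d k : ℝ} {s : Set ℝ}
    (hs : MeasurableSet s) (hγ : ∀ t ∈ s, DifferentiableAt ℝ γ (ramp c d k t)) :
    pathLength ρ (γ ∘ ramp c d k) s = pathLength ρ γ (ramp c d k '' s) := by
  have hd := (contDiff_ramp c d k).differentiable one_ne_zero
  rcases le_total c d with h | h
  · exact pathLength_comp_monotoneOn ρ hs hd ((monotone_ramp k h).monotoneOn _)
      (fun t _ => (monotone_ramp k h).deriv_nonneg) hγ
  · exact pathLength_comp_antitoneOn ρ hs hd ((antitone_ramp k h).antitoneOn _)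
      (fun t _ => (antitone_ramp k h).deriv_nonpos) hγ

/-! ### The distance from a boundary set for a conformal metric -/

/-- Arcs in `Ω` that start on `A` and stay at `z` from time `1` on. -/
def arcsTo (Ω A : Set ℂ) (z : ℂ) : Set (ℝ → ℂ) :=
  {α | ContinuousOn α (Ici 0) ∧ ContDiffOn ℝ 1 α (Ioi 0) ∧ MapsTo α (Ioi 0) Ω ∧ α 0 ∈ A ∧
    ∀ t, 1 ≤ t → α t = z}

/-- The distance of `z` from `A` in `Ω` for the metric `ρ |dz|`. -/
def arcDist (ρ : ℂ → ℝ≥0) (Ω A : Set ℂ) (z : ℂ) : ℝ≥0∞ :=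
  ⨅ α ∈ arcsTo Ω A z, pathLength ρ α (Ioi 0)

section

variable {ρ : ℂ → ℝ≥0} {Ω A B : Set ℂ}

/-- The triangle inequality: an arc that reaches `γ c` is continued along `γ`. No order between `c`
and `d` is assumed, so the estimate can be used in both directions. -/
theorem arcDist_le_add {γ : ℝ → ℂ} {O : Set ℝ} (hO : IsOpen O) {c d : ℝ} (hcd : uIcc c d ⊆ O)
    (hγ : ContDiffOn ℝ 1 γ O) (hγΩ : MapsTo γ (uIcc c d) Ω) :
    arcDist ρ Ω A (γ d) ≤ arcDist ρ Ω A (γ c) + pathLength ρ γ (uIcc c d) := by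
  conv_rhs => rw [arcDist, ENNReal.iInf₂_add]
  refine le_iInf₂ fun α hα => ?_
  -- This piece rests at `γ c` until time 1, from when on `α` rests there too. The junction is
  -- therefore `C¹`.
  set β := γ ∘ ramp c d 1
  have hβ : ContDiff ℝ 1 β := by
    rw [← contDiffOn_univ]
    exact hγ.comp (contDiff_ramp c d 1).contDiffOn fun t _ => hcd (ramp_mem_uIcc c d 1 t)
  have hβ1 : ∀ t ≤ 1, β t = γ c := fun t ht => by simp [β, ramp_of_le ht]
  have hβ2 : ∀ t, 2 ≤ t → β t = γ d := fun t ht => by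
    simp [β, ramp_of_ge (k := 1) (t := t) (by linarith)]
  have hd : ∀ t, DifferentiableAt ℝ γ (ramp c d 1 t) := fun t =>
    (hγ.differentiableOn one_ne_zero).differentiableAt
      (hO.mem_nhds (hcd (ramp_mem_uIcc c d 1 t)))
  have hmem : concat α β (γ c) ∈ arcsTo Ω A (γ d) := by
    refine ⟨?_, contDiffOn_concat (γ c) hα.2.1 hβ.contDiffOn fun t ht => ?_, fun t ht => ?_, ?_,
      fun t ht => ?_⟩
    · have h : ContinuousOn (fun t : ℝ => 2 * t) (Ici 0) := by fun_prop
      exact ((hα.1.comp h fun t ht => by simpa using ht).add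
        (hβ.continuous.comp_continuousOn h)).sub continuousOn_const
    · simpa using ht
    · rcases le_total t (1 / 2) with h | h
      · rw [concat_of_le hβ1 h]; exact hα.2.2.1 (by simpa using ht)
      · rw [concat_of_ge hα.2.2.2.2 h]; exact hγΩ (ramp_mem_uIcc c d 1 _)
    · rw [concat_of_le hβ1 (by norm_num), mul_zero]; exact hα.2.2.2.1
    · rw [concat_of_ge hα.2.2.2.2 (by linarith)]; exact hβ2 _ (by linarith)
  refine (iInf₂_le _ hmem).trans ((pathLength_concat_le ρ isOpen_Ioi hα.2.2.2.2 hβ1 hα.2.1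
    hβ.contDiffOn subset_rfl).trans (add_le_add le_rfl ?_))
  refine (pathLength_mono _ _ inter_subset_right).trans ?_
  rw [pathLength_comp_ramp ρ measurableSet_Ioi fun t _ => hd t]
  refine pathLength_mono _ _ ?_
  rintro _ ⟨t, _, rfl⟩
  exact ramp_mem_uIcc c d 1 t

/-- A piece of curve that starts on `A` is itself a competitor for the distance. It has to be smooth
and inside `Ω` only after its start, as arcs are at their ends. -/
theorem arcDist_le_pathLength_uIcc {γ : ℝ → ℂ} {O : Set ℝ} (hO : IsOpen O) {c d : ℝ} (hcd : c ≠ d)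
    (hcO : uIcc c d \ {c} ⊆ O) (hc : ContinuousOn γ (uIcc c d)) (hγ : ContDiffOn ℝ 1 γ O)
    (hγΩ : MapsTo γ (uIcc c d \ {c}) Ω) (hA : γ c ∈ A) :
    arcDist ρ Ω A (γ d) ≤ pathLength ρ γ (uIcc c d \ {c}) := by
  -- The transition function is positive at all positive times, so the initial parameter `c` is left
  -- at once and not visited again.
  have hr : ∀ s ∈ Ioi (0 : ℝ), ramp c d 0 s ∈ uIcc c d \ {c} := fun s hs => by
    refine ⟨ramp_mem_uIcc c d 0 s, ?_⟩
    have h1 := Real.smoothTransition.pos_of_pos (x := s - 0) (by simpa using hs)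
    simp only [ramp, mem_singleton_iff, add_eq_left, mul_eq_zero, sub_eq_zero, not_or]
    exact ⟨hcd.symm, h1.ne'⟩
  have hmem : γ ∘ ramp c d 0 ∈ arcsTo Ω A (γ d) := by
    refine ⟨hc.comp (contDiff_ramp c d 0).continuous.continuousOn fun s _ => ramp_mem_uIcc c d 0 s,
      hγ.comp (contDiff_ramp c d 0).contDiffOn fun s hs => hcO (hr s hs),
      fun s hs => hγΩ (hr s hs), ?_, fun s hs => ?_⟩
    · simpa [ramp_of_le] using hA
    · simp [ramp_of_ge (k := 0) (t := s) (by linarith)]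
  refine (iInf₂_le _ hmem).trans ?_
  rw [pathLength_comp_ramp ρ measurableSet_Ioi fun s hs =>
    (hγ.differentiableOn one_ne_zero).differentiableAt (hO.mem_nhds (hcO (hr s hs)))]
  refine pathLength_mono _ _ ?_
  rintro _ ⟨s, hs, rfl⟩
  exact hr s hs

theorem arcDist_le_pathLength {α : ℝ → ℂ} (hc : ContinuousOn α (Icc 0 1))
    (hα : ContDiffOn ℝ 1 α (Ioo 0 1)) (hαΩ : MapsTo α (Ioo 0 1) Ω) (h0 : α 0 ∈ A) {t : ℝ}
    (ht : t ∈ Ioo (0 : ℝ) 1) : arcDist ρ Ω A (α t) ≤ pathLength ρ α (Ioc 0 t) := by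
  have h : uIcc 0 t \ {0} = Ioc 0 t := by rw [uIcc_of_le ht.1.le, Icc_sdiff_left]
  have h' : Ioc 0 t ⊆ Ioo 0 1 := fun s hs => ⟨hs.1, hs.2.trans_lt ht.2⟩
  rw [← h] at h' ⊢
  refine arcDist_le_pathLength_uIcc isOpen_Ioo ht.1.ne h' (hc.mono ?_) hα (hαΩ.mono h' subset_rfl) h0
  rw [uIcc_of_le ht.1.le]
  exact Icc_subset_Icc_right ht.2.le

/-- A competitor for the distance to `γ c`, followed by the rest of `γ` up to `B`, is an arc of the
class joining `A` to `B`. -/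
theorem le_arcDist_add {m : ℝ≥0∞} (h1 : ∀ α ∈ arcsJoining Ω A B, m ≤ arcLength ρ α) {γ : ℝ → ℂ}
    {O : Set ℝ} (hO : IsOpen O) {c d : ℝ} (hcd : c ≠ d) (hcO : uIcc c d \ {d} ⊆ O)
    (hc : ContinuousOn γ (uIcc c d)) (hγ : ContDiffOn ℝ 1 γ O)
    (hγΩ : MapsTo γ (uIcc c d \ {d}) Ω) (hB : γ d ∈ B) :
    m ≤ arcDist ρ Ω A (γ c) + pathLength ρ γ (uIcc c d \ {d}) := by
  rw [arcDist, ENNReal.iInf₂_add]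
  refine le_iInf₂ fun η hη => ?_
  -- The endpoint `d` is reached at time 2 and not before, hence at time 1 after doubling the speed.
  -- At earlier times the curve is inside `Ω`.
  have hr : ∀ s ∈ Iio (2 : ℝ), ramp c d 1 s ∈ uIcc c d \ {d} := fun s hs => by
    refine ⟨ramp_mem_uIcc c d 1 s, fun h => ?_⟩
    have h2 := Real.smoothTransition.lt_one_of_lt_one (x := s - 1) (by linarith [mem_Iio.1 hs])
    have h3 : (d - c) * (Real.smoothTransition (s - 1) - 1) = 0 := by
      simp only [ramp, mem_singleton_iff] at h
      linarith
    rcases mul_eq_zero.1 h3 with h4 | h4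
    · exact hcd (by linarith)
    · linarith
  set β := γ ∘ ramp c d 1
  have hβ : ContDiffOn ℝ 1 β (Iio 2) :=
    hγ.comp (contDiff_ramp c d 1).contDiffOn fun s hs => hcO (hr s hs)
  have hβc : Continuous β := by
    rw [← continuousOn_univ]
    exact hc.comp (contDiff_ramp c d 1).continuous.continuousOn fun s _ => ramp_mem_uIcc c d 1 s
  have hβ1 : ∀ s ≤ 1, β s = γ c := fun s hs => by simp [β, ramp_of_le hs]
  have hmem : concat η β (γ c) ∈ arcsJoining Ω A B := by
    refine ⟨?_, contDiffOn_concat (γ c) (s := Ioo 0 2) (hη.2.1.mono Ioo_subset_Ioi_self)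
      (hβ.mono fun s hs => hs.2) fun s hs => ?_, fun s hs => ?_, ?_, ?_⟩
    · have h : ContinuousOn (fun t : ℝ => 2 * t) (Icc 0 1) := by fun_prop
      exact ((hη.1.comp h fun t ht => by simpa using ht.1).add
        (hβc.comp_continuousOn h)).sub continuousOn_const
    · exact ⟨by linarith [hs.1], by linarith [hs.2]⟩
    · rcases le_total s (1 / 2) with h | h
      · rw [concat_of_le hβ1 h]; exact hη.2.2.1 (by simpa using hs.1)
      · rw [concat_of_ge hη.2.2.2.2 h]
        exact hγΩ (hr _ (by simp only [mem_Iio]; linarith [hs.2]))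
    · rw [concat_of_le hβ1 (by norm_num), mul_zero]; exact hη.2.2.2.1
    · rw [concat_of_ge hη.2.2.2.2 (by norm_num)]
      simpa [β, ramp_of_ge (k := 1) (t := 2) (by norm_num)] using hB
  have himg : (fun t : ℝ => 2 * t) '' Ioo 0 1 ⊆ Iio 2 := by
    rintro _ ⟨s, hs, rfl⟩
    simp only [mem_Iio]; linarith [hs.2]
  refine (h1 _ hmem).trans ((pathLength_concat_le ρ isOpen_Ioo hη.2.2.2.2 hβ1 hη.2.1
    (hβ.mono himg) fun s hs => hs.1).trans (add_le_add le_rfl ?_))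
  refine (pathLength_mono _ _ (inter_subset_left.trans himg)).trans ?_
  rw [pathLength_comp_ramp ρ measurableSet_Iio fun s hs =>
    (hγ.differentiableOn one_ne_zero).differentiableAt (hO.mem_nhds (hcO (hr s hs)))]
  refine pathLength_mono _ _ ?_
  rintro _ ⟨s, hs, rfl⟩
  exact hr s hs

theorem le_arcDist_add_Ico {m : ℝ≥0∞} (h1 : ∀ α ∈ arcsJoining Ω A B, m ≤ arcLength ρ α)
    {α : ℝ → ℂ} (hc : ContinuousOn α (Icc 0 1)) (hα : ContDiffOn ℝ 1 α (Ioo 0 1))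
    (hαΩ : MapsTo α (Ioo 0 1) Ω) (hB : α 1 ∈ B) {t : ℝ} (ht : t ∈ Ioo (0 : ℝ) 1) :
    m ≤ arcDist ρ Ω A (α t) + pathLength ρ α (Ico t 1) := by
  have h : uIcc t 1 \ {1} = Ico t 1 := by rw [uIcc_of_le ht.2.le, Icc_sdiff_right]
  have h' : Ico t 1 ⊆ Ioo 0 1 := fun s hs => ⟨ht.1.trans_le hs.1, hs.2⟩
  rw [← h] at h' ⊢
  refine le_arcDist_add h1 isOpen_Ioo ht.2.ne h' (hc.mono ?_) hα (hαΩ.mono h' subset_rfl) hB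
  rw [uIcc_of_le ht.2.le]
  exact Icc_subset_Icc_left ht.1.le

end

end Scherk
end

noncomputable section
namespace Scherk

/-! ### The truncated distance and its mollification -/

/-- The distance from `A`, truncated at `1`. -/
def potential (ρ : ℂ → ℝ≥0) (Ω A : Set ℂ) (z : ℂ) : ℝ := (min 1 (arcDist ρ Ω A z)).toReal

theorem min_one_ne_top (x : ℝ≥0∞) : min 1 x ≠ ∞ := ((min_le_left _ _).trans_lt ENNReal.one_lt_top).ne

/-- Truncation at 1 keeps the triangle inequality and makes the values finite, so that they can be
subtracted as real numbers. -/
theorem toReal_min_one_sub_le {x y L : ℝ≥0∞} (h : x ≤ y + L) (hL : L ≠ ∞) :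
    (min 1 x).toReal - (min 1 y).toReal ≤ L.toReal := by
  rw [sub_le_iff_le_add', ← ENNReal.toReal_add (min_one_ne_top y) hL]
  refine ENNReal.toReal_mono (ENNReal.add_ne_top.2 ⟨min_one_ne_top y, hL⟩) ?_
  rcases le_total 1 y with hy | hy
  · rw [min_eq_left hy]; exact (min_le_left _ _).trans le_self_add
  · rw [min_eq_right hy]; exact (min_le_right _ _).trans h

section

variable {ρ : ℂ → ℝ≥0} {Ω A B : Set ℂ} {ε : ℝ} {r : ℂ → ℝ}

theorem potential_nonneg (z : ℂ) : 0 ≤ potential ρ Ω A z := ENNReal.toReal_nonneg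

theorem potential_le_one (z : ℂ) : potential ρ Ω A z ≤ 1 :=
  ENNReal.toReal_mono ENNReal.one_ne_top (min_le_left _ _)

/-- The truncated distance is 1-Lipschitz for `ρ |dz|`: the triangle inequality is used along `γ` in
both directions. -/
theorem enorm_potential_sub_le {γ : ℝ → ℂ} {O : Set ℝ} (hO : IsOpen O) {c d : ℝ}
    (hcd : uIcc c d ⊆ O) (hγ : ContDiffOn ℝ 1 γ O) (hγΩ : MapsTo γ (uIcc c d) Ω) :
    ‖potential ρ Ω A (γ d) - potential ρ Ω A (γ c)‖ₑ ≤ pathLength ρ γ (uIcc c d) := by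
  by_cases hL : pathLength ρ γ (uIcc c d) = ∞
  · rw [hL]; exact le_top
  have h1 := toReal_min_one_sub_le (arcDist_le_add (ρ := ρ) (A := A) hO hcd hγ hγΩ) hL
  have h2 := toReal_min_one_sub_le (arcDist_le_add (ρ := ρ) (A := A) hO (uIcc_comm c d ▸ hcd) hγ
    (uIcc_comm c d ▸ hγΩ)) (uIcc_comm c d ▸ hL)
  rw [uIcc_comm d c] at h2
  rw [Real.enorm_eq_ofReal_abs, ← ENNReal.ofReal_toReal hL]
  exact ENNReal.ofReal_le_ofReal (abs_le.2 ⟨by unfold potential; linarith, h1⟩)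

theorem pathLength_le_of_le {γ : ℝ → ℂ} {C D : ℝ≥0∞} (hC : ∀ t ∈ Ioo (0 : ℝ) 1, (ρ (γ t) : ℝ≥0∞) ≤ C)
    (hD : ∀ t ∈ Ioo (0 : ℝ) 1, ‖deriv γ t‖ₑ ≤ D) : pathLength ρ γ (Ioo 0 1) ≤ C * D := by
  calc pathLength ρ γ (Ioo 0 1) ≤ ∫⁻ _t in Ioo (0 : ℝ) 1, C * D :=
        setLIntegral_mono' measurableSet_Ioo fun t ht => mul_le_mul' (hC t ht) (hD t ht)
    _ = C * D := by simp

theorem contDiff_lineMap (z z' : ℂ) : ContDiff ℝ 1 (AffineMap.lineMap z z' : ℝ → ℂ) := by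
  have : (AffineMap.lineMap z z' : ℝ → ℂ) = fun t : ℝ => t • (z' - z) + z := by
    ext t; simp [AffineMap.lineMap_apply]
  rw [this]
  exact (contDiff_id.smul contDiff_const).add contDiff_const

theorem deriv_lineMap (z z' : ℂ) (t : ℝ) :
    deriv (AffineMap.lineMap z z' : ℝ → ℂ) t = z' - z := AffineMap.hasDerivAt_lineMap.deriv

theorem lineMap_mem_ball {z z' : ℂ} {δ : ℝ} (hz' : z' ∈ Metric.ball z δ) {t : ℝ}
    (ht : t ∈ Icc (0 : ℝ) 1) : AffineMap.lineMap z z' t ∈ Metric.ball z δ :=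
  (convex_ball z δ).lineMap_mem (Metric.mem_ball_self (Metric.pos_of_mem_ball hz')) hz' ht

theorem uIcc_zero_one : uIcc (0 : ℝ) 1 = Icc 0 1 := uIcc_of_le zero_le_one

theorem exists_ball_le (hΩ : IsOpen Ω) (hρ : ContinuousOn ρ Ω) {z : ℂ} (hz : z ∈ Ω) {C : ℝ≥0}
    (hC : ρ z < C) : ∃ δ > 0, Metric.ball z δ ⊆ Ω ∧ ∀ y ∈ Metric.ball z δ, ρ y ≤ C := by
  have h1 : ∀ᶠ y in nhds z, ρ y < C :=
    (hρ.continuousAt (hΩ.mem_nhds hz)).eventually (gt_mem_nhds hC)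
  obtain ⟨δ, hδ, h⟩ := Metric.eventually_nhds_iff_ball.1 (h1.and (hΩ.mem_nhds hz))
  exact ⟨δ, hδ, fun y hy => (h y hy).2, fun y hy => (h y hy).1.le⟩

/-- A continuous metric is locally bounded, so comparison along short segments makes the potential
locally Lipschitz. A merely measurable metric could not be controlled on individual segments, which
is why it is mollified beforehand. -/
theorem continuousOn_potential (hΩ : IsOpen Ω) (hρ : ContinuousOn ρ Ω) :
    ContinuousOn (potential ρ Ω A) Ω := by
  intro z hz
  refine ContinuousAt.continuousWithinAt ?_
  obtain ⟨δ, hδ, hδΩ, hδC⟩ := exists_ball_le hΩ hρ hz (lt_add_one (ρ z))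
  rw [ContinuousAt, tendsto_iff_edist_tendsto_0]
  have h0 : Filter.Tendsto (fun z' => ((ρ z + 1 : ℝ≥0) : ℝ≥0∞) * ‖z' - z‖ₑ) (nhds z) (nhds 0) := by
    have h1 : Filter.Tendsto (fun z' : ℂ => ‖z' - z‖ₑ) (nhds z) (nhds 0) := by
      have : Continuous fun z' : ℂ => ‖z' - z‖ₑ := by fun_prop
      simpa using this.tendsto z
    have h2 := ENNReal.Tendsto.const_mul (a := ((ρ z + 1 : ℝ≥0) : ℝ≥0∞)) h1
      (Or.inr ENNReal.coe_ne_top)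
    rwa [mul_zero] at h2
  refine tendsto_of_tendsto_of_tendsto_of_le_of_le' tendsto_const_nhds h0
    (Filter.Eventually.of_forall fun _ => zero_le) ?_
  filter_upwards [Metric.ball_mem_nhds z hδ] with z' hz'
  have h := enorm_potential_sub_le (ρ := ρ) (A := A) (Ω := Ω) (c := 0) (d := 1) isOpen_univ
    (subset_univ _) (contDiff_lineMap z z').contDiffOn
    (uIcc_zero_one ▸ fun t ht => hδΩ (lineMap_mem_ball hz' ht))
  rw [AffineMap.lineMap_apply_one, AffineMap.lineMap_apply_zero, uIcc_zero_one,
    ← pathLength_congr_ae ρ _ Ioo_ae_eq_Icc] at h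
  rw [edist_eq_enorm_sub]
  refine h.trans (pathLength_le_of_le (fun t ht => ?_) fun t _ => by rw [deriv_lineMap])
  exact_mod_cast hδC _ (lineMap_mem_ball hz' (Ioo_subset_Icc_self ht))

theorem measurable_indicator_potential (hΩ : IsOpen Ω) (hρ : ContinuousOn ρ Ω) :
    Measurable (Ω.indicator (potential ρ Ω A)) := by
  classical
  have := (continuousOn_potential (A := A) hΩ hρ).measurable_piecewise
    (g := fun _ => (0 : ℝ)) continuousOn_const hΩ.measurableSet
  rw [← piecewise_eq_indicator]
  exact this

theorem indicator_potential_mem (z : ℂ) : Ω.indicator (potential ρ Ω A) z ∈ Icc (0 : ℝ) 1 := by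
  by_cases hz : z ∈ Ω
  · rw [indicator_of_mem hz]; exact ⟨potential_nonneg z, potential_le_one z⟩
  · rw [indicator_of_notMem hz]; simp

theorem locallyIntegrable_indicator_potential (hΩ : IsOpen Ω) (hρ : ContinuousOn ρ Ω) :
    LocallyIntegrable (Ω.indicator (potential ρ Ω A)) := by
  refine (locallyIntegrable_const (1 : ℝ)).mono
    (measurable_indicator_potential hΩ hρ).aestronglyMeasurable
    (Filter.Eventually.of_forall fun z => ?_)
  have := indicator_potential_mem (ρ := ρ) (Ω := Ω) (A := A) z
  rw [Real.norm_of_nonneg this.1]; simpa using this.2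

/-- The mollification of the truncated distance. -/
def smoothPotential (ρ : ℂ → ℝ≥0) (Ω A : Set ℂ) (r : ℂ → ℝ) : ℂ → ℝ :=
  mollify r (Ω.indicator (potential ρ Ω A))

/-- The Lipschitz estimate is applied along each displaced path and then averaged over the
displacements. -/
theorem enorm_smoothPotential_sub_le (hΩ : IsOpen Ω) (hr : IsRadius Ω ε r) (hε0 : 0 ≤ ε)
    (hε1 : ε ≤ 1) (hρm : Measurable ρ) (ha : area ρ Ω < ∞) (hρ : ContinuousOn ρ Ω) {γ : ℝ → ℂ}
    (hγ : ContDiff ℝ 1 γ) (hγΩ : MapsTo γ (Icc 0 1) Ω) :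
    ‖smoothPotential ρ Ω A r (γ 1) - smoothPotential ρ Ω A r (γ 0)‖ₑ ≤
      ENNReal.ofReal (1 + ε) * pathLength (mollifyMetric Ω r ρ) γ (Ioo 0 1) := by
  have hli := locallyIntegrable_indicator_potential (A := A) hΩ hρ
  have hm := measurable_indicator_potential (A := A) hΩ hρ
  rw [smoothPotential, mollify, mollify, ← integral_sub
    (integrable_comp_push hr hli hm (hγΩ (by simp)))
    (integrable_comp_push hr hli hm (hγΩ (by simp)))]
  refine (enorm_integral_le_lintegral_enorm _).trans (le_trans ?_
    (lintegral_pathLength_push_le hΩ hr hε0 hε1 hρm ha isOpen_Ioo hγ.contDiffOn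
      (hγΩ.mono_left Ioo_subset_Icc_self)))
  refine lintegral_mono_ae ?_
  filter_upwards [ae_norm_lt_one] with w hw
  rw [indicator_of_mem (hr.push_mem hε1 hw (hγΩ (by simp))),
    indicator_of_mem (hr.push_mem hε1 hw (hγΩ (by simp)))]
  have h := enorm_potential_sub_le (ρ := ρ) (A := A) (Ω := Ω) (c := 0) (d := 1) isOpen_univ
    (subset_univ _) ((hr.contDiff_push w).comp hγ).contDiffOn
    (uIcc_zero_one ▸ fun t ht => hr.push_mem hε1 hw (hγΩ ht))
  rwa [uIcc_zero_one, ← pathLength_congr_ae ρ _ Ioo_ae_eq_Icc] at h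

/-- The mollified metric is continuous, so close to `z` it stays below any `C` larger than its value
at `z`. Increments along short segments then bound the derivative by `(1 + ε) * C`. -/
theorem norm_fderiv_smoothPotential_le (hΩ : IsOpen Ω) (hr : IsRadius Ω ε r) (hε0 : 0 ≤ ε)
    (hε1 : ε ≤ 1) (hρm : Measurable ρ) (ha : area ρ Ω < ∞) (hρ : ContinuousOn ρ Ω) {z : ℂ}
    (hz : z ∈ Ω) :
    ‖fderiv ℝ (smoothPotential ρ Ω A r) z‖ ≤ (1 + ε) * mollifyMetric Ω r ρ z := by
  have key : ∀ C : ℝ≥0, mollifyMetric Ω r ρ z < C →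
      ‖fderiv ℝ (smoothPotential ρ Ω A r) z‖ ≤ (1 + ε) * C := by
    intro C hC
    obtain ⟨δ, hδ, hδΩ, hδC⟩ :=
      exists_ball_le hΩ (continuousOn_mollifyMetric hΩ hr hρm ha) hz hC
    refine norm_fderiv_le_of_lip' ℝ (by positivity) ?_
    filter_upwards [Metric.ball_mem_nhds z hδ] with z' hz'
    have h := enorm_smoothPotential_sub_le (A := A) hΩ hr hε0 hε1 hρm ha hρ (contDiff_lineMap z z')
      fun t ht => hδΩ (lineMap_mem_ball hz' ht)
    rw [AffineMap.lineMap_apply_one, AffineMap.lineMap_apply_zero] at h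
    have h2 := h.trans (mul_le_mul' le_rfl (pathLength_le_of_le (C := C) (D := ‖z' - z‖ₑ)
      (fun t ht => by exact_mod_cast hδC _ (lineMap_mem_ball hz' (Ioo_subset_Icc_self ht)))
      fun t _ => by rw [deriv_lineMap]))
    have h3 : ENNReal.ofReal (1 + ε) * ((C : ℝ≥0∞) * ‖z' - z‖ₑ) =
        ENNReal.ofReal ((1 + ε) * C * ‖z' - z‖) := by
      rw [ENNReal.ofReal_mul (by positivity), ENNReal.ofReal_mul (by positivity),
        ENNReal.ofReal_coe_nnreal, ofReal_norm, mul_assoc]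
    rw [h3, ← ofReal_norm] at h2
    exact (ENNReal.ofReal_le_ofReal_iff (by positivity)).1 h2
  -- The constant `C` is the value of the metric at `z` plus `η / (1 + ε)`, which costs exactly `η`.
  refine le_of_forall_pos_le_add fun η hη => ?_
  have h := key (mollifyMetric Ω r ρ z + (η / (1 + ε)).toNNReal)
    (lt_add_of_pos_right _ (by simp; positivity))
  refine h.trans_eq ?_
  rw [NNReal.coe_add, Real.coe_toNNReal _ (by positivity)]
  field_simp

theorem tendsto_one_sub : Filter.Tendsto (fun t : ℝ => 1 - t) (nhdsWithin 0 (Ioi 0))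
    (nhdsWithin 1 (Iio 1)) := by
  refine tendsto_nhdsWithin_iff.2 ⟨?_, ?_⟩
  · have : Continuous fun t : ℝ => 1 - t := by fun_prop
    simpa using (this.tendsto 0).mono_left nhdsWithin_le_nhds
  · filter_upwards [self_mem_nhdsWithin] with t ht
    simpa using ht

/-- Absolute continuity of the integral, applied to shrinking initial intervals. -/
theorem tendsto_pathLength_zero {ρ : ℂ → ℝ≥0} {α : ℝ → ℂ}
    (hfin : arcLength ρ α < ∞) :
    Filter.Tendsto (fun t => pathLength ρ α (Ioc 0 t)) (nhdsWithin 0 (Ioi 0)) (nhds 0) := by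
  have h : Filter.Tendsto (fun t : ℝ => volume.restrict (Ioo (0 : ℝ) 1) (Ioc 0 t))
      (nhdsWithin 0 (Ioi 0)) (nhds 0) := by
    refine tendsto_of_tendsto_of_tendsto_of_le_of_le tendsto_const_nhds
      (h := fun t : ℝ => ENNReal.ofReal t) ?_ (fun _ => zero_le)
      (fun t => (Measure.restrict_apply_le _ _).trans (by simp))
    have : Filter.Tendsto ENNReal.ofReal (nhds 0) (nhds 0) := by
      simpa using ENNReal.continuous_ofReal.tendsto 0
    exact this.mono_left nhdsWithin_le_nhds
  refine (tendsto_setLIntegral_zero hfin.ne h).congr' ?_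
  filter_upwards [Ioo_mem_nhdsGT zero_lt_one] with t ht
  rw [Measure.restrict_restrict measurableSet_Ioc,
    inter_eq_left.2 (show Ioc 0 t ⊆ Ioo 0 1 from fun s hs => ⟨hs.1, hs.2.trans_lt ht.2⟩)]
  rfl

theorem tendsto_pathLength_one {ρ : ℂ → ℝ≥0} {α : ℝ → ℂ}
    (hfin : arcLength ρ α < ∞) :
    Filter.Tendsto (fun t => pathLength ρ α (Ico (1 - t) 1)) (nhdsWithin 0 (Ioi 0)) (nhds 0) := by
  have h : Filter.Tendsto (fun t : ℝ => volume.restrict (Ioo (0 : ℝ) 1) (Ico (1 - t) 1))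
      (nhdsWithin 0 (Ioi 0)) (nhds 0) := by
    refine tendsto_of_tendsto_of_tendsto_of_le_of_le tendsto_const_nhds
      (h := fun t : ℝ => ENNReal.ofReal t) ?_ (fun _ => zero_le)
      (fun t => (Measure.restrict_apply_le _ _).trans (by simp))
    have : Filter.Tendsto ENNReal.ofReal (nhds 0) (nhds 0) := by
      simpa using ENNReal.continuous_ofReal.tendsto 0
    exact this.mono_left nhdsWithin_le_nhds
  refine (tendsto_setLIntegral_zero hfin.ne h).congr' ?_
  filter_upwards [Ioo_mem_nhdsGT zero_lt_one] with t ht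
  rw [Measure.restrict_restrict measurableSet_Ico,
    inter_eq_left.2 (show Ico (1 - t) 1 ⊆ Ioo 0 1 from
      fun s hs => ⟨by linarith [hs.1, ht.2], hs.2⟩)]
  rfl

/-- Close to the start the potential is at most the length already covered; close to the end it is
at least 1 minus the length that remains. Both lengths tend to zero along an arc of finite length.
-/
theorem tendsto_potential (h1 : ∀ α ∈ arcsJoining Ω A B, 1 ≤ arcLength ρ α) {α : ℝ → ℂ}
    (hα : α ∈ arcsJoining Ω A B) (hfin : arcLength ρ α < ∞) :
    Filter.Tendsto (fun t => potential ρ Ω A (α (1 - t)) - potential ρ Ω A (α t))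
      (nhdsWithin 0 (Ioi 0)) (nhds 1) := by
  have hfin' : ∀ s ⊆ Icc (0 : ℝ) 1, pathLength ρ α s ≠ ∞ := fun s hs => by
    refine ((pathLength_mono ρ α hs).trans_lt ?_).ne
    rwa [← pathLength_congr_ae ρ α Ioo_ae_eq_Icc]
  have l0 := (ENNReal.tendsto_toReal ENNReal.zero_ne_top).comp (tendsto_pathLength_zero hfin)
  have l1 := (ENNReal.tendsto_toReal ENNReal.zero_ne_top).comp (tendsto_pathLength_one hfin)
  have hlow := (tendsto_const_nhds (x := (1 : ℝ))).sub (l0.add l1)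
  simp only [ENNReal.toReal_zero, add_zero, sub_zero] at hlow
  refine tendsto_of_tendsto_of_tendsto_of_le_of_le' hlow tendsto_const_nhds ?_
    (Filter.Eventually.of_forall fun t => by
      linarith [potential_le_one (ρ := ρ) (Ω := Ω) (A := A) (α (1 - t)),
        potential_nonneg (ρ := ρ) (Ω := Ω) (A := A) (α t)])
  filter_upwards [Ioo_mem_nhdsGT zero_lt_one] with t ht
  have e0 : potential ρ Ω A (α t) ≤ (pathLength ρ α (Ioc 0 t)).toReal :=
    ENNReal.toReal_mono (hfin' _ fun s hs => ⟨hs.1.le, hs.2.trans ht.2.le⟩)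
      ((min_le_right _ _).trans (arcDist_le_pathLength hα.1 hα.2.1 hα.2.2.1 hα.2.2.2.1 ht))
  have ht' : 1 - t ∈ Ioo (0 : ℝ) 1 := ⟨by linarith [ht.2], by linarith [ht.1]⟩
  have hf1 := hfin' (Ico (1 - t) 1) fun s hs => ⟨by linarith [hs.1, ht.2], hs.2.le⟩
  have e1 := toReal_min_one_sub_le (le_arcDist_add_Ico h1 hα.1 hα.2.1 hα.2.2.1 hα.2.2.2.2 ht') hf1
  simp only [min_self, ENNReal.toReal_one] at e1
  simp only [Function.comp_apply]
  unfold potential at e0 ⊢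
  linarith

/-- Finite length for the mollified metric forces almost all displaced arcs to have finite
`ρ`-length. The potential increases by 1 along these, and dominated convergence carries this over to
the average. -/
theorem tendsto_smoothPotential (hΩ : IsOpen Ω) (hr : IsRadius Ω ε r) (hε0 : 0 ≤ ε) (hε1 : ε ≤ 1)
    (hA : A ⊆ Ωᶜ) (hB : B ⊆ Ωᶜ) (hρm : Measurable ρ) (ha : area ρ Ω < ∞)
    (hρ : ContinuousOn ρ Ω) (h1 : ∀ α ∈ arcsJoining Ω A B, 1 ≤ arcLength ρ α) {α : ℝ → ℂ}
    (hα : α ∈ arcsJoining Ω A B) (hfin : arcLength (mollifyMetric Ω r ρ) α < ∞) :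
    Filter.Tendsto (fun t => smoothPotential ρ Ω A r (α (1 - t)) - smoothPotential ρ Ω A r (α t))
      (nhdsWithin 0 (Ioi 0)) (nhds 1) := by
  set f := Ω.indicator (potential ρ Ω A) with hf
  have hli := locallyIntegrable_indicator_potential (A := A) hΩ hρ
  have hm := measurable_indicator_potential (A := A) hΩ hρ
  have hpm : ∀ z, Measurable fun w => f (push r w z) := fun z =>
    hm.comp ((measurable_push hr.contDiff.continuous).comp (measurable_id.prodMk measurable_const))
  have hlt : ∀ᵐ w ∂bumpMeasure, arcLength ρ (push r w ∘ α) < ∞ := by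
    have hle := lintegral_pathLength_push_le hΩ hr hε0 hε1 hρm ha isOpen_Ioo hα.2.1 hα.2.2.1
    have hlt := hle.trans_lt (ENNReal.mul_lt_top ENNReal.ofReal_lt_top hfin)
    have hmeas : AEMeasurable (fun w => arcLength ρ (push r w ∘ α)) bumpMeasure := by
      have hae : AEMeasurable (fun q : ℂ × ℝ => (q.1, α q.2))
          (bumpMeasure.prod (volume.restrict (Ioo (0 : ℝ) 1))) :=
        measurable_fst.aemeasurable.prodMk
          ((aemeasurable_comp_arc measurableSet_Ioo hα.2.1.continuousOn).comp_snd)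
      -- Measurability in the displacement is visible only after the derivative of the displaced arc
      -- has been written out by the chain rule.
      have hF : AEMeasurable (fun q : ℂ × ℝ => ((ρ (push r q.1 (α q.2)) : ℝ≥0) : ℝ≥0∞) *
          ‖deriv α q.2 + fderiv ℝ r (α q.2) (deriv α q.2) • q.1‖ₑ)
          (bumpMeasure.prod (volume.restrict (Ioo (0 : ℝ) 1))) := by
        refine ((hρm.comp (measurable_push hr.contDiff.continuous)).coe_nnreal_ennreal.comp_aemeasurable
          hae).mul ?_
        have hd : Measurable fun q : ℂ × ℝ => deriv α q.2 := (measurable_deriv α).comp measurable_snd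
        have hφ : Continuous fun q : (ℂ × ℂ) × ℂ => q.2 + fderiv ℝ r q.1.2 q.2 • q.1.1 := by
          have : Continuous (fderiv ℝ r) := hr.contDiff.continuous_fderiv one_ne_zero
          fun_prop
        exact ((hφ.measurable.comp_aemeasurable (hae.prodMk hd.aemeasurable))).enorm
      refine (hF.lintegral_prod_right').congr (Filter.Eventually.of_forall fun w => ?_)
      refine setLIntegral_congr_fun measurableSet_Ioo fun t ht => ?_
      have := ((hr.hasFDerivAt_push w (α t)).comp_hasDerivAt t
        (hasDerivAt_of_contDiffOn isOpen_Ioo hα.2.1 ht)).deriv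
      simp only [Function.comp_def] at this ⊢
      rw [this]
      simp
    exact ae_lt_top' hmeas hlt.ne
  have hlim := tendsto_integral_filter_of_dominated_convergence (μ := bumpMeasure)
    (l := nhdsWithin (0 : ℝ) (Ioi 0))
    (F := fun t w => f (push r w (α (1 - t))) - f (push r w (α t))) (f := fun _ => 1)
    (fun _ => 1)
    (Filter.Eventually.of_forall fun t => ((hpm _).sub (hpm _)).aestronglyMeasurable)
    (Filter.Eventually.of_forall fun t => Filter.Eventually.of_forall fun w => by
      have a := indicator_potential_mem (ρ := ρ) (Ω := Ω) (A := A) (push r w (α (1 - t)))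
      have b := indicator_potential_mem (ρ := ρ) (Ω := Ω) (A := A) (push r w (α t))
      rw [Real.norm_eq_abs, abs_le]
      exact ⟨by linarith [a.1, b.2], by linarith [a.2, b.1]⟩)
    (integrable_const _)
    (by
      filter_upwards [hlt, ae_norm_lt_one] with w hw hw1
      refine (tendsto_potential h1 (push_comp_mem_arcsJoining hr hε1 hA hB hw1 hα) hw).congr' ?_
      filter_upwards [Ioo_mem_nhdsGT zero_lt_one] with t ht
      rw [hf, indicator_of_mem (hr.push_mem hε1 hw1 (hα.2.2.1 ht)), indicator_of_mem
        (hr.push_mem hε1 hw1 (hα.2.2.1 ⟨by linarith [ht.2], by linarith [ht.1]⟩))]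
      rfl)
  simp only [integral_const, probReal_univ, smul_eq_mul, mul_one] at hlim
  refine hlim.congr' ?_
  filter_upwards [Ioo_mem_nhdsGT zero_lt_one] with t ht
  exact integral_sub (integrable_comp_push hr hli hm
      (hα.2.2.1 ⟨by linarith [ht.2], by linarith [ht.1]⟩))
    (integrable_comp_push hr hli hm (hα.2.2.1 ht))

end

end Scherk
end

noncomputable section
namespace Scherk

/-! ### Extremal length is the reciprocal of the least Dirichlet energy -/

/-- The length of the gradient of a function, as a conformal metric. -/
def gradNorm (u : ℂ → ℝ) (z : ℂ) : ℝ≥0 := ‖fderiv ℝ u z‖₊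

theorem measurable_gradNorm (u : ℂ → ℝ) : Measurable (gradNorm u) :=
  (measurable_fderiv ℝ u).nnnorm

/-- Functions of finite Dirichlet energy that increase by `s` along the arcs joining `A` to `B`,
with the exception of the arcs of infinite length for a suitable metric of finite area. -/
structure IsPotential (Ω A B : Set ℂ) (s : ℝ) (u : ℂ → ℝ) : Prop where
  contDiffOn : ContDiffOn ℝ 1 u Ω
  area_lt_top : area (gradNorm u) Ω < ∞
  exists_metric : ∃ ρ : ℂ → ℝ≥0, Measurable ρ ∧ area ρ Ω < ∞ ∧ ∀ α ∈ arcsJoining Ω A B,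
    arcLength ρ α < ∞ →
      Filter.Tendsto (fun t => u (α (1 - t)) - u (α t)) (nhdsWithin 0 (Ioi 0)) (nhds s)

/-- The least Dirichlet energy of a potential with increase `1`. -/
def minEnergy (Ω A B : Set ℂ) : ℝ≥0∞ :=
  ⨅ (u : ℂ → ℝ) (_ : IsPotential Ω A B 1 u), area (gradNorm u) Ω

/-- A class of arcs, as a class of systems of arcs with one member. -/
def singletons (Γ : Set (ℝ → ℂ)) : Set (List (ℝ → ℂ)) := {L | ∃ α ∈ Γ, L = [α]}

theorem iInf_singletons (ρ : ℂ → ℝ≥0) (Γ : Set (ℝ → ℂ)) :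
    ⨅ L ∈ singletons Γ, systemLength ρ L = ⨅ α ∈ Γ, arcLength ρ α := by
  refine le_antisymm (le_iInf₂ fun α hα => ?_) (le_iInf₂ fun L hL => ?_)
  · exact (iInf₂_le [α] ⟨α, hα, rfl⟩).trans_eq (by simp [systemLength])
  · obtain ⟨α, hα, rfl⟩ := hL
    exact (iInf₂_le α hα).trans_eq (by simp [systemLength])

/-- From `2 * a * b ≤ a ^ 2 + b ^ 2` applied to the cross term. As `η → 0` the bound tends to the
area of `ρ`. -/
theorem area_add_le {ρ ρ' : ℂ → ℝ≥0} (hρ : Measurable ρ) (η : ℝ≥0) (Ω : Set ℂ) :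
    area (fun z => ρ z + η * ρ' z) Ω ≤
      (1 + η) * area ρ Ω + (η + η ^ 2 : ℝ≥0) * area ρ' Ω := by
  have h1 : AEMeasurable (fun z => (1 + η : ℝ≥0∞) * (ρ z : ℝ≥0∞) ^ 2) (volume.restrict Ω) :=
    ((hρ.coe_nnreal_ennreal.pow_const 2).const_mul _).aemeasurable
  rw [area, area, area, ← lintegral_const_mul' _ _ (by finiteness),
    ← lintegral_const_mul' _ _ ENNReal.coe_ne_top, ← lintegral_add_left' h1]
  refine lintegral_mono fun z => ?_
  have : (ρ z + η * ρ' z) ^ 2 ≤ (1 + η) * ρ z ^ 2 + (η + η ^ 2) * ρ' z ^ 2 := by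
    rw [← NNReal.coe_le_coe]
    push_cast
    nlinarith [mul_nonneg η.2 (sq_nonneg ((ρ z : ℝ) - ρ' z)), η.2]
  have h2 := ENNReal.coe_le_coe.2 this
  push_cast at h2 ⊢
  exact h2

section

variable {Ω A B : Set ℂ}

theorem enorm_sub_le_pathLength_gradNorm {u : ℂ → ℝ} (hΩ : IsOpen Ω) (hu : ContDiffOn ℝ 1 u Ω)
    {α : ℝ → ℂ} {s : Set ℝ} (hs : IsOpen s) (hα : ContDiffOn ℝ 1 α s) (hαΩ : MapsTo α s Ω)
    {a b : ℝ} (hab : a ≤ b) (habs : Icc a b ⊆ s) :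
    ‖u (α b) - u (α a)‖ₑ ≤ pathLength (gradNorm u) α (Icc a b) := by
  have h := enorm_sub_le_lintegral_deriv_of_contDiffOn_Icc
    ((hu.comp hα hαΩ).mono habs) hab
  refine h.trans (setLIntegral_mono' measurableSet_Icc fun t ht => ?_)
  have hd := ((hu.differentiableOn one_ne_zero).differentiableAt
    (hΩ.mem_nhds (hαΩ (habs ht)))).hasFDerivAt.comp_hasDerivAt t
      (hasDerivAt_of_contDiffOn hs hα (habs ht))
  rw [hd.deriv]
  simp only [enorm_eq_nnnorm, gradNorm]
  exact_mod_cast ContinuousLinearMap.le_opNNNorm _ _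

/-- An arc of finite `ρ`-length has gradient length at least the limit of the increments of `u`,
which is 1. All other arcs are infinitely long because of the term with `ρ`. The extra summand `ρ'`
only increases lengths; it will keep the area positive. -/
theorem one_le_arcLength_of_isPotential {u : ℂ → ℝ} (hΩ : IsOpen Ω) (hu : IsPotential Ω A B 1 u)
    {ρ : ℂ → ℝ≥0} (hρ : ∀ α ∈ arcsJoining Ω A B, arcLength ρ α < ∞ →
      Filter.Tendsto (fun t => u (α (1 - t)) - u (α t)) (nhdsWithin 0 (Ioi 0)) (nhds 1))
    {η : ℝ≥0} (hη : 0 < η) {ρ' : ℂ → ℝ≥0} {α : ℝ → ℂ} (hα : α ∈ arcsJoining Ω A B) :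
    1 ≤ arcLength (fun z => gradNorm u z + η * (ρ z + ρ' z)) α := by
  by_cases hfin : arcLength ρ α < ∞
  · have hlim := (hρ α hα hfin).enorm
    rw [enorm_one] at hlim
    refine le_of_tendsto hlim ?_
    filter_upwards [Ioo_mem_nhdsGT (show (0 : ℝ) < 1 / 2 by norm_num)] with t ht
    refine (enorm_sub_le_pathLength_gradNorm hΩ hu.contDiffOn isOpen_Ioo hα.2.1 hα.2.2.1
      (by linarith [ht.2]) fun s hs => ⟨ht.1.trans_le hs.1, by linarith [hs.2, ht.1]⟩).trans ?_
    refine (pathLength_mono _ _ (t := Ioo 0 1)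
      fun s hs => ⟨ht.1.trans_le hs.1, by linarith [hs.2, ht.1]⟩).trans ?_
    refine lintegral_mono fun s => ?_
    gcongr
    exact le_self_add
  · have h1 : (η : ℝ≥0∞) * arcLength ρ α ≤
        arcLength (fun z => gradNorm u z + η * (ρ z + ρ' z)) α := by
      rw [← arcLength_const_mul]
      refine lintegral_mono fun s => ?_
      gcongr
      change η * ρ (α s) ≤ gradNorm u (α s) + η * (ρ (α s) + ρ' (α s))
      rw [mul_add, ← add_assoc, add_right_comm]
      exact le_add_self
    rw [not_lt_top_iff.1 hfin, ENNReal.mul_top (by simpa using hη.ne')] at h1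
    exact le_top.trans h1

theorem exists_unit_metric (hΩ : IsOpen Ω) (hne : Ω.Nonempty) :
    ∃ ρ : ℂ → ℝ≥0, Measurable ρ ∧ 0 < area ρ Ω ∧ area ρ Ω < ∞ := by
  obtain ⟨z, hz⟩ := hne
  refine ⟨(Metric.ball z 1).indicator 1, measurable_one.indicator Metric.isOpen_ball.measurableSet,
    ?_⟩
  have h : area ((Metric.ball z 1).indicator 1) Ω = volume (Ω ∩ Metric.ball z 1) := by
    rw [area, inter_comm, ← Measure.restrict_apply Metric.isOpen_ball.measurableSet,
      ← lintegral_indicator_one Metric.isOpen_ball.measurableSet]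
    refine lintegral_congr fun y => ?_
    by_cases hy : y ∈ Metric.ball z 1 <;> simp [hy]
  rw [h]
  exact ⟨(hΩ.inter Metric.isOpen_ball).measure_pos volume ⟨z, hz, Metric.mem_ball_self one_pos⟩,
    (measure_mono inter_subset_right).trans_lt measure_ball_lt_top⟩

/-- The perturbed gradient is an admissible metric for every `η > 0`, and its area tends to the
energy of the potential as `η → 0`. -/
theorem inv_minEnergy_le_extremalLength (hΩ : IsOpen Ω) (hne : Ω.Nonempty) :
    (minEnergy Ω A B)⁻¹ ≤ extremalLength Ω (singletons (arcsJoining Ω A B)) := by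
  rw [ENNReal.inv_le_iff_inv_le]
  refine le_iInf₂ fun u hu => ?_
  obtain ⟨ρ, hρm, hρa, hρ⟩ := hu.exists_metric
  obtain ⟨ρ', hm', ha0, ha'⟩ := exists_unit_metric hΩ hne
  set D := area (gradNorm u) Ω
  set E := extremalLength Ω (singletons (arcsJoining Ω A B))
  have hsum : area (fun z => ρ z + ρ' z) Ω < ∞ := by
    have h := area_add_le (ρ' := ρ') hρm 1 Ω
    simp only [one_mul] at h
    refine h.trans_lt ?_
    have h1 : ((1 : ℝ≥0∞) + (1 : ℝ≥0)) * area ρ Ω < ∞ := ENNReal.mul_lt_top (by simp) hρa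
    exact ENNReal.add_lt_top.2 ⟨h1, ENNReal.mul_lt_top ENNReal.coe_lt_top ha'⟩
  have key : ∀ η : ℝ≥0, 0 < η →
      E⁻¹ ≤ (1 + η) * D + (η + η ^ 2 : ℝ≥0) * area (fun z => ρ z + ρ' z) Ω := by
    intro η hη
    set σ : ℂ → ℝ≥0 := fun z => gradNorm u z + η * (ρ z + ρ' z)
    have hle := area_add_le (ρ' := fun z => ρ z + ρ' z) (measurable_gradNorm u) η Ω
    have hσm : Measurable σ := (measurable_gradNorm u).add ((hρm.add hm').const_mul η)
    have hσa : area σ Ω < ∞ := hle.trans_lt (ENNReal.add_lt_top.2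
      ⟨ENNReal.mul_lt_top (by simp) hu.area_lt_top, ENNReal.mul_lt_top ENNReal.coe_lt_top hsum⟩)
    -- Nothing is known here about positivity of the gradient or of the exceptional metric, so the
    -- positive area is contributed by `ρ'`.
    have hσ0 : 0 < area σ Ω := by
      have : area (fun z => η * ρ' z) Ω ≤ area σ Ω := by
        refine lintegral_mono fun z => ?_
        gcongr
        simp only [σ]
        rw [mul_add, ← add_assoc]
        exact le_add_self
      refine lt_of_lt_of_le ?_ this
      rw [area_const_mul]
      exact ENNReal.mul_pos (by simpa using hη.ne') ha0.ne'
    have h1 : (area σ Ω)⁻¹ ≤ E := by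
      refine le_trans ?_ (le_iSup₂_of_le σ ⟨hσm, hσ0, hσa⟩ le_rfl)
      rw [iInf_singletons, ← one_div]
      gcongr
      refine one_le_pow₀ (le_iInf₂ fun α hα => ?_)
      exact one_le_arcLength_of_isPotential hΩ hu hρ hη hα
    exact (ENNReal.inv_le_iff_inv_le.1 h1).trans hle
  have hlim : Filter.Tendsto (fun η : ℝ≥0 => (1 + η : ℝ≥0∞) * D +
      (η + η ^ 2 : ℝ≥0) * area (fun z => ρ z + ρ' z) Ω) (nhdsWithin 0 (Ioi 0))
      (nhds ((1 + (0 : ℝ≥0)) * D + ((0 : ℝ≥0) + (0 : ℝ≥0) ^ 2 : ℝ≥0) *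
        area (fun z => ρ z + ρ' z) Ω)) := by
    refine Filter.Tendsto.mono_left ?_ nhdsWithin_le_nhds
    refine Filter.Tendsto.add (ENNReal.Tendsto.mul_const ?_ (Or.inr hu.area_lt_top.ne))
      (ENNReal.Tendsto.mul_const ?_ (Or.inr hsum.ne))
    · exact tendsto_const_nhds.add (ENNReal.tendsto_coe.2 Filter.tendsto_id)
    · refine ENNReal.tendsto_coe.2 ?_
      have : Continuous fun η : ℝ≥0 => η + η ^ 2 := by fun_prop
      exact this.tendsto 0
  have := ge_of_tendsto hlim (by
    filter_upwards [self_mem_nhdsWithin] with η hη using key η hη)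
  simpa using this

/-- Two mollifications with the same radius function: one makes the metric continuous, the other
makes the truncated distance of the resulting metric `C¹`. Each costs a factor `(1 + ε) ^ 2` times
the inverse Jacobian bound in area. -/
theorem exists_isPotential_of_one_le {ρ : ℂ → ℝ≥0} (hΩ : IsOpen Ω) (hA : A ⊆ Ωᶜ) (hB : B ⊆ Ωᶜ)
    (hρm : Measurable ρ) (ha : area ρ Ω < ∞)
    (h1 : ∀ α ∈ arcsJoining Ω A B, 1 ≤ arcLength ρ α) {ε : ℝ} (hε0 : 0 < ε)
    (hε : 2 * ε + 2 * ε ^ 2 < 1) :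
    ∃ u, IsPotential Ω A B 1 u ∧ area (gradNorm u) Ω ≤
      ENNReal.ofReal (((1 + ε) ^ 2 * (1 - (2 * ε + 2 * ε ^ 2))⁻¹) ^ 2) * area ρ Ω := by
  have hε1 : ε ≤ 1 := by nlinarith
  have hκ : 0 < 1 - (2 * ε + 2 * ε ^ 2) := by linarith
  obtain ⟨r, hr⟩ := exists_isRadius hΩ hε0
  -- Mollification may shorten arcs by a factor `1 + ε`. Multiplying by `c` restores lengths of at
  -- least 1.
  set c : ℝ≥0 := (1 + ε).toNNReal with hc
  have hcr : (c : ℝ) = 1 + ε := Real.coe_toNNReal _ (by linarith)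
  set K := ENNReal.ofReal (1 - (2 * ε + 2 * ε ^ 2))⁻¹ with hK
  have hKtop : K < ∞ := ENNReal.ofReal_lt_top
  have hM1 : area (mollifyMetric Ω r ρ) Ω ≤ K * area ρ Ω :=
    area_mollifyMetric_le hΩ.measurableSet hr hε hρm ha
  set ρ₁ : ℂ → ℝ≥0 := fun z => c * mollifyMetric Ω r ρ z with hρ₁
  have hm₁ : Measurable ρ₁ :=
    (measurable_mollifyMetric hΩ.measurableSet hr.contDiff.continuous hρm).const_mul c
  have ha₁ : area ρ₁ Ω ≤ (c : ℝ≥0∞) ^ 2 * (K * area ρ Ω) := by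
    rw [hρ₁, area_const_mul]; gcongr
  have ha₁' : area ρ₁ Ω < ∞ := ha₁.trans_lt
    (ENNReal.mul_lt_top (by simp) (ENNReal.mul_lt_top hKtop ha))
  have hc₁ : ContinuousOn ρ₁ Ω :=
    continuousOn_const.mul (continuousOn_mollifyMetric hΩ hr hρm ha)
  have hl₁ : ∀ α ∈ arcsJoining Ω A B, 1 ≤ arcLength ρ₁ α := fun α hα => by
    rw [hρ₁, arcLength_const_mul]
    exact le_arcLength_mollifyMetric hΩ hr hε0.le hε1 hA hB hρm ha h1 hα
  have hM2 : area (mollifyMetric Ω r ρ₁) Ω ≤ K * area ρ₁ Ω :=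
    area_mollifyMetric_le hΩ.measurableSet hr hε hm₁ ha₁'
  have hE : area (gradNorm (smoothPotential ρ₁ Ω A r)) Ω ≤
      (c : ℝ≥0∞) ^ 2 * area (mollifyMetric Ω r ρ₁) Ω := by
    rw [← area_const_mul]
    refine setLIntegral_mono' hΩ.measurableSet fun z hz => ?_
    gcongr
    rw [← NNReal.coe_le_coe, NNReal.coe_mul, hcr]
    exact norm_fderiv_smoothPotential_le hΩ hr hε0.le hε1 hm₁ ha₁' hc₁ hz
  have hE' : area (gradNorm (smoothPotential ρ₁ Ω A r)) Ω ≤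
      ENNReal.ofReal (((1 + ε) ^ 2 * (1 - (2 * ε + 2 * ε ^ 2))⁻¹) ^ 2) * area ρ Ω := by
    refine (hE.trans (mul_le_mul' le_rfl (hM2.trans (mul_le_mul' le_rfl ha₁)))).trans_eq ?_
    have hcc : (c : ℝ≥0∞) = ENNReal.ofReal (1 + ε) := rfl
    rw [hcc, hK, mul_pow, ENNReal.ofReal_mul (by positivity), ← pow_mul,
      ENNReal.ofReal_pow (by positivity), ENNReal.ofReal_pow (by positivity)]
    ring
  refine ⟨smoothPotential ρ₁ Ω A r,
    ⟨contDiffOn_mollify hΩ hr (locallyIntegrable_indicator_potential hΩ hc₁),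
      hE'.trans_lt (ENNReal.mul_lt_top ENNReal.ofReal_lt_top ha),
      mollifyMetric Ω r ρ₁, measurable_mollifyMetric hΩ.measurableSet hr.contDiff.continuous hm₁,
      hM2.trans_lt (ENNReal.mul_lt_top hKtop ha₁'), fun α hα hfin => ?_⟩, hE'⟩
  exact tendsto_smoothPotential hΩ hr hε0.le hε1 hA hB hm₁ ha₁' hc₁ hl₁ hα hfin

theorem minEnergy_le_area {ρ : ℂ → ℝ≥0} (hΩ : IsOpen Ω) (hA : A ⊆ Ωᶜ) (hB : B ⊆ Ωᶜ)
    (hρm : Measurable ρ) (ha : area ρ Ω < ∞)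
    (h1 : ∀ α ∈ arcsJoining Ω A B, 1 ≤ arcLength ρ α) : minEnergy Ω A B ≤ area ρ Ω := by
  have hlim : Filter.Tendsto (fun ε : ℝ => ENNReal.ofReal
      (((1 + ε) ^ 2 * (1 - (2 * ε + 2 * ε ^ 2))⁻¹) ^ 2) * area ρ Ω) (nhdsWithin 0 (Ioi 0))
      (nhds (1 * area ρ Ω)) := by
    refine ENNReal.Tendsto.mul_const ?_ (Or.inr ha.ne)
    refine Filter.Tendsto.mono_left ?_ nhdsWithin_le_nhds
    have h : ContinuousAt (fun ε : ℝ => ((1 + ε) ^ 2 * (1 - (2 * ε + 2 * ε ^ 2))⁻¹) ^ 2) 0 := by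
      have : ContinuousAt (fun ε : ℝ => (1 - (2 * ε + 2 * ε ^ 2))⁻¹) 0 :=
        ContinuousAt.inv₀ (by fun_prop) (by norm_num)
      fun_prop
    have h2 := (ENNReal.continuous_ofReal.continuousAt).comp h
    simpa [ContinuousAt, Function.comp_def] using h2
  rw [one_mul] at hlim
  refine ge_of_tendsto hlim ?_
  filter_upwards [Ioo_mem_nhdsGT (show (0 : ℝ) < 1 / 4 by norm_num)] with ε hε
  obtain ⟨u, hu, hle⟩ := exists_isPotential_of_one_le hΩ hA hB hρm ha h1 hε.1
    (by nlinarith [hε.1, hε.2])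
  exact (iInf₂_le u hu).trans hle

/-- A metric divided by a number below its length `ℓ` is admissible, so its area bounds the least
energy from above. -/
theorem extremalLength_le_inv_minEnergy (hΩ : IsOpen Ω) (hA : A ⊆ Ωᶜ) (hB : B ⊆ Ωᶜ) :
    extremalLength Ω (singletons (arcsJoining Ω A B)) ≤ (minEnergy Ω A B)⁻¹ := by
  refine iSup₂_le fun ρ hρ => ?_
  obtain ⟨hm, h0, ht⟩ := hρ
  rw [iInf_singletons]
  set ℓ := ⨅ α ∈ arcsJoining Ω A B, arcLength ρ α
  -- Finite numbers `s < ℓ` are used instead of `ℓ` because `ℓ` may be infinite; the supremum over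
  -- `s` is taken at the end.
  have key : ∀ s : ℝ≥0, (s : ℝ≥0∞) < ℓ → (s : ℝ≥0∞) ^ 2 / area ρ Ω ≤ (minEnergy Ω A B)⁻¹ := by
    intro s hs
    rcases eq_or_ne s 0 with rfl | hs0
    · simp
    have hs0' : (s : ℝ≥0∞) ≠ 0 := by simpa using hs0
    have h := minEnergy_le_area (ρ := fun z => s⁻¹ * ρ z) hΩ hA hB (hm.const_mul _)
      (by rw [area_const_mul]; exact ENNReal.mul_lt_top (by simp) ht) fun α hα => by
        rw [arcLength_const_mul, ENNReal.coe_inv hs0, ← ENNReal.div_eq_inv_mul,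
          ENNReal.le_div_iff_mul_le (Or.inl hs0') (Or.inl ENNReal.coe_ne_top), one_mul]
        exact hs.le.trans (iInf₂_le α hα)
    rw [area_const_mul, ENNReal.coe_inv hs0] at h
    rw [ENNReal.le_inv_iff_le_inv]
    refine h.trans_eq ?_
    rw [ENNReal.inv_div (Or.inl ht.ne) (Or.inl h0.ne'), ENNReal.div_eq_inv_mul, ENNReal.inv_pow]
  by_contra hlt
  rw [not_le, ENNReal.lt_div_iff_mul_lt (Or.inl h0.ne') (Or.inl ht.ne)] at hlt
  have hlt2 : ((minEnergy Ω A B)⁻¹ * area ρ Ω) ^ (1 / 2 : ℝ) < ℓ := by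
    have := ENNReal.rpow_lt_rpow hlt (show (0 : ℝ) < 1 / 2 by norm_num)
    rwa [← ENNReal.rpow_natCast ℓ, ← ENNReal.rpow_mul, Nat.cast_ofNat,
      mul_one_div_cancel two_ne_zero, ENNReal.rpow_one] at this
  obtain ⟨s, hs1, hs2⟩ := ENNReal.lt_iff_exists_nnreal_btwn.1 hlt2
  have h3 := key s hs2
  rw [ENNReal.div_le_iff_le_mul (Or.inl h0.ne') (Or.inl ht.ne)] at h3
  have h4 := ENNReal.rpow_le_rpow h3 (show (0 : ℝ) ≤ 1 / 2 by norm_num)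
  rw [← ENNReal.rpow_natCast (s : ℝ≥0∞), ← ENNReal.rpow_mul, Nat.cast_ofNat,
    mul_one_div_cancel two_ne_zero, ENNReal.rpow_one] at h4
  exact absurd hs1 (not_lt.2 h4)

theorem extremalLength_eq_inv_minEnergy (hΩ : IsOpen Ω) (hne : Ω.Nonempty) (hA : A ⊆ Ωᶜ)
    (hB : B ⊆ Ωᶜ) :
    extremalLength Ω (singletons (arcsJoining Ω A B)) = (minEnergy Ω A B)⁻¹ :=
  le_antisymm (extremalLength_le_inv_minEnergy hΩ hA hB) (inv_minEnergy_le_extremalLength hΩ hne)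

end

end Scherk
end

noncomputable section
namespace Scherk

/-! ### Minima of quadratic forms depending analytically on a parameter -/

section

variable {X : Type*} [NormedAddCommGroup X] [InnerProductSpace ℝ X]

/-- By continuity the first-order condition extends from `N` to its closure, and the form at `f + k`
exceeds the value at `f + h` by the form at `k - h`. Since `h` need only lie in the closure, the
value is an infimum, which is approached by density. -/
theorem isGLB_quadratic_of_symmetric {S : X →L[ℝ] X} (hsym : ∀ f g, inner ℝ (S f) g = inner ℝ f (S g))
    (hpos : ∀ f, 0 ≤ inner ℝ (S f) f) {N : Submodule ℝ X} {f : X} {h : X}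
    (hh : h ∈ N.topologicalClosure) (hmin : ∀ k ∈ N, inner ℝ (S (f + h)) k = 0) :
    IsGLB ((fun k => inner ℝ (S (f + k)) (f + k)) '' (N : Set X)) (inner ℝ (S (f + h)) (f + h)) := by
  have hcont : Continuous fun k => inner ℝ (S (f + h)) k := by fun_prop
  have hmin' : ∀ k ∈ N.topologicalClosure, inner ℝ (S (f + h)) k = 0 := fun k hk =>
    (isClosed_eq hcont continuous_const).closure_subset_iff.2 hmin hk
  refine ⟨?_, fun c hc => ?_⟩
  · rintro _ ⟨k, hk, rfl⟩
    have hk' : k - h ∈ N.topologicalClosure :=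
      Submodule.sub_mem _ (N.le_topologicalClosure hk) hh
    have e : f + k = (f + h) + (k - h) := by abel
    have e2 : inner ℝ (S (k - h)) (f + h) = 0 := by
      rw [hsym, real_inner_comm]; exact hmin' _ hk'
    have key : ∀ a b : X, inner ℝ (S (a + b)) (a + b) =
        inner ℝ (S a) a + inner ℝ (S a) b + (inner ℝ (S b) a + inner ℝ (S b) b) := fun a b => by
      rw [map_add, inner_add_left, inner_add_right, inner_add_right]
    simp only
    rw [e, key (f + h), hmin' _ hk', e2]
    linarith [hpos (k - h)]
  · have hclosed : IsClosed {k : X | c ≤ inner ℝ (S (f + k)) (f + k)} :=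
      isClosed_le continuous_const (by fun_prop)
    exact hclosed.closure_subset_iff.2 (fun k hk => hc ⟨k, hk, rfl⟩) hh

/-- Only the symmetric part `S` of `Q` matters. With `P` the projection to the closure of `N`, the
minimizing `h` is determined by `P S (f + h) = 0`. Solving this means inverting the compression of
`S`, which is close to the identity, and inversion is analytic. -/
theorem exists_analyticAt_isGLB [CompleteSpace X] {E : Type*} [NormedAddCommGroup E] [NormedSpace ℝ E]
    {Q : E → X →L[ℝ] X} {x₀ : E} (hQ : AnalyticAt ℝ Q x₀) (hQ0 : Q x₀ = 1) (N : Submodule ℝ X)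
    (f : X) : ∃ Λ : E → ℝ, AnalyticAt ℝ Λ x₀ ∧ ∀ᶠ x in nhds x₀,
      IsGLB ((fun k => inner ℝ (Q x (f + k)) (f + k)) '' (N : Set X)) (Λ x) := by
  set S : E → X →L[ℝ] X := fun x => (1 / 2 : ℝ) • (Q x + star (Q x)) with hS
  set H := N.topologicalClosure with hH
  have : CompleteSpace H := N.isClosed_topologicalClosure.completeSpace_coe
  set P : X →L[ℝ] X := H.starProjection with hP
  have hSan : AnalyticAt ℝ S x₀ := by
    have h1 : AnalyticAt ℝ (fun x => star (Q x)) x₀ :=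
      ((starL' ℝ : (X →L[ℝ] X) ≃L[ℝ] (X →L[ℝ] X)).toContinuousLinearMap.analyticAt _).comp hQ
    exact (analyticAt_const (v := (1 / 2 : ℝ))).smul (hQ.add h1)
  have hS0 : S x₀ = 1 := by
    simp only [hS, hQ0, star_one]
    rw [← two_smul ℝ (1 : X →L[ℝ] X), smul_smul]; norm_num
  have hsym : ∀ x f g, inner ℝ (S x f) g = inner ℝ f (S x g) := by
    intro x f g
    simp only [hS, _root_.smul_apply, _root_.add_apply,
      inner_smul_left, inner_smul_right, inner_add_left, inner_add_right,
      ContinuousLinearMap.star_eq_adjoint, ContinuousLinearMap.adjoint_inner_left,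
      ContinuousLinearMap.adjoint_inner_right, conj_trivial]
    ring
  have hquad : ∀ x f, inner ℝ (Q x f) f = inner ℝ (S x f) f := by
    intro x f
    have h1 : inner ℝ (S x f) f = (1 / 2) * (inner ℝ (Q x f) f + inner ℝ (star (Q x) f) f) := by
      rw [← inner_add_left, ← real_inner_smul_left]; rfl
    rw [h1, ContinuousLinearMap.star_eq_adjoint, ContinuousLinearMap.adjoint_inner_left,
      real_inner_comm]
    ring
  -- The compression of `S` is completed by the identity on the orthogonal complement, so that it
  -- can be inverted in the algebra of operators on the whole space.
  set T : E → X →L[ℝ] X := fun x => P * S x * P + (1 - P) with hT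
  have hPP : P * P = P := by
    ext v
    exact Submodule.starProjection_eq_self_iff.2 (Submodule.starProjection_apply_mem _ _)
  have hTan : AnalyticAt ℝ T x₀ :=
    ((analyticAt_const.mul hSan).mul analyticAt_const).add analyticAt_const
  have hT0 : T x₀ = 1 := by simp only [hT, hS0, mul_one, hPP]; abel
  have hinv : AnalyticAt ℝ (fun x => Ring.inverse (T x)) x₀ := by
    have h1 : AnalyticAt ℝ (Ring.inverse : (X →L[ℝ] X) → _) (T x₀) := by
      rw [hT0]; exact analyticAt_inverse (𝕜 := ℝ) (1 : (X →L[ℝ] X)ˣ)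
    exact h1.comp hTan
  set h : E → X := fun x => -(P (Ring.inverse (T x) (P (S x f)))) with hh
  have happ : ∀ {L : E → X →L[ℝ] X} {v : E → X}, AnalyticAt ℝ L x₀ → AnalyticAt ℝ v x₀ →
      AnalyticAt ℝ (fun x => L x (v x)) x₀ := fun hL hv =>
    ((ContinuousLinearMap.id ℝ (X →L[ℝ] X)).analyticAt_bilinear _).comp (hL.prod hv)
  have hhan : AnalyticAt ℝ h x₀ :=
    (happ analyticAt_const (happ hinv (happ analyticAt_const (happ hSan analyticAt_const)))).neg
  refine ⟨fun x => inner ℝ (S x (f + h x)) (f + h x), ?_, ?_⟩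
  · exact ((innerSL ℝ : X →L[ℝ] X →L[ℝ] ℝ).analyticAt_bilinear _).comp
      ((happ hSan (analyticAt_const.add hhan)).prod (analyticAt_const.add hhan))
  · have hunit : ∀ᶠ x in nhds x₀, IsUnit (T x) :=
      hTan.continuousAt.eventually (by rw [hT0]; exact Units.isOpen.mem_nhds isUnit_one)
    have hclose : ∀ᶠ x in nhds x₀, ‖S x - 1‖ < 1 := by
      have : Filter.Tendsto (fun x => ‖S x - 1‖) (nhds x₀) (nhds 0) := by
        have := (hSan.continuousAt.sub (continuousAt_const (y := (1 : X →L[ℝ] X)))).norm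
        simpa [ContinuousAt, hS0] using this
      exact this.eventually (gt_mem_nhds one_pos)
    filter_upwards [hunit, hclose] with x hx hx1
    simp only [hquad]
    refine isGLB_quadratic_of_symmetric (hsym x) (fun v => ?_) ?_ fun k hk => ?_
    · have h1 : inner ℝ (S x v) v = ‖v‖ ^ 2 + inner ℝ ((S x - 1) v) v := by
        rw [← real_inner_self_eq_norm_sq, ← inner_add_left]; simp
      have h2 : |inner ℝ ((S x - 1) v) v| ≤ ‖v‖ ^ 2 := by
        refine (abs_real_inner_le_norm _ _).trans ?_
        have := (S x - 1).le_opNorm v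
        nlinarith [norm_nonneg v]
      rw [h1]; linarith [(abs_le.1 h2).1]
    · exact Submodule.neg_mem _ (Submodule.starProjection_apply_mem _ _)
    · have hkP : P k = k :=
        Submodule.starProjection_eq_self_iff.2 (N.le_topologicalClosure hk)
      set g := Ring.inverse (T x) (P (S x f)) with hg
      have hTg : T x g = P (S x f) := by
        rw [hg, ← mul_apply_eq_comp, Ring.mul_inverse_cancel _ hx,
          one_apply_eq_self]
      have hP2 : ∀ v, P (P v) = P v := fun v => by
        rw [← mul_apply_eq_comp, hPP]
      -- Applying `P` to `T g = P S f` removes the part `1 - P`. What remains says that `h = -P g`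
      -- satisfies the first-order condition.
      have hPTg : P (S x (P g)) = P (S x f) := by
        have := congrArg P hTg
        simp only [hT, _root_.add_apply, mul_apply_eq_comp,
          _root_.sub_apply, one_apply_eq_self, map_add, map_sub,
          hP2, sub_self, add_zero] at this
        exact this
      rw [← hkP, ← Submodule.inner_starProjection_left_eq_right, ← hP]
      simp only [hh, map_add, map_neg, hPTg, ← hg]
      simp

end

/-! ### Multiplication operators on `L²` -/

section

variable {ι : Type*} [Fintype ι]

theorem exists_mulOp (μ : Measure ℂ) {φ : ℂ → ℂ →L[ℝ] ℂ} (hφ : AEStronglyMeasurable φ μ) {C : ℝ}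
    (hC : ∀ z, ‖φ z‖ ≤ C) :
    ∃ M : Lp ℂ 2 μ →L[ℝ] Lp ℂ 2 μ, ∀ f, M f =ᵐ[μ] fun z => φ z (f z) := by
  have hmem : MemLp φ ∞ μ := memLp_top_of_bound hφ C (Filter.Eventually.of_forall hC)
  refine ⟨(ContinuousLinearMap.id ℝ (ℂ →L[ℝ] ℂ)).holderL μ ∞ 2 2 (hmem.toLp φ), fun f => ?_⟩
  have h := (ContinuousLinearMap.id ℝ (ℂ →L[ℝ] ℂ)).coeFn_holder (r := 2) (hmem.toLp φ) f
  rw [ContinuousLinearMap.holderL_apply_apply]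
  filter_upwards [h, hmem.coeFn_toLp] with z h1 h2
  rw [h1, h2]; rfl

theorem exists_affine_mulOp (μ : Measure ℂ) {φ : ι → ℂ → ℂ →L[ℝ] ℂ}
    (hφ : ∀ k, AEStronglyMeasurable (φ k) μ) {C : ℝ} (hC : ∀ k z, ‖φ k z‖ ≤ C) :
    ∃ M : (ι → ℝ) → Lp ℂ 2 μ →L[ℝ] Lp ℂ 2 μ, (∀ x, AnalyticAt ℝ M x) ∧ M 0 = 0 ∧
      ∀ x f, M x f =ᵐ[μ] fun z => (∑ k, x k • φ k z) (f z) := by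
  choose M hM using fun k => exists_mulOp μ (hφ k) (hC k)
  refine ⟨fun x => ∑ k, x k • M k, fun x => ?_, by simp, fun x f => ?_⟩
  · refine Finset.analyticAt_fun_sum _ fun k _ => ?_
    exact ((ContinuousLinearMap.proj (R := ℝ) (φ := fun _ : ι => ℝ) k).analyticAt x).smul
      analyticAt_const
  · have h1 : ∀ s : Finset ι, (((∑ k ∈ s, x k • M k) f : Lp ℂ 2 μ) : ℂ → ℂ) =ᵐ[μ]
        fun z => (∑ k ∈ s, x k • φ k z) (f z) := by
      intro s
      induction s using Finset.cons_induction with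
      | empty =>
        simp only [Finset.sum_empty, _root_.zero_apply]
        exact Lp.coeFn_zero _ _ _
      | cons a s ha ih =>
        simp only [Finset.sum_cons, _root_.add_apply, _root_.smul_apply]
        refine (Lp.coeFn_add _ _).trans ?_
        filter_upwards [ih, Lp.coeFn_smul (x a) (M a f), hM a f] with z h1 h2 h3
        rw [Pi.add_apply, h1, h2, Pi.smul_apply, h3]
    exact h1 Finset.univ

end

end Scherk
end

noncomputable section
namespace Scherk

/-! ### Diffeomorphisms of the plane with bounded derivatives -/

/-- `F` and `G` are mutually inverse `C¹` maps whose derivatives are bounded by `C`. -/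
structure IsDiffeoPair (F G : ℂ → ℂ) (C : ℝ≥0) : Prop where
  contDiff : ContDiff ℝ 1 F
  contDiff_inv : ContDiff ℝ 1 G
  left_inv : Function.LeftInverse G F
  right_inv : Function.RightInverse G F
  norm_fderiv_le : ∀ z, ‖fderiv ℝ F z‖ ≤ C
  norm_fderiv_inv_le : ∀ z, ‖fderiv ℝ G z‖ ≤ C

namespace IsDiffeoPair

variable {F G : ℂ → ℂ} {C : ℝ≥0}

theorem symm (h : IsDiffeoPair F G C) : IsDiffeoPair G F C :=
  ⟨h.2, h.1, h.right_inv, h.left_inv, h.6, h.5⟩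

theorem hasFDerivAt (h : IsDiffeoPair F G C) (z : ℂ) : HasFDerivAt F (fderiv ℝ F z) z :=
  (h.contDiff.differentiable one_ne_zero z).hasFDerivAt

theorem fderiv_inv_comp (h : IsDiffeoPair F G C) (z : ℂ) :
    (fderiv ℝ G (F z)).comp (fderiv ℝ F z) = ContinuousLinearMap.id ℝ ℂ := by
  have h1 := (h.symm.hasFDerivAt (F z)).comp z (h.hasFDerivAt z)
  have h2 : G ∘ F = id := funext h.left_inv
  rw [h2] at h1
  exact h1.unique (hasFDerivAt_id z)

/-- The determinants of the derivatives of `F` and of its inverse are reciprocal, and the second is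
at most `2 * C ^ 2`. -/
theorem one_le_abs_det (h : IsDiffeoPair F G C) (z : ℂ) :
    1 ≤ 2 * (C : ℝ) ^ 2 * |(fderiv ℝ F z).det| := by
  have h1 := congrArg ContinuousLinearMap.det (h.fderiv_inv_comp z)
  have h3 : (fderiv ℝ G (F z)).det * (fderiv ℝ F z).det = 1 := by
    rw [ContinuousLinearMap.det, ContinuousLinearMap.toLinearMap_comp, LinearMap.det_comp] at h1
    simpa [ContinuousLinearMap.det] using h1
  have h4 : |(fderiv ℝ G (F z)).det| ≤ 2 * (C : ℝ) ^ 2 :=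
    (abs_det_le _).trans (by gcongr; exact h.norm_fderiv_inv_le _)
  calc (1 : ℝ) = |(fderiv ℝ G (F z)).det| * |(fderiv ℝ F z).det| := by rw [← abs_mul, h3, abs_one]
    _ ≤ _ := by gcongr

theorem isOpen_image (h : IsDiffeoPair F G C) {Ω : Set ℂ} (hΩ : IsOpen Ω) :
    IsOpen (F '' Ω) := by
  rw [image_eq_preimage_of_inverse h.left_inv h.right_inv]
  exact hΩ.preimage h.contDiff_inv.continuous

theorem lintegral_image (h : IsDiffeoPair F G C) {Ω : Set ℂ} (hΩ : MeasurableSet Ω)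
    (f : ℂ → ℝ≥0∞) :
    ∫⁻ z in F '' Ω, f z = ∫⁻ z in Ω, ENNReal.ofReal |(fderiv ℝ F z).det| * f (F z) :=
  lintegral_image_eq_lintegral_abs_det_fderiv_mul volume hΩ
    (fun z _ => (h.hasFDerivAt z).hasFDerivWithinAt) h.left_inv.injective.injOn f

theorem area_comp_le (h : IsDiffeoPair F G C) {Ω : Set ℂ} (hΩ : MeasurableSet Ω) (ρ : ℂ → ℝ≥0) :
    area (ρ ∘ F) Ω ≤ (2 * C ^ 2 : ℝ≥0) * area ρ (F '' Ω) := by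
  rw [area, area, h.lintegral_image hΩ, ← lintegral_const_mul' _ _ ENNReal.coe_ne_top]
  refine lintegral_mono fun z => ?_
  rw [← mul_assoc]
  refine le_mul_of_one_le_left' ?_
  rw [← ENNReal.ofReal_coe_nnreal, ← ENNReal.ofReal_mul (NNReal.coe_nonneg _), ← ENNReal.ofReal_one]
  exact ENNReal.ofReal_le_ofReal (by exact_mod_cast h.one_le_abs_det z)

/-- Bounded derivatives in both directions preserve finite energy, finite area of the exceptional
metric and finite length of arcs, so the arcwise boundary condition is carried over. -/
theorem isPotential_comp (h : IsDiffeoPair F G C) {Ω A B : Set ℂ} (hΩ : IsOpen Ω) {s : ℝ}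
    {u : ℂ → ℝ} (hu : IsPotential (F '' Ω) (F '' A) (F '' B) s u) :
    IsPotential Ω A B s (u ∘ F) := by
  obtain ⟨ρ, hρm, hρa, hρ⟩ := hu.exists_metric
  refine ⟨hu.contDiffOn.comp h.contDiff.contDiffOn fun z hz => mem_image_of_mem F hz, ?_,
    ρ ∘ F, hρm.comp h.contDiff.continuous.measurable, (h.area_comp_le hΩ.measurableSet ρ).trans_lt
      (ENNReal.mul_lt_top ENNReal.coe_lt_top hρa), fun α hα hfin => ?_⟩
  · have h1 : area (gradNorm (u ∘ F)) Ω ≤ (C : ℝ≥0∞) ^ 2 * area (gradNorm u ∘ F) Ω := by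
      rw [← area_const_mul]
      refine setLIntegral_mono' hΩ.measurableSet fun z hz => ?_
      gcongr
      rw [← NNReal.coe_le_coe, NNReal.coe_mul]
      have hd := ((hu.contDiffOn.differentiableOn one_ne_zero).differentiableAt
        ((h.isOpen_image hΩ).mem_nhds (mem_image_of_mem F hz))).hasFDerivAt.comp z (h.hasFDerivAt z)
      simp only [gradNorm, coe_nnnorm, hd.fderiv, Function.comp_apply]
      refine (ContinuousLinearMap.opNorm_comp_le _ _).trans ?_
      rw [mul_comm]
      gcongr
      exact h.norm_fderiv_le z
    refine h1.trans_lt (ENNReal.mul_lt_top (by simp) ?_)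
    exact (h.area_comp_le hΩ.measurableSet _).trans_lt
      (ENNReal.mul_lt_top ENNReal.coe_lt_top hu.area_lt_top)
  · have hmem := comp_mem_arcsJoining h.contDiff (mapsTo_image F Ω) (mapsTo_image F A)
      (mapsTo_image F B) hα
    have hle := pathLength_comp_le (Φ := F) ρ isOpen_Ioo hα.2.1 hα.2.2.1 h.contDiff
      fun z _ => h.norm_fderiv_le z
    exact hρ _ hmem (hle.trans_lt (ENNReal.mul_lt_top ENNReal.coe_lt_top hfin))

theorem isPotential_comp_inv (h : IsDiffeoPair F G C) {Ω A B : Set ℂ} (hΩ : IsOpen Ω) {s : ℝ}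
    {v : ℂ → ℝ} (hv : IsPotential Ω A B s v) :
    IsPotential (F '' Ω) (F '' A) (F '' B) s (v ∘ G) := by
  refine h.symm.isPotential_comp (h.isOpen_image hΩ) ?_
  simpa only [← image_comp, h.left_inv.comp_eq_id, image_id] using hv

end IsDiffeoPair

/-- Such a map differs from the identity by a map with Lipschitz constant `1 / 2`, so it is a
homeomorphism of the plane. Its derivative shrinks vectors by at most a factor 2, which bounds the
derivative of the inverse. -/
theorem exists_isDiffeoPair {F : ℂ → ℂ} (hF : ContDiff ℝ 1 F)
    (h : ∀ z, ‖fderiv ℝ F z - 1‖ ≤ 1 / 2) : ∃ G, IsDiffeoPair F G 2 := by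
  have hFd := fun z => (hF.differentiable one_ne_zero z).hasFDerivAt
  have happrox : ApproximatesLinearOn F ((ContinuousLinearEquiv.refl ℝ ℂ : ℂ ≃L[ℝ] ℂ) : ℂ →L[ℝ] ℂ)
      univ (1 / 2 : ℝ≥0) := by
    rw [ApproximatesLinearOn.approximatesLinearOn_iff_lipschitzOnWith]
    refine Convex.lipschitzOnWith_of_nnnorm_hasFDerivWithin_le (𝕜 := ℝ)
      (f' := fun z => fderiv ℝ F z - 1) (fun z _ => ?_) (fun z _ => ?_) convex_univ
    · exact ((hFd z).sub (ContinuousLinearMap.hasFDerivAt _)).hasFDerivWithinAt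
    · rw [← NNReal.coe_le_coe]; simpa using h z
  have hc : Subsingleton ℂ ∨ (1 / 2 : ℝ≥0) <
      ‖((ContinuousLinearEquiv.refl ℝ ℂ).symm : ℂ →L[ℝ] ℂ)‖₊⁻¹ := by
    right
    have h1 : ‖((ContinuousLinearEquiv.refl ℝ ℂ).symm : ℂ →L[ℝ] ℂ)‖₊ = 1 := by
      rw [← NNReal.coe_inj]; exact ContinuousLinearMap.norm_id
    rw [h1, inv_one]
    exact NNReal.half_lt_self one_ne_zero
  set e := happrox.toHomeomorph F hc with he
  have heF : (e : ℂ → ℂ) = F := rfl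
  have hlow : ∀ z v, ‖v‖ ≤ 2 * ‖fderiv ℝ F z v‖ := by
    intro z v
    have h1 : ‖(fderiv ℝ F z - 1) v‖ ≤ 1 / 2 * ‖v‖ :=
      ((fderiv ℝ F z - 1).le_opNorm v).trans (by gcongr; exact h z)
    have h2 : v = fderiv ℝ F z v - (fderiv ℝ F z - 1) v := by simp
    have h3 := norm_sub_le (fderiv ℝ F z v) ((fderiv ℝ F z - 1) v)
    rw [← h2] at h3
    linarith
  have hequiv : ∀ z, ∃ L : ℂ ≃L[ℝ] ℂ, (L : ℂ →L[ℝ] ℂ) = fderiv ℝ F z := by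
    intro z
    have h1 : ‖(1 : ℂ →L[ℝ] ℂ) - fderiv ℝ F z‖ < 1 := by
      rw [norm_sub_rev]; exact (h z).trans_lt (by norm_num)
    refine ⟨ContinuousLinearEquiv.unitsEquiv ℝ ℂ (Units.oneSub _ h1), ?_⟩
    ext v
    simp
  choose L hL using hequiv
  have hG : ContDiff ℝ 1 e.symm :=
    e.contDiff_symm (f₀' := L) (fun z => by rw [hL]; exact hFd z) hF
  have hinv1 : Function.LeftInverse e.symm F := e.symm_apply_apply
  have hinv2 : Function.RightInverse e.symm F := e.apply_symm_apply
  refine ⟨e.symm, hF, hG, hinv1, hinv2, fun z => ?_, fun z => ?_⟩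
  · have h1 : fderiv ℝ F z = (fderiv ℝ F z - 1) + 1 := by abel
    rw [h1]
    refine (norm_add_le _ _).trans ?_
    have h2 : ‖(1 : ℂ →L[ℝ] ℂ)‖ = 1 := ContinuousLinearMap.norm_id
    have := h z
    rw [h2]; push_cast; linarith
  · refine ContinuousLinearMap.opNorm_le_bound _ (by norm_num) fun v => ?_
    have h1 := (hFd (e.symm z)).comp z (hG.differentiable one_ne_zero z).hasFDerivAt
    have h2 : F ∘ e.symm = id := funext hinv2
    rw [h2] at h1
    have h3 := congrArg (fun M : ℂ →L[ℝ] ℂ => M v) (h1.unique (hasFDerivAt_id z))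
    have h4 := hlow (e.symm z) (fderiv ℝ e.symm z v)
    simp only [ContinuousLinearMap.comp_apply, ContinuousLinearMap.id_apply] at h3
    rw [h3] at h4
    exact_mod_cast h4

/-! ### Linear combinations of potentials -/

section

variable {Ω A B : Set ℂ}

theorem area_add_lt_top {ρ ρ' : ℂ → ℝ≥0} (hρ : Measurable ρ) (h : area ρ Ω < ∞)
    (h' : area ρ' Ω < ∞) : area (fun z => ρ z + ρ' z) Ω < ∞ := by
  have hle := area_add_le (ρ' := ρ') hρ 1 Ω
  simp only [one_mul] at hle
  refine hle.trans_lt (ENNReal.add_lt_top.2 ⟨ENNReal.mul_lt_top (by simp) h, ?_⟩)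
  exact ENNReal.mul_lt_top ENNReal.coe_lt_top h'

theorem area_mono {ρ ρ' : ℂ → ℝ≥0} (hΩ : MeasurableSet Ω) (h : ∀ z ∈ Ω, ρ z ≤ ρ' z) :
    area ρ Ω ≤ area ρ' Ω :=
  setLIntegral_mono' hΩ fun z hz => by gcongr; exact h z hz

theorem IsPotential.hasFDerivAt (hΩ : IsOpen Ω) {s : ℝ} {u : ℂ → ℝ} (hu : IsPotential Ω A B s u)
    {z : ℂ} (hz : z ∈ Ω) : HasFDerivAt u (fderiv ℝ u z) z :=
  ((hu.contDiffOn.differentiableOn one_ne_zero).differentiableAt (hΩ.mem_nhds hz)).hasFDerivAt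

/-- The two exceptional metrics are added: an arc of finite length for the sum has finite length for
both. -/
theorem IsPotential.add (hΩ : IsOpen Ω) {s t : ℝ} {u v : ℂ → ℝ} (hu : IsPotential Ω A B s u)
    (hv : IsPotential Ω A B t v) : IsPotential Ω A B (s + t) (u + v) := by
  obtain ⟨ρ, hρm, hρa, hρ⟩ := hu.exists_metric
  obtain ⟨ρ', hρm', hρa', hρ'⟩ := hv.exists_metric
  refine ⟨hu.contDiffOn.add hv.contDiffOn, ?_, fun z => ρ z + ρ' z, hρm.add hρm',
    area_add_lt_top hρm hρa hρa', fun α hα hfin => ?_⟩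
  · refine (area_mono hΩ.measurableSet fun z hz => ?_).trans_lt
      (area_add_lt_top (measurable_gradNorm u) hu.area_lt_top hv.area_lt_top)
    rw [gradNorm, ((hu.hasFDerivAt hΩ hz).add (hv.hasFDerivAt hΩ hz)).fderiv]
    exact nnnorm_add_le _ _
  · rw [arcLength_add hα.2.1 hρm, ENNReal.add_lt_top] at hfin
    refine ((hρ α hα hfin.1).add (hρ' α hα hfin.2)).congr fun t => ?_
    simp only [Pi.add_apply]; ring

theorem IsPotential.const_mul (hΩ : IsOpen Ω) {s : ℝ} {u : ℂ → ℝ} (hu : IsPotential Ω A B s u)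
    (c : ℝ) : IsPotential Ω A B (c * s) (fun z => c * u z) := by
  obtain ⟨ρ, hρm, hρa, hρ⟩ := hu.exists_metric
  refine ⟨contDiffOn_const.mul hu.contDiffOn, ?_, ρ, hρm, hρa, fun α hα hfin => ?_⟩
  · refine (area_mono (ρ' := fun z => ‖c‖₊ * gradNorm u z) hΩ.measurableSet
      fun z hz => ?_).trans_lt ?_
    · rw [gradNorm, ((hu.hasFDerivAt hΩ hz).const_mul c).fderiv, nnnorm_smul]
      rfl
    · rw [area_const_mul]
      exact ENNReal.mul_lt_top (by simp) hu.area_lt_top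
  · refine ((hρ α hα hfin).const_mul c).congr fun t => ?_
    ring

/-! ### Gradients in `L²` -/

theorem nnnorm_gradient (u : ℂ → ℝ) (z : ℂ) : ‖gradient u z‖₊ = gradNorm u z := by
  rw [gradient, gradNorm, ← NNReal.coe_inj, coe_nnnorm, coe_nnnorm, LinearIsometryEquiv.norm_map]

theorem measurable_gradient (u : ℂ → ℝ) : Measurable (gradient u) :=
  (InnerProductSpace.toDual ℝ ℂ).symm.continuous.measurable.comp (measurable_fderiv ℝ u)

theorem eLpNorm_two_sq {f : ℂ → ℂ} (μ : Measure ℂ) :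
    eLpNorm f 2 μ ^ 2 = ∫⁻ z, (‖f z‖₊ : ℝ≥0∞) ^ 2 ∂μ := by
  have h := eLpNorm_nnreal_pow_eq_lintegral (f := f) (μ := μ) (p := 2) two_ne_zero
  have h1 : ∀ x : ℝ≥0∞, x ^ ((2 : ℝ≥0) : ℝ) = x ^ 2 := fun x => by
    rw [← ENNReal.rpow_natCast]; norm_num
  simp only [h1] at h
  exact h

theorem memLp_of_lintegral {f : ℂ → ℂ} {μ : Measure ℂ} (hf : AEStronglyMeasurable f μ)
    (h : ∫⁻ z, (‖f z‖₊ : ℝ≥0∞) ^ 2 ∂μ < ∞) : MemLp f 2 μ := by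
  refine ⟨hf, ?_⟩
  rw [← eLpNorm_two_sq] at h
  by_contra h'
  rw [not_lt_top_iff.1 h'] at h
  simp at h

theorem IsPotential.memLp {s : ℝ} {u : ℂ → ℝ} (hu : IsPotential Ω A B s u) :
    MemLp (gradient u) 2 (volume.restrict Ω) := by
  refine memLp_of_lintegral (measurable_gradient u).aestronglyMeasurable ?_
  simp only [nnnorm_gradient]
  exact hu.area_lt_top

theorem gradient_add_smul {u v : ℂ → ℝ} {z : ℂ} (hu : DifferentiableAt ℝ u z)
    (hv : DifferentiableAt ℝ v z) (c : ℝ) :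
    gradient (u + fun z => c * v z) z = gradient u z + c • gradient v z := by
  have h : fderiv ℝ (u + fun z => c * v z) z = fderiv ℝ u z + c • fderiv ℝ v z :=
    (hu.hasFDerivAt.add (hv.hasFDerivAt.const_mul c)).fderiv
  rw [gradient, h, map_add, map_smulₛₗ]
  rfl

theorem gradient_comp {u : ℂ → ℝ} {F : ℂ → ℂ} {z : ℂ} (hu : DifferentiableAt ℝ u (F z))
    (hF : DifferentiableAt ℝ F z) :
    gradient (u ∘ F) z = ContinuousLinearMap.adjoint (fderiv ℝ F z) (gradient u (F z)) := by
  refine ext_inner_right ℝ fun v => ?_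
  rw [ContinuousLinearMap.adjoint_inner_left, gradient, gradient,
    InnerProductSpace.toDual_symm_apply, InnerProductSpace.toDual_symm_apply,
    (hu.hasFDerivAt.comp z hF.hasFDerivAt).fderiv]
  rfl

end

end Scherk
end

noncomputable section
namespace Scherk

/-! ### Analytic dependence of the least energy on a deformation of the domain -/

section

variable {Ω A B : Set ℂ}

/-- The gradients of the potentials with increase `0`, as a subspace of `L²`. -/
def gradSubmodule (Ω A B : Set ℂ) (hΩ : IsOpen Ω) : Submodule ℝ (Lp ℂ 2 (volume.restrict Ω)) where
  carrier := {f | ∃ u, ∃ hu : IsPotential Ω A B 0 u, hu.memLp.toLp _ = f}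
  zero_mem' := by
    have h0 : IsPotential Ω A B 0 fun _ => 0 := by
      have ha : area (gradNorm fun _ => 0) Ω = 0 := by simp [area, gradNorm]
      refine ⟨contDiffOn_const, by simp [ha], 0, measurable_zero, by simp [area], fun α _ _ => ?_⟩
      simp
    refine ⟨_, h0, ?_⟩
    rw [Lp.ext_iff]
    filter_upwards [h0.memLp.coeFn_toLp, Lp.coeFn_zero ℂ 2 (volume.restrict Ω)] with z h1 h2
    rw [h1, h2]
    simp [gradient]
  add_mem' := by
    rintro _ _ ⟨u, hu, rfl⟩ ⟨v, hv, rfl⟩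
    have h : IsPotential Ω A B 0 (u + fun z => 1 * v z) := by
      simpa using hu.add hΩ (hv.const_mul hΩ 1)
    refine ⟨_, h, ?_⟩
    rw [← MemLp.toLp_add]
    refine MemLp.toLp_congr _ _ ?_
    filter_upwards [ae_restrict_mem hΩ.measurableSet] with z hz
    rw [gradient_add_smul (hu.hasFDerivAt hΩ hz).differentiableAt
      (hv.hasFDerivAt hΩ hz).differentiableAt, one_smul]
    rfl
  smul_mem' := by
    rintro c _ ⟨u, hu, rfl⟩
    have h : IsPotential Ω A B 0 ((fun _ => 0) + fun z => c * u z) := by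
      have := hu.const_mul hΩ c
      rw [mul_zero] at this
      convert this using 1
      ext z; simp
    refine ⟨_, h, ?_⟩
    rw [← MemLp.toLp_const_smul]
    refine MemLp.toLp_congr _ _ ?_
    filter_upwards [ae_restrict_mem hΩ.measurableSet] with z hz
    rw [gradient_add_smul (differentiableAt_const _) (hu.hasFDerivAt hΩ hz).differentiableAt]
    simp [gradient]

/-- Potentials with increase 1 differ by potentials with increase 0, so their gradients form a coset
of a linear subspace. This puts the minimization of energy into Hilbert space form. -/
theorem image_add_gradSubmodule (hΩ : IsOpen Ω) {v₀ : ℂ → ℝ} (h₀ : IsPotential Ω A B 1 v₀)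
    (q : Lp ℂ 2 (volume.restrict Ω) → ℝ) :
    (fun k => q (h₀.memLp.toLp _ + k)) '' (gradSubmodule Ω A B hΩ : Set _) =
      {c | ∃ v, ∃ hv : IsPotential Ω A B 1 v, q (hv.memLp.toLp _) = c} := by
  ext c
  constructor
  · rintro ⟨_, ⟨u, hu, rfl⟩, rfl⟩
    have h : IsPotential Ω A B 1 (v₀ + fun z => 1 * u z) := by
      simpa using h₀.add hΩ (hu.const_mul hΩ 1)
    refine ⟨_, h, ?_⟩
    simp only
    rw [← MemLp.toLp_add]
    congr 1
    refine MemLp.toLp_congr _ _ ?_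
    filter_upwards [ae_restrict_mem hΩ.measurableSet] with z hz
    rw [gradient_add_smul (h₀.hasFDerivAt hΩ hz).differentiableAt
      (hu.hasFDerivAt hΩ hz).differentiableAt, one_smul]
    rfl
  · rintro ⟨v, hv, rfl⟩
    have h : IsPotential Ω A B 0 (v + fun z => (-1) * v₀ z) := by
      simpa using hv.add hΩ (h₀.const_mul hΩ (-1))
    refine ⟨_, ⟨_, h, rfl⟩, ?_⟩
    simp only
    rw [← MemLp.toLp_add]
    congr 1
    refine MemLp.toLp_congr _ _ ?_
    filter_upwards [ae_restrict_mem hΩ.measurableSet] with z hz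
    rw [Pi.add_apply, gradient_add_smul (hv.hasFDerivAt hΩ hz).differentiableAt
      (h₀.hasFDerivAt hΩ hz).differentiableAt]
    simp

theorem inner_eq_toReal_lintegral {μ : Measure ℂ} {f g : Lp ℂ 2 μ} {d : ℂ → ℝ}
    (hd : ∀ z, 0 ≤ d z) (hg : g =ᵐ[μ] fun z => d z • f z) :
    ENNReal.ofReal (inner ℝ g f) = ∫⁻ z, ENNReal.ofReal (d z) * (‖f z‖₊ : ℝ≥0∞) ^ 2 ∂μ := by
  have h : (fun z => inner ℝ (g z) (f z)) =ᵐ[μ] fun z => d z * ‖f z‖ ^ 2 := by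
    filter_upwards [hg] with z hz
    rw [hz, real_inner_smul_left, real_inner_self_eq_norm_sq]
  rw [L2.inner_def, ofReal_integral_eq_lintegral_ofReal (L2.integrable_inner g f)
    (h.mono fun z hz => by rw [hz]; exact mul_nonneg (hd z) (sq_nonneg _))]
  refine lintegral_congr_ae ?_
  filter_upwards [h] with z hz
  rw [hz, ENNReal.ofReal_mul (hd z), ENNReal.ofReal_pow (norm_nonneg _), ofReal_norm,
    enorm_eq_nnnorm]

variable {ι : Type*} [Fintype ι]

/-- The deformation of the plane along a linear combination of vector fields. -/
def deform (Y : ι → ℂ → ℂ) (x : ι → ℝ) (z : ℂ) : ℂ := z + ∑ k, x k • Y k z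

/-- Bounded continuously differentiable vector fields. -/
structure IsDeformation (Y : ι → ℂ → ℂ) (C : ℝ) : Prop where
  contDiff : ∀ k, ContDiff ℝ 1 (Y k)
  norm_fderiv_le : ∀ k z, ‖fderiv ℝ (Y k) z‖ ≤ C

theorem contDiff_deform {Y : ι → ℂ → ℂ} {C : ℝ} (hY : IsDeformation Y C) (x : ι → ℝ) :
    ContDiff ℝ 1 (deform Y x) :=
  contDiff_id.add (ContDiff.sum fun k _ => (hY.contDiff k).const_smul (x k))

theorem fderiv_deform {Y : ι → ℂ → ℂ} {C : ℝ} (hY : IsDeformation Y C) (x : ι → ℝ) (z : ℂ) :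
    fderiv ℝ (deform Y x) z = 1 + ∑ k, x k • fderiv ℝ (Y k) z := by
  refine HasFDerivAt.fderiv ?_
  refine (hasFDerivAt_id z).add (HasFDerivAt.fun_sum fun k _ => ?_)
  exact (((hY.contDiff k).differentiable one_ne_zero z).hasFDerivAt).const_smul (x k)

/-- The bound `1 / 8` serves two purposes: it is below the `1 / 2` needed for invertibility, and it
is small enough to keep the Jacobian positive. -/
theorem eventually_norm_fderiv_deform {Y : ι → ℂ → ℂ} {C : ℝ} (hY : IsDeformation Y C) :
    ∀ᶠ x in nhds (0 : ι → ℝ), ∀ z, ‖fderiv ℝ (deform Y x) z - 1‖ ≤ 1 / 8 := by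
  have hlim : Filter.Tendsto (fun x : ι → ℝ => ∑ k, |x k| * C) (nhds 0) (nhds 0) := by
    have : Continuous fun x : ι → ℝ => ∑ k, |x k| * C := by fun_prop
    simpa using this.tendsto 0
  filter_upwards [hlim.eventually (gt_mem_nhds (show (0 : ℝ) < 1 / 8 by norm_num))] with x hx z
  rw [fderiv_deform hY, add_sub_cancel_left]
  refine (norm_sum_le _ _).trans (le_trans ?_ hx.le)
  refine Finset.sum_le_sum fun k _ => ?_
  rw [norm_smul]
  gcongr
  · exact le_rfl
  · exact hY.norm_fderiv_le k z

/-- The determinant is a polynomial in the four matrix entries of the derivative, and these are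
affine in `x`. The operator is the same polynomial in the commuting multiplication operators of the
entries. -/
theorem exists_detOp {Y : ι → ℂ → ℂ} {C : ℝ} (hY : IsDeformation Y C) (μ : Measure ℂ) :
    ∃ D : (ι → ℝ) → Lp ℂ 2 μ →L[ℝ] Lp ℂ 2 μ, AnalyticAt ℝ D 0 ∧ D 0 = 1 ∧
      ∀ x f, D x f =ᵐ[μ] fun z => (fderiv ℝ (deform Y x) z).det • f z := by
  have hcoef : ∀ (v : ℂ) (p : ℂ →L[ℝ] ℝ), ‖v‖ = 1 → ‖p‖ = 1 →
      ∃ M : (ι → ℝ) → Lp ℂ 2 μ →L[ℝ] Lp ℂ 2 μ, (∀ x, AnalyticAt ℝ M x) ∧ M 0 = 0 ∧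
      ∀ x f, M x f =ᵐ[μ] fun z => (∑ k, x k * p (fderiv ℝ (Y k) z v)) • f z := by
    intro v p hv hp
    obtain ⟨M, h1, h2, h3⟩ := exists_affine_mulOp μ
      (φ := fun k z => p (fderiv ℝ (Y k) z v) • (1 : ℂ →L[ℝ] ℂ)) (C := C) (fun k => by
        have hc : Continuous (fderiv ℝ (Y k)) := (hY.contDiff k).continuous_fderiv one_ne_zero
        have : Continuous fun z => p (fderiv ℝ (Y k) z v) • (1 : ℂ →L[ℝ] ℂ) := by fun_prop
        exact this.aestronglyMeasurable) (fun k z => by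
        rw [norm_smul]
        have h1 : ‖(1 : ℂ →L[ℝ] ℂ)‖ = 1 := ContinuousLinearMap.norm_id
        rw [h1, mul_one]
        have a := p.le_opNorm (fderiv ℝ (Y k) z v)
        have b := (fderiv ℝ (Y k) z).le_opNorm v
        rw [hp, one_mul] at a
        rw [hv, mul_one] at b
        exact a.trans (b.trans (hY.norm_fderiv_le k z)))
    refine ⟨M, h1, h2, fun x f => ?_⟩
    filter_upwards [h3 x f] with z hz
    rw [hz]
    simp only [_root_.sum_apply, _root_.smul_apply, one_apply_eq_self, smul_smul,
      Finset.sum_smul]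
  obtain ⟨Ma, a1, a2, a3⟩ := hcoef 1 Complex.reCLM (by simp) (by simp)
  obtain ⟨Mb, b1, b2, b3⟩ := hcoef Complex.I Complex.reCLM (by simp) (by simp)
  obtain ⟨Mc, c1, c2, c3⟩ := hcoef 1 Complex.imCLM (by simp) (by simp)
  obtain ⟨Md, d1, d2, d3⟩ := hcoef Complex.I Complex.imCLM (by simp) (by simp)
  refine ⟨fun x => (1 + Ma x) * (1 + Md x) - Mb x * Mc x, ?_, by simp [a2, b2, d2], ?_⟩
  · exact ((analyticAt_const.add (a1 0)).mul (analyticAt_const.add (d1 0))).sub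
      ((b1 0).mul (c1 0))
  · intro x f
    have e : ((1 + Ma x) * (1 + Md x) - Mb x * Mc x) f =
        (f + Md x f) + Ma x (f + Md x f) - Mb x (Mc x f) := rfl
    simp only [e]
    filter_upwards [Lp.coeFn_sub ((f + Md x f) + Ma x (f + Md x f)) (Mb x (Mc x f)),
      Lp.coeFn_add (f + Md x f) (Ma x (f + Md x f)), Lp.coeFn_add f (Md x f),
      a3 x (f + Md x f), b3 x (Mc x f), c3 x f, d3 x f] with z h1 h2 h3 h4 h5 h6 h7
    rw [h1, Pi.sub_apply, h2, Pi.add_apply, h4, h5, h3, Pi.add_apply, h6, h7, det_eq,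
      fderiv_deform hY]
    simp only [_root_.add_apply, one_apply_eq_self, _root_.sum_apply, _root_.smul_apply,
      Complex.add_re, Complex.add_im, Complex.one_re, Complex.one_im, Complex.I_re, Complex.I_im,
      Complex.re_sum, Complex.im_sum, Complex.smul_re, Complex.smul_im, smul_eq_mul,
      Complex.reCLM_apply, Complex.imCLM_apply]
    module

theorem exists_adjointOp {Y : ι → ℂ → ℂ} {C : ℝ} (hY : IsDeformation Y C) (μ : Measure ℂ) :
    ∃ J : (ι → ℝ) → Lp ℂ 2 μ →L[ℝ] Lp ℂ 2 μ, AnalyticAt ℝ J 0 ∧ J 0 = 1 ∧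
      ∀ x f, J x f =ᵐ[μ] fun z => ContinuousLinearMap.adjoint (fderiv ℝ (deform Y x) z) (f z) := by
  obtain ⟨M, h1, h2, h3⟩ := exists_affine_mulOp μ
    (φ := fun k z => ContinuousLinearMap.adjoint (fderiv ℝ (Y k) z)) (C := C) (fun k => by
      have hc : Continuous (fderiv ℝ (Y k)) := (hY.contDiff k).continuous_fderiv one_ne_zero
      exact (ContinuousLinearMap.adjoint.continuous.comp hc).aestronglyMeasurable) (fun k z => by
      rw [LinearIsometryEquiv.norm_map]; exact hY.norm_fderiv_le k z)
  refine ⟨fun x => 1 + M x, analyticAt_const.add (h1 0), by simp [h2], fun x f => ?_⟩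
  have e : (1 + M x) f = f + M x f := rfl
  simp only [e]
  filter_upwards [Lp.coeFn_add f (M x f), h3 x f] with z hz hz'
  rw [hz, Pi.add_apply, hz', fderiv_deform hY]
  refine ext_inner_right ℝ fun v => ?_
  rw [ContinuousLinearMap.adjoint_inner_left]
  simp only [_root_.add_apply, one_apply_eq_self, _root_.sum_apply, _root_.smul_apply,
    inner_add_left, inner_add_right, sum_inner, inner_sum, inner_smul_left, inner_smul_right,
    ContinuousLinearMap.adjoint_inner_left, conj_trivial]

/-- The least energy of the images of a configuration under the deformations along finitely many
vector fields is an analytic function of the coefficients. -/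
theorem exists_analyticAt_minEnergy (hΩ : IsOpen Ω) {Y : ι → ℂ → ℂ} {C : ℝ}
    (hY : IsDeformation Y C) {v₀ : ℂ → ℝ} (h₀ : IsPotential Ω A B 1 v₀) :
    ∃ Λ : (ι → ℝ) → ℝ, AnalyticAt ℝ Λ 0 ∧ ∀ᶠ x in nhds 0,
      minEnergy (deform Y x '' Ω) (deform Y x '' A) (deform Y x '' B) = ENNReal.ofReal (Λ x) := by
  obtain ⟨D, hD, hD0, hDf⟩ := exists_detOp hY (volume.restrict Ω)
  obtain ⟨J, hJ, hJ0, hJf⟩ := exists_adjointOp hY (volume.restrict Ω)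
  have hinv : AnalyticAt ℝ (fun x => Ring.inverse (J x)) 0 := by
    have h1 : AnalyticAt ℝ (Ring.inverse : (Lp ℂ 2 (volume.restrict Ω) →L[ℝ] _) → _) (J 0) := by
      rw [hJ0]; exact analyticAt_inverse (𝕜 := ℝ) (1 : (Lp ℂ 2 (volume.restrict Ω) →L[ℝ] _)ˣ)
    exact h1.comp hJ
  have hstar : AnalyticAt ℝ (fun x => star (Ring.inverse (J x))) 0 :=
    ((starL' ℝ : (Lp ℂ 2 (volume.restrict Ω) →L[ℝ] Lp ℂ 2 (volume.restrict Ω)) ≃L[ℝ]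
      _).toContinuousLinearMap.analyticAt _).comp hinv
  -- For `v = u ∘ F` the chain rule gives `∇v = J (∇u ∘ F)`, and the change of variables inserts the
  -- Jacobian `D`. The energy of `u` is therefore the quadratic form of `J⁻¹* D J⁻¹` at `∇v`.
  obtain ⟨Λ, hΛ, hglb⟩ := exists_analyticAt_isGLB
    (Q := fun x => star (Ring.inverse (J x)) * D x * Ring.inverse (J x))
    ((hstar.mul hD).mul hinv) (by simp [hJ0, hD0]) (gradSubmodule Ω A B hΩ) (h₀.memLp.toLp _)
  have hunit : ∀ᶠ x in nhds 0, IsUnit (J x) :=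
    hJ.continuousAt.eventually (by rw [hJ0]; exact Units.isOpen.mem_nhds isUnit_one)
  refine ⟨Λ, hΛ, ?_⟩
  filter_upwards [hglb, hunit, eventually_norm_fderiv_deform hY] with x hx hu hsmall
  set F := deform Y x with hF
  obtain ⟨G, hG⟩ := exists_isDiffeoPair (contDiff_deform hY x) fun z =>
    (hsmall z).trans (by norm_num)
  rw [image_add_gradSubmodule hΩ h₀ fun f => inner ℝ ((star (Ring.inverse (J x)) * D x *
    Ring.inverse (J x)) f) f] at hx
  have hdet : ∀ z, 0 ≤ (fderiv ℝ F z).det := fun z => by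
    have h1 := abs_det_one_add_sub_one_le (fderiv ℝ F z - 1)
    rw [add_sub_cancel] at h1
    have h2 := hsmall z
    have := (abs_le.1 h1).1
    nlinarith [norm_nonneg (fderiv ℝ F z - 1)]
  -- The energy on the deformed domain equals the quadratic form on the fixed one. Together with the
  -- correspondence of potentials, this identifies the two infima.
  have key : ∀ u, IsPotential (F '' Ω) (F '' A) (F '' B) 1 u → ∀ v (hv : IsPotential Ω A B 1 v),
      v = u ∘ F → area (gradNorm u) (F '' Ω) =
        ENNReal.ofReal (inner ℝ ((star (Ring.inverse (J x)) * D x * Ring.inverse (J x))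
          (hv.memLp.toLp _)) (hv.memLp.toLp _)) := by
    rintro u hu' v hv rfl
    have hw : MemLp (fun z => gradient u (F z)) 2 (volume.restrict Ω) := by
      refine memLp_of_lintegral ((measurable_gradient u).comp
        hG.contDiff.continuous.measurable).aestronglyMeasurable ?_
      simp only [nnnorm_gradient]
      exact (hG.area_comp_le hΩ.measurableSet _).trans_lt
        (ENNReal.mul_lt_top ENNReal.coe_lt_top hu'.area_lt_top)
    have hJw : J x (hw.toLp _) = hv.memLp.toLp _ := by
      rw [Lp.ext_iff]
      filter_upwards [hJf x (hw.toLp _), hw.coeFn_toLp, hv.memLp.coeFn_toLp,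
        ae_restrict_mem hΩ.measurableSet] with z h1 h2 h3 hz
      rw [h1, h2, h3, gradient_comp (hu'.hasFDerivAt (hG.isOpen_image hΩ)
        (mem_image_of_mem F hz)).differentiableAt (hG.hasFDerivAt z).differentiableAt]
    have hw' : Ring.inverse (J x) (hv.memLp.toLp _) = hw.toLp _ := by
      rw [← hJw, ← mul_apply_eq_comp, Ring.inverse_mul_cancel _ hu, one_apply_eq_self]
    rw [mul_apply_eq_comp, mul_apply_eq_comp, ContinuousLinearMap.star_eq_adjoint,
      ContinuousLinearMap.adjoint_inner_left, hw', inner_eq_toReal_lintegral hdet (hDf x _),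
      area, hG.lintegral_image hΩ.measurableSet]
    refine lintegral_congr_ae ?_
    filter_upwards [hw.coeFn_toLp] with z hz
    rw [hz, nnnorm_gradient, abs_of_nonneg (hdet z)]
  refine le_antisymm ?_ ?_
  · refine le_of_forall_gt fun c hc => ?_
    rcases eq_or_ne c ∞ with rfl | hctop
    · have hv := h₀
      refine (iInf₂_le _ (hG.isPotential_comp_inv hΩ hv)).trans_lt
        (hG.isPotential_comp_inv hΩ hv).area_lt_top
    · have hc' : Λ x < c.toReal := by
        by_contra h
        rw [← ENNReal.ofReal_toReal hctop] at hc
        exact absurd hc (not_lt.2 (ENNReal.ofReal_le_ofReal (not_lt.1 h)))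
      obtain ⟨_, ⟨v, hv, rfl⟩, hlt⟩ := (isGLB_lt_iff hx).1 hc'
      refine (iInf₂_le _ (hG.isPotential_comp_inv hΩ hv)).trans_lt ?_
      rw [key _ (hG.isPotential_comp_inv hΩ hv) v hv
        (by rw [Function.comp_assoc, hG.left_inv.comp_eq_id, Function.comp_id])]
      rw [← ENNReal.ofReal_toReal hctop]
      refine (ENNReal.ofReal_lt_ofReal_iff ?_).2 hlt
      rw [ENNReal.toReal_pos_iff]
      exact ⟨pos_of_gt hc, lt_top_iff_ne_top.2 hctop⟩
  · refine le_iInf₂ fun u hu' => ?_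
    rw [key u hu' _ (hG.isPotential_comp hΩ hu') rfl]
    exact ENNReal.ofReal_le_ofReal (hx.1 ⟨u ∘ F, hG.isPotential_comp hΩ hu', rfl⟩)

end

end Scherk
end



noncomputable section

namespace Scherk

/-! ### Reflection in the line `y = -x` -/

/-- The reflection `(x, y) ↦ (-y, -x)`. -/
def reflect : ℂ ≃ₗᵢ[ℝ] ℂ :=
  Complex.conjLIE.trans (rotation ⟨-Complex.I, by simp [Submonoid.unitSphere]⟩)

theorem reflect_apply (z : ℂ) : reflect z = ⟨-z.im, -z.re⟩ := by
  change -Complex.I * (starRingEnd ℂ) z = _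
  apply Complex.ext <;> simp

@[simp] theorem reflect_re (z : ℂ) : (reflect z).re = -z.im := by rw [reflect_apply]

@[simp] theorem reflect_im (z : ℂ) : (reflect z).im = -z.re := by rw [reflect_apply]

@[simp] theorem reflect_reflect (z : ℂ) : reflect (reflect z) = z := by
  apply Complex.ext <;> simp

theorem contDiff_reflect : ContDiff ℝ 1 reflect := reflect.contDiff

theorem pathLength_reflect (ρ : ℂ → ℝ≥0) (α : ℝ → ℂ) (s : Set ℝ) :
    pathLength ρ (reflect ∘ α) s = pathLength (ρ ∘ reflect) α s := by
  refine lintegral_congr fun t => ?_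
  have h : deriv (reflect ∘ α) t = reflect (deriv α t) := by
    rw [← fderiv_apply_one_eq_deriv, ← fderiv_apply_one_eq_deriv, reflect.comp_fderiv]
    rfl
  rw [h, Function.comp_apply, Function.comp_apply, reflect.enorm_map]

theorem lintegral_reflect (f : ℂ → ℝ≥0∞) {Ω : Set ℂ} (hΩ : MapsTo reflect Ω Ω) :
    ∫⁻ z in Ω, f (reflect z) = ∫⁻ z in Ω, f z := by
  have h : reflect ⁻¹' Ω = Ω :=
    Subset.antisymm (fun z hz => by simpa using hΩ hz) hΩ
  have hm := (reflect.measurePreserving).setLIntegral_comp_preimage_emb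
    reflect.toHomeomorph.measurableEmbedding f Ω
  rwa [h] at hm

theorem area_comp_reflect (ρ : ℂ → ℝ≥0) {Ω : Set ℂ} (hΩ : MapsTo reflect Ω Ω) :
    area (ρ ∘ reflect) Ω = area ρ Ω :=
  lintegral_reflect (fun z => (ρ z : ℝ≥0∞) ^ 2) hΩ

theorem reflect_comp_mem {Ω A B : Set ℂ} (hΩ : MapsTo reflect Ω Ω) {α : ℝ → ℂ}
    (hα : α ∈ arcsJoining Ω A B) : reflect ∘ α ∈ arcsJoining Ω (reflect '' A) (reflect '' B) :=
  comp_mem_arcsJoining contDiff_reflect hΩ (mapsTo_image _ _) (mapsTo_image _ _) hα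

theorem reflect_image_image (A : Set ℂ) : reflect '' (reflect '' A) = A := by
  simp [image_image]

theorem reverse_mem {Ω A B : Set ℂ} {α : ℝ → ℂ} (hα : α ∈ arcsJoining Ω A B) :
    α ∘ (fun t => 1 - t) ∈ arcsJoining Ω B A := by
  have h : MapsTo (fun t : ℝ => 1 - t) (Ioo 0 1) (Ioo 0 1) := fun t ht =>
    ⟨by linarith [ht.2], by linarith [ht.1]⟩
  refine ⟨hα.1.comp (by fun_prop) fun t ht => ⟨by linarith [ht.2], by linarith [ht.1]⟩,
    hα.2.1.comp (by fun_prop) h, hα.2.2.1.comp h, ?_, ?_⟩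
  · simpa using hα.2.2.2.2
  · simpa using hα.2.2.2.1

theorem arcLength_reverse (ρ : ℂ → ℝ≥0) {α : ℝ → ℂ} (hα : ContDiffOn ℝ 1 α (Ioo 0 1)) :
    arcLength ρ (α ∘ fun t => 1 - t) = arcLength ρ α := by
  have himg : (fun t : ℝ => 1 - t) '' Ioo 0 1 = Ioo 0 1 := by simp
  have h : ∀ t ∈ Ioo (0 : ℝ) 1, 1 - t ∈ Ioo (0 : ℝ) 1 := fun t ht =>
    ⟨by linarith [ht.2], by linarith [ht.1]⟩
  rw [arcLength_eq_pathLength, pathLength_comp_antitoneOn ρ measurableSet_Ioo (by fun_prop)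
    (fun s _ t _ hst => sub_le_sub_left hst 1) (fun t _ => by simp)
    (fun t ht => (hα.differentiableOn one_ne_zero).differentiableAt (isOpen_Ioo.mem_nhds (h t ht))),
    himg, arcLength_eq_pathLength]

/-- An arc that crosses the axis of symmetry can be replaced by one of at most the same length
that joins `A` to `B`, if the metric is symmetric. -/
theorem le_arcLength_of_crossing {Ω A B : Set ℂ} (hΩ : MapsTo reflect Ω Ω)
    (hA : ∀ z ∈ A, z.re + z.im < 0) (hB : ∀ z ∈ B, z.re + z.im < 0) {ρ : ℂ → ℝ≥0}
    (hρ : ρ ∘ reflect = ρ) {m : ℝ≥0∞} (h1 : ∀ α ∈ arcsJoining Ω A B, m ≤ arcLength ρ α)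
    {γ : ℝ → ℂ} (hγ : γ ∈ arcsJoining Ω A (reflect '' B)) : m ≤ arcLength ρ γ := by
  obtain ⟨hc, hd, hm, h0, h1'⟩ := hγ
  have hB' : 0 < (γ 1).re + (γ 1).im := by
    obtain ⟨w, hw, hw'⟩ := h1'
    rw [← hw']
    have := hB w hw
    simp only [reflect_re, reflect_im]
    linarith
  have hcs : ContinuousOn (fun t => (γ t).re + (γ t).im) (Icc 0 1) := by fun_prop
  obtain ⟨t, ht, hts⟩ := intermediate_value_Ioo zero_le_one hcs ⟨hA _ h0, hB'⟩
  -- The arc meets the axis of symmetry at time `t`, so its remainder can be replaced by the mirror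
  -- image without a break.
  have hfix : reflect (γ t) = γ t := by
    simp only at hts
    apply Complex.ext <;> simp <;> linarith
  have hrefl := comp_mem_arcsJoining contDiff_reflect hΩ (mapsTo_univ _ univ)
    (show MapsTo reflect (reflect '' B) B by
      rintro _ ⟨w, hw, rfl⟩; simpa using hw) (⟨hc, hd, hm, trivial, h1'⟩ : γ ∈ arcsJoining Ω univ _)
  have e1 := arcDist_le_pathLength (ρ := ρ) hc hd hm h0 ht
  have e2 := le_arcDist_add_Ico h1 hrefl.1 hrefl.2.1 hrefl.2.2.1 hrefl.2.2.2.2 ht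
  rw [Function.comp_apply, hfix, pathLength_reflect, hρ] at e2
  refine e2.trans ((add_le_add e1 le_rfl).trans_eq ?_)
  have hu : Ioo (0 : ℝ) 1 = Ioc 0 t ∪ Ioo t 1 := (Ioc_union_Ioo_eq_Ioo ht.1.le ht.2).symm
  rw [pathLength_congr_ae ρ γ (Ioo_ae_eq_Ico (a := t) (b := 1)).symm, arcLength_eq_pathLength, hu,
    pathLength, pathLength, pathLength, lintegral_union measurableSet_Ioo]
  rw [disjoint_left]
  exact fun s hs hs' => absurd hs.2 (not_le.2 hs'.1)

section

variable {Ω A B : Set ℂ}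

/-- The pairs that consist of an arc from `A` to `B` and an arc from the mirror image of `B` to
that of `A`. -/
def mirrorPairs (Ω A B : Set ℂ) : Set (List (ℝ → ℂ)) :=
  {L | ∃ α ∈ arcsJoining Ω A B, ∃ β ∈ arcsJoining Ω (reflect '' B) (reflect '' A), L = [α, β]}

/-- The arc is paired with its mirror image, run backwards. The total length of this pair is twice
the length of the arc in the symmetrized metric. -/
theorem iInf_mirrorPairs_le {ρ : ℂ → ℝ≥0} (hρ : Measurable ρ) (hΩ : MapsTo reflect Ω Ω)
    {α : ℝ → ℂ} (hα : α ∈ arcsJoining Ω A B) :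
    ⨅ L ∈ mirrorPairs Ω A B, systemLength ρ L ≤
      2 * arcLength (fun z => 2⁻¹ * (ρ z + ρ (reflect z))) α := by
  have h := reflect_comp_mem hΩ hα
  refine (iInf₂_le [α, (reflect ∘ α) ∘ fun t => 1 - t] ⟨α, hα, _, reverse_mem h, rfl⟩).trans_eq ?_
  rw [arcLength_const_mul, ← mul_assoc, arcLength_add hα.2.1 hρ]
  have h2 : (2 : ℝ≥0∞) * ((2⁻¹ : ℝ≥0) : ℝ≥0∞) = 1 := by
    rw [ENNReal.coe_inv two_ne_zero]
    exact ENNReal.mul_inv_cancel two_ne_zero ENNReal.ofNat_ne_top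
  rw [h2, one_mul]
  simp only [systemLength, List.map_cons, List.map_nil, List.sum_cons, List.sum_nil, add_zero]
  rw [arcLength_reverse ρ h.2.1, arcLength_eq_pathLength ρ (reflect ∘ α), pathLength_reflect]
  rfl

/-- There are four cases for the ends. Arcs with both ends on the far side are reflected; arcs that
change sides are treated by reflecting their part beyond the axis. -/
theorem iInf_mirrorPairs_le_of_symmetric {ρ : ℂ → ℝ≥0} (hρ : Measurable ρ)
    (hΩ : MapsTo reflect Ω Ω) (hA : ∀ z ∈ A, z.re + z.im < 0) (hB : ∀ z ∈ B, z.re + z.im < 0)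
    {γ : ℝ → ℂ} (hγ : γ ∈ arcsJoining Ω (A ∪ reflect '' A) (B ∪ reflect '' B)) :
    2⁻¹ * ⨅ L ∈ mirrorPairs Ω A B, systemLength ρ L ≤
      arcLength (fun z => 2⁻¹ * (ρ z + ρ (reflect z))) γ := by
  set ρ' : ℂ → ℝ≥0 := fun z => 2⁻¹ * (ρ z + ρ (reflect z))
  have hρ' : ρ' ∘ reflect = ρ' := by
    ext z
    simp [ρ', add_comm]
  have key : ∀ α ∈ arcsJoining Ω A B,
      2⁻¹ * ⨅ L ∈ mirrorPairs Ω A B, systemLength ρ L ≤ arcLength ρ' α := fun α hα => by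
    rw [mul_comm, ← div_eq_mul_inv]
    exact ENNReal.div_le_of_le_mul' (iInf_mirrorPairs_le hρ hΩ hα)
  have hrefl : ∀ α, arcLength ρ' (reflect ∘ α) = arcLength ρ' α := fun α => by
    rw [arcLength_eq_pathLength, pathLength_reflect, hρ', arcLength_eq_pathLength]
  obtain ⟨hc, hd, hm, h0 | h0, h1 | h1⟩ := hγ
  · exact key γ ⟨hc, hd, hm, h0, h1⟩
  · exact le_arcLength_of_crossing hΩ hA hB hρ' key ⟨hc, hd, hm, h0, h1⟩
  · have h := reflect_comp_mem hΩ (⟨hc, hd, hm, h0, h1⟩ : γ ∈ arcsJoining Ω (reflect '' A) B)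
    rw [reflect_image_image] at h
    rw [← hrefl]
    exact le_arcLength_of_crossing hΩ hA hB hρ' key h
  · have h := reflect_comp_mem hΩ
      (⟨hc, hd, hm, h0, h1⟩ : γ ∈ arcsJoining Ω (reflect '' A) (reflect '' B))
    rw [reflect_image_image, reflect_image_image] at h
    rw [← hrefl]
    exact key _ h

/-- After reversal of the second arc, both members of a pair join the symmetric unions of boundary
sets. -/
theorem two_mul_iInf_le_iInf_mirrorPairs (ρ : ℂ → ℝ≥0) :
    2 * ⨅ γ ∈ arcsJoining Ω (A ∪ reflect '' A) (B ∪ reflect '' B), arcLength ρ γ ≤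
      ⨅ L ∈ mirrorPairs Ω A B, systemLength ρ L := by
  refine le_iInf₂ fun L hL => ?_
  obtain ⟨α, hα, β, hβ, rfl⟩ := hL
  simp only [systemLength, List.map_cons, List.map_nil, List.sum_cons, List.sum_nil, add_zero]
  rw [two_mul]
  refine add_le_add (iInf₂_le α ⟨hα.1, hα.2.1, hα.2.2.1, Or.inl hα.2.2.2.1, Or.inl hα.2.2.2.2⟩) ?_
  rw [← arcLength_reverse ρ hβ.2.1]
  have h := reverse_mem hβ
  exact iInf₂_le _ ⟨h.1, h.2.1, h.2.2.1, Or.inr h.2.2.2.1, Or.inr h.2.2.2.2⟩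

/-- Convexity of the square, together with the invariance of area under reflection. -/
theorem area_symmetrize_le {ρ : ℂ → ℝ≥0} (hρ : Measurable ρ) (hΩ : MapsTo reflect Ω Ω) :
    area (fun z => 2⁻¹ * (ρ z + ρ (reflect z))) Ω ≤ area ρ Ω := by
  have h := area_add_le (ρ := ρ) (ρ' := ρ ∘ reflect) hρ 1 Ω
  rw [area_comp_reflect ρ hΩ] at h
  simp only [one_mul, Function.comp_apply] at h
  rw [area_const_mul, ENNReal.coe_inv two_ne_zero]
  calc ((2 : ℝ≥0) : ℝ≥0∞)⁻¹ ^ 2 * area (fun z => ρ z + ρ (reflect z)) Ω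
      ≤ ((2 : ℝ≥0) : ℝ≥0∞)⁻¹ ^ 2 * (2 ^ 2 * area ρ Ω) := by
        gcongr
        refine h.trans_eq ?_
        rw [← add_mul]
        norm_num
    _ = area ρ Ω := by
        rw [← mul_assoc, ← mul_pow, ENNReal.coe_ofNat,
          ENNReal.inv_mul_cancel two_ne_zero ENNReal.ofNat_ne_top, one_pow, one_mul]

/-- Symmetrizing a metric does not increase its area. For symmetric metrics the length of the pairs
is twice that of the single arcs, and the factor is 4 because length enters squared. -/
theorem extremalLength_mirrorPairs (hΩm : MeasurableSet Ω) (hΩ : MapsTo reflect Ω Ω)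
    (hA : ∀ z ∈ A, z.re + z.im < 0) (hB : ∀ z ∈ B, z.re + z.im < 0) :
    extremalLength Ω (mirrorPairs Ω A B) =
      4 * extremalLength Ω
        (singletons (arcsJoining Ω (A ∪ reflect '' A) (B ∪ reflect '' B))) := by
  refine le_antisymm (iSup₂_le fun ρ hρ => ?_) ?_
  · obtain ⟨hm, h0, ht⟩ := hρ
    set ρ' : ℂ → ℝ≥0 := fun z => 2⁻¹ * (ρ z + ρ (reflect z))
    have hm' : Measurable ρ' :=
      (hm.add (hm.comp contDiff_reflect.continuous.measurable)).const_mul _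
    have ha := area_symmetrize_le hm hΩ
    have h0' : 0 < area ρ' Ω := by
      refine lt_of_lt_of_le ?_ (area_mono (ρ := fun z => 2⁻¹ * ρ z) hΩm fun z _ => ?_)
      · rw [area_const_mul]
        exact ENNReal.mul_pos (by simp) h0.ne'
      · simp only [ρ']
        gcongr
        exact le_self_add
    set ℓ := ⨅ L ∈ mirrorPairs Ω A B, systemLength ρ L
    have h1 : (2⁻¹ * ℓ) ^ 2 / area ρ' Ω ≤ extremalLength Ω
        (singletons (arcsJoining Ω (A ∪ reflect '' A) (B ∪ reflect '' B))) := by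
      refine le_trans ?_ (le_iSup₂_of_le ρ' ⟨hm', h0', ha.trans_lt ht⟩ le_rfl)
      rw [iInf_singletons]
      gcongr
      exact le_iInf₂ fun γ hγ => iInf_mirrorPairs_le_of_symmetric hm hΩ hA hB hγ
    calc ℓ ^ 2 / area ρ Ω = 4 * ((2⁻¹ * ℓ) ^ 2 / area ρ Ω) := by
          have h4 : (4 : ℝ≥0∞) * 2⁻¹ ^ 2 = 1 := by
            rw [← ENNReal.inv_pow, show (2 : ℝ≥0∞) ^ 2 = 4 by norm_num]
            exact ENNReal.mul_inv_cancel (by norm_num) (by norm_num)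
          rw [mul_pow, mul_div_assoc, ← mul_assoc, h4, one_mul]
      _ ≤ 4 * ((2⁻¹ * ℓ) ^ 2 / area ρ' Ω) := by gcongr
      _ ≤ _ := by gcongr
  · rw [extremalLength, ENNReal.mul_iSup]
    refine iSup_le fun ρ => ?_
    rw [ENNReal.mul_iSup]
    refine iSup_le fun hρ => le_trans ?_ (le_iSup₂_of_le ρ hρ le_rfl)
    rw [iInf_singletons, ← mul_div_assoc]
    gcongr
    refine le_trans (le_of_eq ?_) (pow_le_pow_left' (two_mul_iInf_le_iInf_mirrorPairs ρ) 2)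
    rw [mul_pow]
    norm_num

end

end Scherk
end



noncomputable section

namespace Scherk

/-! ### Upper bounds for extremal lengths from sweeps by polygonal arcs -/

theorem sq_lintegral_le_mul {X : Type*} [MeasurableSpace X] {ν : Measure X}
    {f : X → ℝ≥0∞} (hf : AEMeasurable f ν) :
    (∫⁻ x, f x ∂ν) ^ 2 ≤ (∫⁻ x, f x ^ 2 ∂ν) * ν univ := by
  have h := ENNReal.lintegral_mul_le_Lp_mul_Lq ν Real.HolderConjugate.two_two hf
    (aemeasurable_const (b := (1 : ℝ≥0∞)))
  simp only [Pi.mul_apply, mul_one, ENNReal.one_rpow, lintegral_const, one_mul] at h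
  refine (pow_le_pow_left' h 2).trans_eq ?_
  rw [mul_pow, ← ENNReal.rpow_natCast, ← ENNReal.rpow_mul, ← ENNReal.rpow_natCast,
    ← ENNReal.rpow_mul]
  norm_num

/-- The horizontal line at height `q`, or the vertical line at abscissa `q`. -/
def axisLine (horizontal : Bool) (q t : ℝ) : ℂ := if horizontal then ⟨t, q⟩ else ⟨q, t⟩

@[simp] theorem axisLine_true (q t : ℝ) : axisLine true q t = ⟨t, q⟩ := rfl

@[simp] theorem axisLine_false (q t : ℝ) : axisLine false q t = ⟨q, t⟩ := rfl

theorem hasDerivAt_axisLine (o : Bool) (q t : ℝ) :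
    HasDerivAt (axisLine o q) (if o then 1 else Complex.I) t := by
  have h := (Complex.ofRealCLM.hasDerivAt (x := t))
  cases o
  · have h1 := (h.mul_const Complex.I).const_add (q : ℂ)
    simp only [Complex.ofRealCLM_apply, Complex.ofReal_one, one_mul] at h1
    have h2 : axisLine false q = fun s : ℝ => (q : ℂ) + s * Complex.I := by
      funext s
      exact Complex.ext (by simp) (by simp)
    rw [h2]
    exact h1
  · have h1 := h.add_const (q * Complex.I)
    simp only [Complex.ofRealCLM_apply, Complex.ofReal_one] at h1
    have h2 : axisLine true q = fun s : ℝ => (s : ℂ) + q * Complex.I := by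
      funext s
      exact Complex.ext (by simp) (by simp)
    rw [h2]
    exact h1

theorem contDiff_axisLine (o : Bool) (q : ℝ) : ContDiff ℝ 1 (axisLine o q) := by
  rw [contDiff_one_iff_deriv]
  refine ⟨fun t => (hasDerivAt_axisLine o q t).differentiableAt, ?_⟩
  rw [funext fun t => (hasDerivAt_axisLine o q t).deriv]
  exact continuous_const

/-- The length of the part of a line with parameters in `[-R,R]`. -/
def lineLength (ρ : ℂ → ℝ≥0) (R : ℝ) (o : Bool) (q : ℝ) : ℝ≥0∞ :=
  ∫⁻ t in Icc (-R) R, (ρ (axisLine o q t) : ℝ≥0∞)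

theorem pathLength_axisLine_le (ρ : ℂ → ℝ≥0) {R : ℝ} (o : Bool) (q : ℝ) {s : Set ℝ}
    (hs : s ⊆ Icc (-R) R) : pathLength ρ (axisLine o q) s ≤ lineLength ρ R o q := by
  refine (pathLength_mono _ _ hs).trans_eq (lintegral_congr fun t => ?_)
  rw [(hasDerivAt_axisLine o q t).deriv, ← ofReal_norm]
  cases o <;> simp

section

variable {ρ : ℂ → ℝ≥0} {Ω A B : Set ℂ} {R c d : ℝ} (o : Bool) {q : ℝ}

theorem uIcc_subset_Icc_neg (hc : |c| ≤ R) (hd : |d| ≤ R) : uIcc c d ⊆ Icc (-R) R :=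
  uIcc_subset_Icc (abs_le.1 hc) (abs_le.1 hd)

theorem arcDist_start (hc : |c| ≤ R) (hd : |d| ≤ R) (hcd : c ≠ d)
    (hΩ : ∀ t ∈ uIcc c d, t ≠ c → axisLine o q t ∈ Ω) (hA : axisLine o q c ∈ A) :
    arcDist ρ Ω A (axisLine o q d) ≤ lineLength ρ R o q :=
  (arcDist_le_pathLength_uIcc isOpen_univ hcd (subset_univ _)
    (contDiff_axisLine o q).continuous.continuousOn (contDiff_axisLine o q).contDiffOn
    (fun t ht => hΩ t ht.1 ht.2) hA).trans
    (pathLength_axisLine_le ρ o q (sdiff_subset.trans (uIcc_subset_Icc_neg hc hd)))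

theorem arcDist_step (hc : |c| ≤ R) (hd : |d| ≤ R)
    (hΩ : ∀ t ∈ uIcc c d, axisLine o q t ∈ Ω) :
    arcDist ρ Ω A (axisLine o q d) ≤ arcDist ρ Ω A (axisLine o q c) + lineLength ρ R o q :=
  (arcDist_le_add isOpen_univ (subset_univ _) (contDiff_axisLine o q).contDiffOn hΩ).trans
    (add_le_add le_rfl (pathLength_axisLine_le ρ o q (uIcc_subset_Icc_neg hc hd)))

theorem arcDist_finish (hc : |c| ≤ R) (hd : |d| ≤ R) (hcd : c ≠ d)
    (hΩ : ∀ t ∈ uIcc c d, t ≠ d → axisLine o q t ∈ Ω) (hB : axisLine o q d ∈ B) :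
    ⨅ α ∈ arcsJoining Ω A B, arcLength ρ α ≤
      arcDist ρ Ω A (axisLine o q c) + lineLength ρ R o q :=
  (le_arcDist_add (fun α hα => iInf₂_le α hα) isOpen_univ hcd (subset_univ _)
    (contDiff_axisLine o q).continuous.continuousOn (contDiff_axisLine o q).contDiffOn
    (fun t ht => hΩ t ht.1 ht.2) hB).trans
    (add_le_add le_rfl
      (pathLength_axisLine_le ρ o q (sdiff_subset.trans (uIcc_subset_Icc_neg hc hd))))

end

theorem measurePreserving_axisLine (o : Bool) {τ : ℝ → ℝ}
    (hτ : MeasurePreserving τ volume volume) :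
    MeasurePreserving (fun q : ℝ × ℝ => axisLine o (τ q.1) q.2) (volume.prod volume) volume := by
  have h := hτ.prod (MeasurePreserving.id (volume : Measure ℝ))
  have hsymm := Complex.volume_preserving_equiv_real_prod.symm
  cases o
  · exact hsymm.comp h
  · exact hsymm.comp (Measure.measurePreserving_swap.comp h)

/-- Cauchy–Schwarz on the rectangle of sides `δ` and `2 * R` that is swept out by the lines. -/
theorem sq_lintegral_lineLength_le {ρ : ℂ → ℝ≥0} (hρ : Measurable ρ) (o : Bool) {τ : ℝ → ℝ}
    (hτ : MeasurePreserving τ volume volume) (R δ : ℝ) :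
    (∫⁻ s in Ioo 0 δ, lineLength ρ R o (τ s)) ^ 2 ≤
      area ρ univ * (ENNReal.ofReal δ * ENNReal.ofReal (2 * R)) := by
  have hΨ := measurePreserving_axisLine o hτ
  have hm : Measurable fun q : ℝ × ℝ => (ρ (axisLine o (τ q.1) q.2) : ℝ≥0∞) :=
    (hρ.comp hΨ.measurable).coe_nnreal_ennreal
  have h1 : ∫⁻ s in Ioo 0 δ, lineLength ρ R o (τ s) =
      ∫⁻ q, (ρ (axisLine o (τ q.1) q.2) : ℝ≥0∞)
        ∂((volume.restrict (Ioo 0 δ)).prod (volume.restrict (Icc (-R) R))) :=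
    (lintegral_prod _ hm.aemeasurable).symm
  rw [h1]
  refine (sq_lintegral_le_mul hm.aemeasurable).trans ?_
  rw [Measure.prod_restrict]
  gcongr
  · refine (setLIntegral_le_lintegral _ _).trans_eq ?_
    rw [area, Measure.restrict_univ, ← hΨ.lintegral_comp ((hρ.coe_nnreal_ennreal).pow_const 2)]
  · rw [Measure.restrict_apply_univ, Measure.prod_prod, Real.volume_Ioo, Real.volume_Icc]
    ring_nf
    rfl

theorem measurable_lineLength {ρ : ℂ → ℝ≥0} (hρ : Measurable ρ) (o : Bool) {τ : ℝ → ℝ}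
    (hτ : MeasurePreserving τ volume volume) (R : ℝ) :
    Measurable fun s => lineLength ρ R o (τ s) :=
  ((hρ.comp (measurePreserving_axisLine o hτ).measurable).coe_nnreal_ennreal).lintegral_prod_right'

/-- For each `s` the arc length is bounded by that of a polygonal path with legs on the given lines.
Integrating over `s` and applying Cauchy–Schwarz to each leg bounds the squared length by a constant
times the area, whatever the metric. -/
theorem extremalLength_lt_top_of_sweep {Ω A B : Set ℂ} (hΩ : MeasurableSet Ω) {ι : Type*}
    [Fintype ι] {R δ : ℝ} (hδ : 0 < δ) {o : ι → Bool} {τ : ι → ℝ → ℝ}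
    (hτ : ∀ i, MeasurePreserving (τ i) volume volume)
    (h : ∀ ρ : ℂ → ℝ≥0, ∀ s ∈ Ioo 0 δ, ⨅ α ∈ arcsJoining Ω A B, arcLength ρ α ≤
      ∑ i, lineLength ρ R (o i) (τ i s)) :
    extremalLength Ω (singletons (arcsJoining Ω A B)) < ∞ := by
  set n : ℝ≥0∞ := (Fintype.card ι : ℝ≥0∞)
  have hδ0 : ENNReal.ofReal δ ≠ 0 := by simpa using hδ
  set K := (n * n) * (ENNReal.ofReal δ * ENNReal.ofReal (2 * R)) / ENNReal.ofReal δ ^ 2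
  have hK : K < ∞ := by
    refine ENNReal.div_lt_top ?_ (by simp [hδ])
    finiteness
  refine lt_of_le_of_lt (iSup₂_le fun ρ hρ => ?_) hK
  obtain ⟨hm, h0, ht⟩ := hρ
  -- Extension by zero gives the area over the whole plane its value on `Ω` and does not affect arcs
  -- inside `Ω`.
  set ρ' : ℂ → ℝ≥0 := Ω.indicator ρ
  have hm' : Measurable ρ' := hm.indicator hΩ
  have ha : area ρ' univ = area ρ Ω := by
    rw [area, Measure.restrict_univ, area, ← lintegral_indicator hΩ]
    refine lintegral_congr fun z => ?_
    by_cases hz : z ∈ Ω <;> simp [ρ', hz]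
  have hℓ : ∀ α ∈ arcsJoining Ω A B, arcLength ρ' α = arcLength ρ α := fun α hα =>
    setLIntegral_congr_fun measurableSet_Ioo fun t ht => by simp [ρ', hα.2.2.1 ht]
  rw [iInf_singletons]
  set ℓ := ⨅ α ∈ arcsJoining Ω A B, arcLength ρ α
  have hℓ' : ℓ = ⨅ α ∈ arcsJoining Ω A B, arcLength ρ' α :=
    iInf_congr fun α => iInf_congr fun hα => (hℓ α hα).symm
  have hsum : ℓ * ENNReal.ofReal δ ≤ ∑ i, ∫⁻ s in Ioo 0 δ, lineLength ρ' R (o i) (τ i s) := by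
    rw [← lintegral_finsetSum _ fun i _ => measurable_lineLength hm' (o i) (hτ i) R]
    calc ℓ * ENNReal.ofReal δ = ∫⁻ _ in Ioo 0 δ, ℓ := by simp
      _ ≤ _ := setLIntegral_mono' measurableSet_Ioo fun s hs => hℓ' ▸ h ρ' s hs
  have hsq : (ℓ * ENNReal.ofReal δ) ^ 2 ≤
      n * n * (area ρ Ω * (ENNReal.ofReal δ * ENNReal.ofReal (2 * R))) := by
    refine (pow_le_pow_left' hsum 2).trans ?_
    rw [sq, Finset.sum_mul_sum]
    -- A product of two legs is at most the square of the larger one.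
    have hle : ∀ i j, (∫⁻ s in Ioo 0 δ, lineLength ρ' R (o i) (τ i s)) *
        (∫⁻ s in Ioo 0 δ, lineLength ρ' R (o j) (τ j s)) ≤
        area ρ Ω * (ENNReal.ofReal δ * ENNReal.ofReal (2 * R)) := by
      have hi := fun i => sq_lintegral_lineLength_le hm' (o i) (hτ i) R δ
      rw [ha] at hi
      intro i j
      rcases le_total (∫⁻ s in Ioo 0 δ, lineLength ρ' R (o i) (τ i s))
        (∫⁻ s in Ioo 0 δ, lineLength ρ' R (o j) (τ j s)) with hij | hij
      · refine (mul_le_mul_left hij _).trans ?_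
        rw [← sq]; exact hi j
      · refine (mul_le_mul_right hij _).trans ?_
        rw [← sq]; exact hi i
    refine (Finset.sum_le_sum fun i _ => Finset.sum_le_sum fun j _ => hle i j).trans_eq ?_
    simp [n, mul_assoc]
  refine ENNReal.div_le_of_le_mul ?_
  simp only [K]
  rw [div_eq_mul_inv, mul_right_comm, ← div_eq_mul_inv, ENNReal.le_div_iff_mul_le
    (Or.inl (pow_ne_zero 2 hδ0)) (Or.inl (by finiteness)), ← mul_pow]
  refine hsq.trans_eq ?_
  ring

end Scherk
end



noncomputable section

namespace Scherk

/-! ### Staircases that are symmetric in the line `y = -x` -/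

section

variable (g : ℕ) (X : ℕ → ℝ)

/-- The interval between the nodes `X k` and `X (k + 1)`, unbounded for `k = g`. -/
def gap (k : ℕ) : Set ℝ := {t | X k < t ∧ (k < g → t < X (k + 1))}

/-- The `k`-th horizontal edge. -/
def hEdge (k : ℕ) : Set ℂ := {z | z.im = -X (g - k) ∧ z.re ∈ gap g X k}

/-- The `k`-th vertical edge. -/
def vEdge (k : ℕ) : Set ℂ := {z | z.re = X k ∧ -z.im ∈ gap g X (g - k)}

/-- The staircase with nodes `X 0, …, X g`. -/
def stairs : Set ℂ := closure (⋃ k ∈ Finset.range (g + 1), hEdge g X k ∪ vEdge g X k)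

/-- The points to the upper left of points of `S`. -/
def above (S : Set ℂ) : Set ℂ := {z | ∃ w ∈ S, z.re < w.re ∧ w.im < z.im}

/-- The points to the lower right of points of `S`. -/
def below (S : Set ℂ) : Set ℂ := {z | ∃ w ∈ S, w.re < z.re ∧ z.im < w.im}

/-- The orthodisk to the upper left of a staircase. -/
def upperDomain (b : ℝ) : Set ℂ := above (stairs g X) ∩ ({z | -b < z.re} ∩ {z | z.im < b})

/-- The orthodisk to the lower right of a staircase. -/
def lowerDomain (b : ℝ) : Set ℂ := below (stairs g X) ∩ ({z | z.re < b} ∪ {z | -b < z.im})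

/-- The conditions on the nodes of a staircase and the width `b` of the strips. -/
structure IsStair (b : ℝ) : Prop where
  strictMonoOn : StrictMonoOn X (Iic g)
  zero : X 0 = 0
  lt : X ((g + 1) / 2) < b

end

variable {g : ℕ} {X : ℕ → ℝ} {b : ℝ}

theorem isOpen_above (S : Set ℂ) : IsOpen (above S) := by
  have h : above S = ⋃ w ∈ S, {z : ℂ | z.re < w.re} ∩ {z : ℂ | w.im < z.im} := by
    ext z; simp [above, and_left_comm]
  rw [h]
  exact isOpen_biUnion fun w _ => (isOpen_lt Complex.continuous_re continuous_const).inter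
    (isOpen_lt continuous_const Complex.continuous_im)

theorem isOpen_below (S : Set ℂ) : IsOpen (below S) := by
  have h : below S = ⋃ w ∈ S, {z : ℂ | w.re < z.re} ∩ {z : ℂ | z.im < w.im} := by
    ext z; simp [below, and_left_comm]
  rw [h]
  exact isOpen_biUnion fun w _ => (isOpen_lt continuous_const Complex.continuous_re).inter
    (isOpen_lt Complex.continuous_im continuous_const)

theorem isOpen_upperDomain (g : ℕ) (X : ℕ → ℝ) (b : ℝ) : IsOpen (upperDomain g X b) :=
  (isOpen_above _).inter ((isOpen_lt continuous_const Complex.continuous_re).inter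
    (isOpen_lt Complex.continuous_im continuous_const))

theorem isOpen_lowerDomain (g : ℕ) (X : ℕ → ℝ) (b : ℝ) : IsOpen (lowerDomain g X b) :=
  (isOpen_below _).inter ((isOpen_lt Complex.continuous_re continuous_const).union
    (isOpen_lt continuous_const Complex.continuous_im))

theorem hEdge_subset_stairs {k : ℕ} (hk : k ≤ g) : hEdge g X k ⊆ stairs g X := fun z hz =>
  subset_closure (mem_iUnion₂.2 ⟨k, by simpa [Nat.lt_succ_iff] using hk, Or.inl hz⟩)

theorem vEdge_subset_stairs {k : ℕ} (hk : k ≤ g) : vEdge g X k ⊆ stairs g X := fun z hz =>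
  subset_closure (mem_iUnion₂.2 ⟨k, by simpa [Nat.lt_succ_iff] using hk, Or.inr hz⟩)

theorem stairs_subset {S : Set ℂ} (hS : IsClosed S) (hh : ∀ k ≤ g, hEdge g X k ⊆ S)
    (hv : ∀ k ≤ g, vEdge g X k ⊆ S) : stairs g X ⊆ S := by
  refine closure_minimal (iUnion₂_subset fun k hk => ?_) hS
  have hk' : k ≤ g := by simpa [Nat.lt_succ_iff] using hk
  exact union_subset (hh k hk') (hv k hk')

namespace IsStair

theorem le (h : IsStair g X b) {i j : ℕ} (hij : i ≤ j) (hj : j ≤ g) : X i ≤ X j :=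
  h.strictMonoOn.monotoneOn (mem_Iic.2 (hij.trans hj)) (mem_Iic.2 hj) hij

theorem lt_of_lt (h : IsStair g X b) {i j : ℕ} (hij : i < j) (hj : j ≤ g) : X i < X j :=
  h.strictMonoOn (mem_Iic.2 (hij.le.trans hj)) (mem_Iic.2 hj) hij

theorem nonneg (h : IsStair g X b) {j : ℕ} (hj : j ≤ g) : 0 ≤ X j :=
  h.zero ▸ h.le (Nat.zero_le j) hj

theorem pos (h : IsStair g X b) (hg : 1 ≤ g) : 0 < b :=
  (h.nonneg (by omega)).trans_lt h.lt

theorem edges_monotone (h : IsStair g X b) {k k' : ℕ} (hk : k ≤ g) (hk' : k' ≤ g) {w w' : ℂ}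
    (hw : w ∈ hEdge g X k ∪ vEdge g X k) (hw' : w' ∈ hEdge g X k' ∪ vEdge g X k')
    (hlt : w.re < w'.re) : w.im ≤ w'.im := by
  rcases hw with ⟨h1, h2, h3⟩ | ⟨h1, h2, h3⟩ <;> rcases hw' with ⟨h4, h5, h6⟩ | ⟨h4, h5, h6⟩
  · by_cases hkk : k' < k
    · linarith [h6 (by omega), h.le (show k' + 1 ≤ k by omega) hk]
    · rw [h1, h4]
      exact neg_le_neg (h.le (by omega) (by omega))
  · have hkk : k < k' := by
      by_contra hn
      linarith [h.le (show k' ≤ k by omega) hk]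
    linarith [h6 (by omega), h.le (show g - k' + 1 ≤ g - k by omega) (by omega)]
  · by_cases hkk : k' < k
    · linarith [h6 (by omega), h.le (show k' + 1 ≤ k by omega) hk]
    · linarith [h.le (show g - k' ≤ g - k by omega) (by omega)]
  · have hkk : k < k' := by
      by_contra hn
      linarith [h.le (show k' ≤ k by omega) hk]
    linarith [h6 (by omega), h.le (show g - k' + 1 ≤ g - k by omega) (by omega)]

/-- The relation expressing monotonicity is closed when written as a disjunction of non-strict
inequalities, so it passes from the open edges to their closure. It shows that the staircase is
disjoint from both of its sides. -/
theorem stairs_monotone (h : IsStair g X b) {w w' : ℂ} (hw : w ∈ stairs g X)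
    (hw' : w' ∈ stairs g X) (hlt : w.re < w'.re) : w.im ≤ w'.im := by
  have hR : IsClosed {q : ℂ × ℂ | q.2.re ≤ q.1.re ∨ q.1.im ≤ q.2.im} :=
    (isClosed_le (Complex.continuous_re.comp continuous_snd)
      (Complex.continuous_re.comp continuous_fst)).union
      (isClosed_le (Complex.continuous_im.comp continuous_fst)
      (Complex.continuous_im.comp continuous_snd))
  have hmem : (w, w') ∈ closure ((⋃ k ∈ Finset.range (g + 1), hEdge g X k ∪ vEdge g X k) ×ˢ
      (⋃ k ∈ Finset.range (g + 1), hEdge g X k ∪ vEdge g X k)) := by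
    rw [closure_prod_eq]; exact ⟨hw, hw'⟩
  have hsub := closure_minimal (s := (⋃ k ∈ Finset.range (g + 1), hEdge g X k ∪ vEdge g X k) ×ˢ
      (⋃ k ∈ Finset.range (g + 1), hEdge g X k ∪ vEdge g X k)) (fun q hq => ?_) hR
  · exact (hsub hmem).resolve_left (not_le.2 hlt)
  · obtain ⟨h1, h2⟩ := hq
    simp only [mem_iUnion, Finset.mem_range, Nat.lt_succ_iff] at h1 h2
    obtain ⟨k, hk, h1⟩ := h1
    obtain ⟨k', hk', h2⟩ := h2
    rcases le_or_gt q.2.re q.1.re with hle | hlt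
    · exact Or.inl hle
    · exact Or.inr (h.edges_monotone hk hk' h1 h2 hlt)

theorem stairs_subset_compl_above (h : IsStair g X b) : stairs g X ⊆ (above (stairs g X))ᶜ := by
  rintro z hz ⟨w, hw, h1, h2⟩
  exact absurd (h.stairs_monotone hz hw h1) (not_le.2 h2)

theorem stairs_subset_compl_below (h : IsStair g X b) : stairs g X ⊆ (below (stairs g X))ᶜ := by
  rintro z hz ⟨w, hw, h1, h2⟩
  exact absurd (h.stairs_monotone hw hz h1) (not_le.2 h2)

theorem stairs_subset_compl_upperDomain (h : IsStair g X b) :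
    stairs g X ⊆ (upperDomain g X b)ᶜ := fun _ hz hz' => h.stairs_subset_compl_above hz hz'.1

theorem stairs_subset_compl_lowerDomain (h : IsStair g X b) :
    stairs g X ⊆ (lowerDomain g X b)ᶜ := fun _ hz hz' => h.stairs_subset_compl_below hz hz'.1

theorem stairs_subset_quadrant (h : IsStair g X b) : stairs g X ⊆
    {z | 0 ≤ z.re ∧ z.im ≤ 0 ∧ (z.re ≤ 0 ∨ -X g ≤ z.im)} := by
  refine stairs_subset ?_ (fun k hk z hz => ?_) fun k hk z hz => ?_
  · exact (isClosed_le continuous_const Complex.continuous_re).inter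
      ((isClosed_le Complex.continuous_im continuous_const).inter
      ((isClosed_le Complex.continuous_re continuous_const).union
        (isClosed_le continuous_const Complex.continuous_im)))
  · obtain ⟨h1, h2, -⟩ := hz
    refine ⟨(h.nonneg hk).trans h2.le, ?_, Or.inr ?_⟩
    · linarith [h.nonneg (show g - k ≤ g by omega)]
    · linarith [h.le (show g - k ≤ g by omega) le_rfl]
  · obtain ⟨h1, h2, h3⟩ := hz
    refine ⟨h1 ▸ h.nonneg hk, ?_, ?_⟩
    · linarith [h.nonneg (show g - k ≤ g by omega)]
    · rcases Nat.eq_zero_or_pos k with rfl | hk0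
      · left; rw [h1, h.zero]
      · right; linarith [h3 (by omega), h.le (show g - k + 1 ≤ g by omega) le_rfl]

/-- Of the two half-infinite strips, one runs downwards and the other to the right, and `x + y` is
unbounded along both. -/
theorem isBounded_upperDomain (h : IsStair g X b) (hg : 1 ≤ g) (M : ℝ) :
    Bornology.IsBounded (upperDomain g X b ∩ {z | |z.re + z.im| ≤ M}) := by
  refine (Metric.isBounded_closedBall (x := (0 : ℂ)) (r := 2 * (|M| + b + X g))).subset ?_
  rintro z ⟨⟨⟨w, hw, h1, h2⟩, h3, h4⟩, h5⟩
  obtain ⟨e1, e2, e3⟩ := h.stairs_subset_quadrant hw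
  simp only [mem_ofPred_eq] at h3 h4 h5
  have hb := h.pos hg
  have ha := h.nonneg (le_refl g)
  have h6 := abs_le.1 (h5.trans (le_abs_self M))
  rw [mem_closedBall_zero_iff]
  refine (Complex.norm_le_abs_re_add_abs_im z).trans ?_
  have h7 : |z.re| ≤ |M| + b + X g ∧ |z.im| ≤ |M| + b + X g := by
    rw [abs_le, abs_le]
    rcases e3 with e3 | e3
    · exact ⟨⟨by linarith, by linarith⟩, by linarith, by linarith⟩
    · exact ⟨⟨by linarith, by linarith⟩, by linarith, by linarith⟩
  linarith [h7.1, h7.2]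

theorem isBounded_lowerDomain (h : IsStair g X b) (hg : 1 ≤ g) (M : ℝ) :
    Bornology.IsBounded (lowerDomain g X b ∩ {z | |z.re + z.im| ≤ M}) := by
  refine (Metric.isBounded_closedBall (x := (0 : ℂ)) (r := 2 * (|M| + b))).subset ?_
  rintro z ⟨⟨⟨w, hw, h1, h2⟩, h34⟩, h5⟩
  obtain ⟨e1, e2, -⟩ := h.stairs_subset_quadrant hw
  simp only [mem_ofPred_eq] at h5
  have hb := h.pos hg
  have h6 := abs_le.1 (h5.trans (le_abs_self M))
  rw [mem_closedBall_zero_iff]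
  refine (Complex.norm_le_abs_re_add_abs_im z).trans ?_
  have h7 : |z.re| ≤ |M| + b ∧ |z.im| ≤ |M| + b := by
    rw [abs_le, abs_le]
    rcases h34 with h3 | h3
    · simp only [mem_ofPred_eq] at h3
      exact ⟨⟨by linarith, by linarith⟩, by linarith, by linarith⟩
    · simp only [mem_ofPred_eq] at h3
      exact ⟨⟨by linarith, by linarith⟩, by linarith, by linarith⟩
  linarith [h7.1, h7.2]

end IsStair

/-! ### Reflection of a staircase -/

theorem mem_reflect_image {S : Set ℂ} {z : ℂ} : z ∈ reflect '' S ↔ reflect z ∈ S :=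
  ⟨by rintro ⟨w, hw, rfl⟩; simpa using hw, fun h => ⟨_, h, by simp⟩⟩

theorem reflect_image_hEdge {k : ℕ} (hk : k ≤ g) :
    reflect '' hEdge g X k = vEdge g X (g - k) := by
  ext z
  rw [mem_reflect_image]
  simp [hEdge, vEdge, Nat.sub_sub_self hk]

theorem reflect_image_vEdge {k : ℕ} (hk : k ≤ g) :
    reflect '' vEdge g X k = hEdge g X (g - k) := by
  ext z
  rw [mem_reflect_image]
  simp only [vEdge, hEdge, mem_ofPred_eq, reflect_re, reflect_im, neg_neg, Nat.sub_sub_self hk]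
  constructor <;> rintro ⟨h1, h2⟩ <;> exact ⟨by linarith, h2⟩

theorem mapsTo_reflect_stairs : MapsTo reflect (stairs g X) (stairs g X) := by
  refine fun z hz => ?_
  have hc : stairs g X ⊆ reflect ⁻¹' stairs g X := by
    refine stairs_subset (isClosed_closure.preimage reflect.continuous) (fun k hk w hw => ?_)
      fun k hk w hw => ?_
    · refine vEdge_subset_stairs (k := g - k) (by omega) ?_
      rw [← reflect_image_hEdge hk]
      exact mem_image_of_mem _ hw
    · refine hEdge_subset_stairs (k := g - k) (by omega) ?_
      rw [← reflect_image_vEdge hk]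
      exact mem_image_of_mem _ hw
  exact hc hz

theorem mapsTo_reflect_upperDomain : MapsTo reflect (upperDomain g X b) (upperDomain g X b) := by
  rintro z ⟨⟨w, hw, h1, h2⟩, h3, h4⟩
  simp only [mem_ofPred_eq] at h3 h4
  refine ⟨⟨_, mapsTo_reflect_stairs hw, ?_, ?_⟩, ?_, ?_⟩ <;> simp <;> linarith

theorem mapsTo_reflect_lowerDomain : MapsTo reflect (lowerDomain g X b) (lowerDomain g X b) := by
  rintro z ⟨⟨w, hw, h1, h2⟩, h3⟩
  refine ⟨⟨_, mapsTo_reflect_stairs hw, ?_, ?_⟩, ?_⟩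
  · simp; linarith
  · simp; linarith
  · rcases h3 with h3 | h3 <;> simp only [mem_ofPred_eq] at h3
    · right; simp; linarith
    · left; simp; linarith

/-! ### Maps of staircases -/

/-- The homeomorphism `(x, y) ↦ (f x, -f (-y))`. -/
def stairMap (f : ℝ ≃o ℝ) : ℂ ≃ₜ ℂ where
  toFun z := ⟨f z.re, -f (-z.im)⟩
  invFun z := ⟨f.symm z.re, -f.symm (-z.im)⟩
  left_inv z := by apply Complex.ext <;> simp
  right_inv z := by apply Complex.ext <;> simp
  continuous_toFun := by
    have := f.continuous
    exact Complex.equivRealProdCLM.symm.continuous.comp (by fun_prop :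
      Continuous fun z : ℂ => (f z.re, -f (-z.im)))
  continuous_invFun := by
    have := f.symm.continuous
    exact Complex.equivRealProdCLM.symm.continuous.comp (by fun_prop :
      Continuous fun z : ℂ => (f.symm z.re, -f.symm (-z.im)))

@[simp] theorem stairMap_re (f : ℝ ≃o ℝ) (z : ℂ) : (stairMap f z).re = f z.re := rfl

@[simp] theorem stairMap_im (f : ℝ ≃o ℝ) (z : ℂ) : (stairMap f z).im = -f (-z.im) := rfl

@[simp] theorem stairMap_symm_re (f : ℝ ≃o ℝ) (z : ℂ) :
    ((stairMap f).symm z).re = f.symm z.re := rfl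

@[simp] theorem stairMap_symm_im (f : ℝ ≃o ℝ) (z : ℂ) :
    ((stairMap f).symm z).im = -f.symm (-z.im) := rfl

theorem mem_stairMap_image {f : ℝ ≃o ℝ} {S : Set ℂ} {z : ℂ} :
    z ∈ stairMap f '' S ↔ (stairMap f).symm z ∈ S := by
  rw [Homeomorph.image_eq_preimage_symm]; rfl

section

variable {f : ℝ ≃o ℝ} {X' : ℕ → ℝ} {b' : ℝ}

theorem symm_mem_gap (hf : ∀ k ≤ g, f (X k) = X' k) {k : ℕ} (hk : k ≤ g) {t : ℝ} :
    f.symm t ∈ gap g X k ↔ t ∈ gap g X' k := by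
  simp only [gap, mem_ofPred_eq, f.lt_symm_apply, hf k hk, f.symm_apply_lt]
  refine and_congr_right fun _ => forall_congr' fun h => ?_
  rw [hf (k + 1) h]

theorem stairMap_image_hEdge (hf : ∀ k ≤ g, f (X k) = X' k) {k : ℕ} (hk : k ≤ g) :
    stairMap f '' hEdge g X k = hEdge g X' k := by
  ext z
  rw [mem_stairMap_image]
  simp only [hEdge, mem_ofPred_eq, stairMap_symm_re, stairMap_symm_im, symm_mem_gap hf hk, neg_inj]
  rw [f.symm_apply_eq, hf _ (Nat.sub_le _ _), neg_eq_iff_eq_neg]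

theorem stairMap_image_vEdge (hf : ∀ k ≤ g, f (X k) = X' k) {k : ℕ} (hk : k ≤ g) :
    stairMap f '' vEdge g X k = vEdge g X' k := by
  ext z
  rw [mem_stairMap_image]
  simp only [vEdge, mem_ofPred_eq, stairMap_symm_re, stairMap_symm_im,
    symm_mem_gap hf (Nat.sub_le g k), neg_neg]
  rw [f.symm_apply_eq, hf _ hk]

theorem stairMap_image_stairs (hf : ∀ k ≤ g, f (X k) = X' k) :
    stairMap f '' stairs g X = stairs g X' := by
  rw [stairs, (stairMap f).image_closure, stairs, image_iUnion₂]
  congr 1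
  refine iUnion₂_congr fun k hk => ?_
  have hk' : k ≤ g := by simpa [Nat.lt_succ_iff] using hk
  rw [image_union, stairMap_image_hEdge hf hk', stairMap_image_vEdge hf hk']

theorem stairMap_image_above (S : Set ℂ) :
    stairMap f '' above S = above (stairMap f '' S) := by
  ext z
  rw [mem_stairMap_image]
  simp only [above, mem_ofPred_eq, exists_mem_image, stairMap_re, stairMap_im, stairMap_symm_re,
    stairMap_symm_im, f.symm_apply_lt]
  refine exists_congr fun w => and_congr_right fun _ => and_congr_right fun _ => ?_
  rw [lt_neg, f.symm_apply_lt, neg_lt]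

theorem stairMap_image_below (S : Set ℂ) :
    stairMap f '' below S = below (stairMap f '' S) := by
  ext z
  rw [mem_stairMap_image]
  simp only [below, mem_ofPred_eq, exists_mem_image, stairMap_re, stairMap_im, stairMap_symm_re,
    stairMap_symm_im, f.lt_symm_apply]
  refine exists_congr fun w => and_congr_right fun _ => and_congr_right fun _ => ?_
  rw [neg_lt, f.lt_symm_apply, lt_neg]

theorem stairMap_image_upperDomain (hf : ∀ k ≤ g, f (X k) = X' k) (hb : f (-b) = -b') :
    stairMap f '' upperDomain g X b = upperDomain g X' b' := by
  rw [upperDomain, image_inter (stairMap f).injective, stairMap_image_above,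
    stairMap_image_stairs hf, upperDomain]
  congr 1
  ext z
  rw [mem_stairMap_image]
  simp only [mem_inter_iff, mem_ofPred_eq, stairMap_symm_re, stairMap_symm_im, f.lt_symm_apply, hb]
  rw [neg_lt (a := f.symm _), f.lt_symm_apply, hb, neg_lt_neg_iff]

/-- This serves for homotheties. It does not suffice for general deformations, because `b` may
coincide with a node and must then be moved independently of it. -/
theorem stairMap_image_lowerDomain (hf : ∀ k ≤ g, f (X k) = X' k) (hb : f b = b') :
    stairMap f '' lowerDomain g X b = lowerDomain g X' b' := by
  rw [lowerDomain, image_inter (stairMap f).injective, stairMap_image_below,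
    stairMap_image_stairs hf, lowerDomain]
  congr 1
  ext z
  rw [mem_stairMap_image]
  simp only [mem_union, mem_ofPred_eq, stairMap_symm_re, stairMap_symm_im, f.symm_apply_lt, hb]
  rw [neg_lt_neg_iff, f.symm_apply_lt, hb, neg_lt]

end

end Scherk
end



noncomputable section

namespace Scherk

/-! ### The staircase of a point of the space of geometric coordinates -/

section

variable {g : ℕ} (p : (Fin g → ℝ) × ℝ)

/-- The abscissas of the even vertices. -/
def node (k : ℕ) : ℝ := (vertex p (2 * k)).re

theorem segLength_of_lt {i : ℕ} (hi : i < g) : segLength p i = p.1 ⟨i, hi⟩ := by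
  have h : min i (2 * g - 1 - i) = i := by omega
  simp [segLength, h, hi]

theorem segLength_symm {i : ℕ} (hi : i < 2 * g) :
    segLength p (2 * g - 1 - i) = segLength p i := by
  have h : min (2 * g - 1 - i) (2 * g - 1 - (2 * g - 1 - i)) = min i (2 * g - 1 - i) := by omega
  simp only [segLength, h]

theorem segLength_pos (hp : ∀ i, 0 < p.1 i) {i : ℕ} (hi : i < 2 * g) : 0 < segLength p i := by
  have h : min i (2 * g - 1 - i) < g := by omega
  simpa [segLength, h] using hp _

theorem vertex_zero : vertex p 0 = ⟨0, -cornerDist p⟩ := by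
  apply Complex.ext <;> simp [vertex]

theorem vertex_succ_re (j : ℕ) :
    (vertex p (j + 1)).re = (vertex p j).re + if Even j then segLength p j else 0 := by
  rw [vertex, vertex, Finset.sum_range_succ, ← add_assoc, Complex.add_re]
  congr 1
  split_ifs <;> simp

theorem vertex_succ_im (j : ℕ) :
    (vertex p (j + 1)).im = (vertex p j).im + if Even j then 0 else segLength p j := by
  rw [vertex, vertex, Finset.sum_range_succ, ← add_assoc, Complex.add_im]
  congr 1
  split_ifs <;> simp

theorem vertex_sub_re {j : ℕ} (hj : j < 2 * g) :
    (vertex p (2 * g - j)).re =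
      (vertex p (2 * g - (j + 1))).re + if Even j then 0 else segLength p j := by
  have h := vertex_succ_re p (2 * g - (j + 1))
  rw [show 2 * g - (j + 1) + 1 = 2 * g - j by omega,
    show 2 * g - (j + 1) = 2 * g - 1 - j by omega, segLength_symm p hj] at h
  rw [h, show 2 * g - (j + 1) = 2 * g - 1 - j by omega]
  congr 1
  by_cases hev : Even j
  · have : ¬ Even (2 * g - 1 - j) := by
      obtain ⟨m, hm⟩ := hev
      rw [Nat.not_even_iff]; omega
    simp [hev, this]
  · have : Even (2 * g - 1 - j) := by
      rw [Nat.not_even_iff] at hev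
      rw [Nat.even_iff]; omega
    simp [hev, this]

/-- Counting from both ends at once: by symmetry the `i`-th segment from the end has the length of
the `i`-th from the start but the other direction, so exactly one of the two is horizontal. -/
theorem vertex_last_re : (vertex p (2 * g)).re = cornerDist p := by
  have key : ∀ j ≤ g, (vertex p (2 * g)).re - (vertex p (2 * g - j)).re + (vertex p j).re =
      ∑ i ∈ Finset.range j, segLength p i := by
    intro j
    induction j with
    | zero => intro _; simp [vertex_zero]
    | succ j ih =>
      intro hj
      rw [Finset.sum_range_succ, ← ih (by omega), vertex_sub_re p (show j < 2 * g by omega),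
        vertex_succ_re]
      split_ifs <;> ring
  have h := key g le_rfl
  rw [show 2 * g - g = g by omega, sub_add_cancel] at h
  rw [h, cornerDist, Finset.sum_range]
  exact Finset.sum_congr rfl fun i _ => segLength_of_lt p i.2

theorem vertex_im {j : ℕ} (hj : j ≤ 2 * g) : (vertex p j).im = -(vertex p (2 * g - j)).re := by
  induction j with
  | zero => simp [vertex_zero, vertex_last_re]
  | succ j ih =>
    rw [vertex_succ_im, ih (by omega), vertex_sub_re p (show j < 2 * g by omega)]
    split_ifs <;> ring

theorem vertex_even {k : ℕ} (hk : k ≤ g) : vertex p (2 * k) = ⟨node p k, -node p (g - k)⟩ := by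
  refine Complex.ext rfl ?_
  rw [vertex_im p (by omega), ← Nat.mul_sub]
  rfl

theorem vertex_odd {k : ℕ} (hk : k < g) :
    vertex p (2 * k + 1) = ⟨node p (k + 1), -node p (g - k)⟩ := by
  refine Complex.ext ?_ ?_
  · change _ = (vertex p (2 * k + 1 + 1)).re
    rw [vertex_succ_re p (2 * k + 1), if_neg (by simp), add_zero]
  · rw [vertex_succ_im, if_pos (by simp), add_zero, vertex_even p hk.le]

theorem node_zero : node p 0 = 0 := by simp [node, vertex_zero]

theorem node_last : node p g = cornerDist p := vertex_last_re p

theorem node_succ (k : ℕ) : node p (k + 1) = node p k + segLength p (2 * k) := by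
  change (vertex p (2 * k + 1 + 1)).re = _
  rw [vertex_succ_re p (2 * k + 1), if_neg (by simp), add_zero, vertex_succ_re, if_pos (by simp)]
  rfl

/-- Rounding up is right for odd `g`, where the segment after `P_g` is vertical and the next even
vertex has the same abscissa. -/
theorem node_center : node p ((g + 1) / 2) = (vertex p g).re := by
  rcases Nat.even_or_odd g with h | h
  · rw [node, show 2 * ((g + 1) / 2) = g by obtain ⟨m, rfl⟩ := h; omega]
  · rw [node, show 2 * ((g + 1) / 2) = g + 1 by obtain ⟨m, rfl⟩ := h; omega, vertex_succ_re,
      if_neg (Nat.not_even_iff_odd.2 h), add_zero]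

theorem isStair_node {p : (Fin g → ℝ) × ℝ} (hp : p ∈ Delta g) : IsStair g (node p) p.2 := by
  refine ⟨?_, node_zero p, ?_⟩
  · have h : ∀ i j, i < j → j ≤ g → node p i < node p j := by
      intro i j hij
      induction j, hij using Nat.le_induction with
      | base =>
        intro hj
        rw [node_succ]
        exact lt_add_of_pos_right _ (segLength_pos p hp.1 (by omega))
      | succ j hj ih =>
        intro hj'
        rw [node_succ]
        exact (ih (by omega)).trans (lt_add_of_pos_right _ (segLength_pos p hp.1 (by omega)))
    exact fun i _ j hj hij => h i j hij hj
  · rw [node_center]; exact hp.2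

theorem openSegment_horizontal {x x' : ℝ} (h : x < x') (y : ℝ) :
    openSegment ℝ (⟨x, y⟩ : ℂ) ⟨x', y⟩ = {z | z.im = y ∧ x < z.re ∧ z.re < x'} := by
  ext z
  constructor
  · rintro ⟨s, t, hs, ht, hst, rfl⟩
    have hs' : s = 1 - t := by linarith
    subst hs'
    simp only [mem_ofPred_eq, Complex.add_im, Complex.add_re, Complex.smul_im, Complex.smul_re,
      smul_eq_mul]
    exact ⟨by ring, by nlinarith, by nlinarith⟩
  · rintro ⟨h1, h2, h3⟩
    have hx : 0 < x' - x := by linarith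
    refine ⟨(x' - z.re) / (x' - x), (z.re - x) / (x' - x), div_pos (by linarith) hx,
      div_pos (by linarith) hx, by field_simp; ring, Complex.ext ?_ ?_⟩
    · simp only [Complex.add_re, Complex.smul_re, smul_eq_mul]
      field_simp; ring
    · simp only [Complex.add_im, Complex.smul_im, smul_eq_mul, h1]
      field_simp; ring

theorem openSegment_vertical {y y' : ℝ} (h : y < y') (x : ℝ) :
    openSegment ℝ (⟨x, y⟩ : ℂ) ⟨x, y'⟩ = {z | z.re = x ∧ y < z.im ∧ z.im < y'} := by
  ext z
  constructor
  · rintro ⟨s, t, hs, ht, hst, rfl⟩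
    have hs' : s = 1 - t := by linarith
    subst hs'
    simp only [mem_ofPred_eq, Complex.add_im, Complex.add_re, Complex.smul_im, Complex.smul_re,
      smul_eq_mul]
    exact ⟨by ring, by nlinarith, by nlinarith⟩
  · rintro ⟨h1, h2, h3⟩
    have hx : 0 < y' - y := by linarith
    refine ⟨(y' - z.im) / (y' - y), (z.im - y) / (y' - y), div_pos (by linarith) hx,
      div_pos (by linarith) hx, by field_simp; ring, Complex.ext ?_ ?_⟩
    · simp only [Complex.add_re, Complex.smul_re, smul_eq_mul, h1]
      field_simp; ring
    · simp only [Complex.add_im, Complex.smul_im, smul_eq_mul]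
      field_simp; ring

variable {p}

/-- The last, unbounded edge fits the pattern because the gap after the node `g` has no upper end.
-/
theorem edge_odd (hp : p ∈ Delta g) {k : ℕ} (hk : k ≤ g) :
    edge p (2 * k + 1) = hEdge g (node p) k := by
  rcases hk.lt_or_eq with hk | rfl
  · rw [edge, if_neg (by omega), if_pos (by omega), Nat.add_sub_cancel, vertex_even p hk.le,
      vertex_odd p hk, openSegment_horizontal ((isStair_node hp).lt_of_lt (Nat.lt_succ_self k) hk)]
    ext z
    simp [hEdge, gap, hk]
  · rw [edge, if_neg (by omega), if_neg (by omega)]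
    ext z
    simp [hEdge, gap, node_zero, node_last, and_comm]

theorem edge_even (hp : p ∈ Delta g) {k : ℕ} (hk : k ≤ g) :
    edge p (2 * k) = vEdge g (node p) k := by
  rcases Nat.eq_zero_or_pos k with rfl | hk0
  · rw [edge, if_pos (by omega)]
    ext z
    simp only [vEdge, gap, node_zero, node_last, mem_ofPred_eq, Nat.sub_zero, lt_irrefl,
      false_imp_iff, and_true, lt_neg]
  · obtain ⟨k, rfl⟩ : ∃ m, k = m + 1 := ⟨k - 1, by omega⟩
    have hlt := (isStair_node hp).lt_of_lt (show g - (k + 1) < g - k by omega) (by omega)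
    rw [edge, if_neg (by omega), if_pos (by omega), show 2 * (k + 1) - 1 = 2 * k + 1 by omega,
      vertex_even p hk, vertex_odd p hk, openSegment_vertical (neg_lt_neg hlt)]
    ext z
    simp only [vEdge, gap, mem_ofPred_eq]
    rw [show g - (k + 1) + 1 = g - k by omega]
    simp only [show g - (k + 1) < g by omega, true_imp_iff]
    constructor <;> rintro ⟨h1, h2, h3⟩ <;> exact ⟨h1, by linarith, by linarith⟩

theorem zigzag_eq (hp : p ∈ Delta g) : zigzag p = stairs g (node p) := by
  rw [zigzag, stairs]
  congr 1
  ext z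
  simp only [mem_iUnion, Finset.mem_range, exists_prop, mem_union]
  constructor
  · rintro ⟨j, hj, hz⟩
    rcases Nat.even_or_odd' j with ⟨k, rfl | rfl⟩
    · exact ⟨k, by omega, Or.inr (edge_even hp (show k ≤ g by omega) ▸ hz)⟩
    · exact ⟨k, by omega, Or.inl (edge_odd hp (show k ≤ g by omega) ▸ hz)⟩
  · rintro ⟨k, hk, hz | hz⟩
    · exact ⟨2 * k + 1, by omega, (edge_odd hp (show k ≤ g by omega)).symm ▸ hz⟩
    · exact ⟨2 * k, by omega, (edge_even hp (show k ≤ g by omega)).symm ▸ hz⟩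

theorem upperOrthodisk_eq (hp : p ∈ Delta g) :
    upperOrthodisk p = upperDomain g (node p) p.2 := by
  rw [upperOrthodisk, upperLeft, zigzag_eq hp]; rfl

theorem lowerOrthodisk_eq (hp : p ∈ Delta g) :
    lowerOrthodisk p = lowerDomain g (node p) p.2 := by
  rw [lowerOrthodisk, lowerRight, zigzag_eq hp]; rfl

theorem reflect_image_edge (hp : p ∈ Delta g) {j : ℕ} (hj : j ≤ 2 * g + 1) :
    reflect '' edge p j = edge p (2 * g + 1 - j) := by
  rcases Nat.even_or_odd' j with ⟨k, rfl | rfl⟩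
  · rw [edge_even hp (by omega), reflect_image_vEdge (by omega),
      show 2 * g + 1 - 2 * k = 2 * (g - k) + 1 by omega, edge_odd hp (by omega)]
  · rw [edge_odd hp (by omega), reflect_image_hEdge (by omega),
      show 2 * g + 1 - (2 * k + 1) = 2 * (g - k) by omega, edge_even hp (by omega)]

theorem edge_subset_stairs (hp : p ∈ Delta g) {j : ℕ} (hj : j ≤ 2 * g + 1) :
    edge p j ⊆ stairs g (node p) := by
  rcases Nat.even_or_odd' j with ⟨k, rfl | rfl⟩
  · rw [edge_even hp (by omega)]; exact vEdge_subset_stairs (by omega)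
  · rw [edge_odd hp (by omega)]; exact hEdge_subset_stairs (by omega)

theorem stairMap_image_edge {q : (Fin g → ℝ) × ℝ} (hp : p ∈ Delta g) (hq : q ∈ Delta g)
    {f : ℝ ≃o ℝ} (hf : ∀ k ≤ g, f (node p k) = node q k) {j : ℕ} (hj : j ≤ 2 * g + 1) :
    stairMap f '' edge p j = edge q j := by
  rcases Nat.even_or_odd' j with ⟨k, rfl | rfl⟩
  · rw [edge_even hp (by omega), edge_even hq (by omega), stairMap_image_vEdge hf (by omega)]
  · rw [edge_odd hp (by omega), edge_odd hq (by omega), stairMap_image_hEdge hf (by omega)]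

end

theorem analyticAt_segLength {g : ℕ} (i : ℕ) (p : (Fin g → ℝ) × ℝ) :
    AnalyticAt ℝ (fun q : (Fin g → ℝ) × ℝ => segLength q i) p := by
  by_cases h : min i (2 * g - 1 - i) < g
  · simp only [segLength, h, dif_pos]
    exact ((ContinuousLinearMap.proj (R := ℝ) (φ := fun _ : Fin g => ℝ)
      ⟨_, h⟩).comp (ContinuousLinearMap.fst ℝ (Fin g → ℝ) ℝ)).analyticAt p
  · simp only [segLength, h, dif_neg, not_false_iff]
    exact analyticAt_const

theorem analyticAt_node {g : ℕ} (k : ℕ) (p : (Fin g → ℝ) × ℝ) :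
    AnalyticAt ℝ (fun q : (Fin g → ℝ) × ℝ => node q k) p := by
  induction k with
  | zero => simp only [node_zero]; exact analyticAt_const
  | succ k ih => simp only [node_succ]; exact ih.add (analyticAt_segLength _ p)

theorem node_smul {g : ℕ} (r : ℝ) (p : (Fin g → ℝ) × ℝ) (k : ℕ) :
    node (r • p) k = r * node p k := by
  have hseg : ∀ i, segLength (r • p) i = r * segLength p i := fun i => by
    by_cases h : min i (2 * g - 1 - i) < g <;> simp [segLength, h]
  induction k with
  | zero => simp [node_zero]
  | succ k ih => rw [node_succ, node_succ, ih, hseg, mul_add]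

theorem isOpen_Delta (g : ℕ) : IsOpen (Delta g) := by
  have h : Delta g = (⋂ i, {p | 0 < p.1 i}) ∩ {p | node p ((g + 1) / 2) < p.2} := by
    ext p
    simp [Delta, node_center]
  have hn : Continuous fun q : (Fin g → ℝ) × ℝ => node q ((g + 1) / 2) :=
    continuous_iff_continuousAt.2 fun q => (analyticAt_node _ q).continuousAt
  rw [h]
  exact (isOpen_iInter_of_finite fun i => isOpen_lt continuous_const (by fun_prop)).inter
    (isOpen_lt hn continuous_snd)

theorem smul_mem_Delta {g : ℕ} {p : (Fin g → ℝ) × ℝ} (hp : p ∈ Delta g) {r : ℝ} (hr : 0 < r) :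
    r • p ∈ Delta g := by
  refine ⟨fun i => mul_pos hr (hp.1 i), ?_⟩
  rw [← node_center, node_smul, node_center]
  exact mul_lt_mul_of_pos_left hp.2 hr

end Scherk
end



noncomputable section

namespace Scherk

/-! ### Existence of potentials of finite energy -/

section

variable {Ω A B : Set ℂ}

/-- The function is constant where `|x + y|` is large, so its bounded gradient lives on a bounded
part of `Ω`. Being continuous on the whole plane, it has the right limits along every arc. -/
theorem isPotential_of_diagonal {φ : ℝ → ℝ} (hφ : ContDiff ℝ 1 φ) {M c₁ c₂ : ℝ}
    (h1 : ∀ s, M < s → φ s = c₁) (h2 : ∀ s, s < -M → φ s = c₂)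
    (hbd : Bornology.IsBounded (Ω ∩ {z | |z.re + z.im| ≤ M}))
    (hA : ∀ z ∈ A, φ (z.re + z.im) = 0) (hB : ∀ z ∈ B, φ (z.re + z.im) = 1) :
    IsPotential Ω A B 1 (fun z => φ (z.re + z.im)) := by
  set L : ℂ →L[ℝ] ℝ := Complex.reCLM + Complex.imCLM
  have hu : ContDiff ℝ 1 (fun z : ℂ => φ (z.re + z.im)) := hφ.comp L.contDiff
  -- The exceptional metric is zero, so no arc is exempted.
  refine ⟨hu.contDiffOn, ?_, 0, measurable_zero, by simp [area], fun α hα _ => ?_⟩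
  · obtain ⟨C, hC⟩ := isCompact_Icc.exists_bound_of_continuousOn (s := Icc (-M) M)
      (hφ.continuous_deriv le_rfl).continuousOn
    have hg : ∀ z, gradNorm (fun z : ℂ => φ (z.re + z.im)) z ≤
        (univ ∩ {z : ℂ | |z.re + z.im| ≤ M}).indicator (fun _ => C.toNNReal * ‖L‖₊) z := by
      intro z
      have hd : HasFDerivAt (fun z : ℂ => φ (z.re + z.im)) (deriv φ (z.re + z.im) • L) z :=
        ((hφ.differentiable one_ne_zero _).hasDerivAt).comp_hasFDerivAt z L.hasFDerivAt
      have hn : gradNorm (fun z : ℂ => φ (z.re + z.im)) z = ‖deriv φ (z.re + z.im)‖₊ * ‖L‖₊ := by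
        rw [gradNorm, hd.fderiv, nnnorm_smul]
      rw [hn]
      by_cases hz : |z.re + z.im| ≤ M
      · rw [indicator_of_mem (by simpa using hz)]
        gcongr
        rw [← NNReal.coe_le_coe, coe_nnnorm]
        exact (hC _ (abs_le.1 hz)).trans (Real.le_coe_toNNReal C)
      · have h0 : deriv φ (z.re + z.im) = 0 := by
          rcases lt_abs.1 (not_le.1 hz) with h | h
          · have he : φ =ᶠ[nhds (z.re + z.im)] fun _ => c₁ :=
              Filter.eventually_of_mem (Ioi_mem_nhds h) h1
            rw [he.deriv_eq, deriv_const]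
          · have he : φ =ᶠ[nhds (z.re + z.im)] fun _ => c₂ :=
              Filter.eventually_of_mem (Iio_mem_nhds (by linarith : z.re + z.im < -M)) h2
            rw [he.deriv_eq, deriv_const]
        simp [h0]
    have hS : MeasurableSet {z : ℂ | |z.re + z.im| ≤ M} :=
      (isClosed_le (Complex.continuous_re.add Complex.continuous_im).abs
        continuous_const).measurableSet
    have hle : area (gradNorm fun z : ℂ => φ (z.re + z.im)) Ω ≤
        ((C.toNNReal * ‖L‖₊ : ℝ≥0) : ℝ≥0∞) ^ 2 * volume (Ω ∩ {z | |z.re + z.im| ≤ M}) := by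
      rw [inter_comm, ← Measure.restrict_apply hS, ← lintegral_indicator_const hS]
      refine lintegral_mono fun z => ?_
      refine (pow_le_pow_left' (ENNReal.coe_le_coe.2 (hg z)) 2).trans_eq ?_
      by_cases hz : z ∈ {z : ℂ | |z.re + z.im| ≤ M}
      · rw [indicator_of_mem (by simpa using hz), indicator_of_mem hz]
      · rw [indicator_of_notMem (by simpa using hz), indicator_of_notMem hz]
        simp
    exact hle.trans_lt (ENNReal.mul_lt_top (by finiteness) hbd.measure_lt_top)
  · have hmem : ∀ t ∈ Ioo (0 : ℝ) 1, t ∈ Icc (0 : ℝ) 1 := fun t ht => Ioo_subset_Icc_self ht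
    have hc : ContinuousOn (fun t => φ ((α t).re + (α t).im)) (Icc 0 1) := by
      have := hα.1
      exact hu.continuous.comp_continuousOn this
    have hlim0 : Filter.Tendsto (fun t => φ ((α t).re + (α t).im)) (nhdsWithin 0 (Ioi 0))
        (nhds 0) := by
      have h := (hc 0 (by simp)).tendsto
      rw [hA _ hα.2.2.2.1] at h
      exact h.mono_left (nhdsWithin_le_iff.2 (Icc_mem_nhdsGT zero_lt_one))
    have hlim1 : Filter.Tendsto (fun t => φ ((α t).re + (α t).im)) (nhdsWithin 1 (Iio 1))
        (nhds 1) := by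
      have h := (hc 1 (by simp)).tendsto
      rw [hB _ hα.2.2.2.2] at h
      exact h.mono_left (nhdsWithin_le_iff.2 (Icc_mem_nhdsLT zero_lt_one))
    have := (hlim1.comp tendsto_one_sub).sub hlim0
    simpa using this

theorem exists_isPotential_of_separated {a : ℝ} (ha : 0 < a)
    (hbd : Bornology.IsBounded (Ω ∩ {z | |z.re + z.im| ≤ a}))
    (hA : ∀ z ∈ A, z.re + z.im ≤ -a) (hB : ∀ z ∈ B, a ≤ z.re + z.im) :
    ∃ u, IsPotential Ω A B 1 u := by
  have hφ : ContDiff ℝ 1 fun s : ℝ => Real.smoothTransition ((s + a) / (2 * a)) :=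
    Real.smoothTransition.contDiff.comp (by fun_prop)
  have h1 : ∀ s, a ≤ s → Real.smoothTransition ((s + a) / (2 * a)) = 1 := fun s hs =>
    Real.smoothTransition.one_of_one_le (by rw [le_div_iff₀ (by linarith)]; linarith)
  have h0 : ∀ s, s ≤ -a → Real.smoothTransition ((s + a) / (2 * a)) = 0 := fun s hs =>
    Real.smoothTransition.zero_of_nonpos (div_nonpos_of_nonpos_of_nonneg (by linarith)
      (by linarith))
  exact ⟨_, isPotential_of_diagonal hφ (fun s hs => h1 s hs.le) (fun s hs => h0 s hs.le) hbd
    (fun z hz => h0 _ (hA z hz)) fun z hz => h1 _ (hB z hz)⟩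

theorem exists_isPotential_of_abs {c d : ℝ} (hc : 0 ≤ c) (hcd : c < d)
    (hbd : Bornology.IsBounded (Ω ∩ {z | |z.re + z.im| ≤ d}))
    (hA : ∀ z ∈ A, d ≤ |z.re + z.im|) (hB : ∀ z ∈ B, |z.re + z.im| ≤ c) :
    ∃ u, IsPotential Ω A B 1 u := by
  have hpos : 0 < d ^ 2 - c ^ 2 := by nlinarith
  -- Squares stand in for absolute values, so that the function is smooth where `x + y = 0`.
  have hφ : ContDiff ℝ 1 fun s : ℝ => Real.smoothTransition ((d ^ 2 - s ^ 2) / (d ^ 2 - c ^ 2)) :=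
    Real.smoothTransition.contDiff.comp (by fun_prop)
  have h1 : ∀ s, |s| ≤ c → Real.smoothTransition ((d ^ 2 - s ^ 2) / (d ^ 2 - c ^ 2)) = 1 :=
    fun s hs => by
      have : s ^ 2 ≤ c ^ 2 := sq_le_sq' (by linarith [(abs_le.1 hs).1]) (abs_le.1 hs).2
      exact Real.smoothTransition.one_of_one_le (by rw [le_div_iff₀ hpos]; linarith)
  have h0 : ∀ s, d ≤ |s| → Real.smoothTransition ((d ^ 2 - s ^ 2) / (d ^ 2 - c ^ 2)) = 0 :=
    fun s hs => by
      have : d ^ 2 ≤ s ^ 2 := by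
        rw [← sq_abs s]; exact pow_le_pow_left₀ (by linarith) hs 2
      exact Real.smoothTransition.zero_of_nonpos
        (div_nonpos_of_nonpos_of_nonneg (by linarith) hpos.le)
  exact ⟨_, isPotential_of_diagonal hφ (fun s hs => h0 s (hs.le.trans (le_abs_self s)))
    (fun s hs => h0 s ((le_neg.2 hs.le).trans (neg_le_abs s))) hbd
    (fun z hz => h0 _ (hA z hz)) fun z hz => h1 _ (hB z hz)⟩

theorem extremalLength_singletons_comm :
    extremalLength Ω (singletons (arcsJoining Ω A B)) =
      extremalLength Ω (singletons (arcsJoining Ω B A)) := by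
  have key : ∀ (A B : Set ℂ) (ρ : ℂ → ℝ≥0), ⨅ α ∈ arcsJoining Ω A B, arcLength ρ α ≤
      ⨅ α ∈ arcsJoining Ω B A, arcLength ρ α := fun A B ρ => le_iInf₂ fun α hα => by
    rw [← arcLength_reverse ρ hα.2.1]
    exact iInf₂_le _ (reverse_mem hα)
  refine iSup_congr fun ρ => iSup_congr fun _ => ?_
  rw [iInf_singletons, iInf_singletons, le_antisymm (key A B ρ) (key B A ρ)]

end

/-! ### Sweeps of the orthodisks -/

theorem measurePreserving_const_sub (q : ℝ) :
    MeasurePreserving (fun s : ℝ => q - s) volume volume := Measure.measurePreserving_sub_left volume q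

theorem measurePreserving_const_add (q : ℝ) :
    MeasurePreserving (fun s : ℝ => q + s) volume volume := measurePreserving_add_left volume q

namespace IsStair

variable {g : ℕ} {X : ℕ → ℝ} {b : ℝ} {A B : Set ℂ}

theorem exists_width (h : IsStair g X b) (hg : 1 ≤ g) : ∃ η, 0 < η ∧ η ≤ b ∧
    X ((g + 1) / 2) + η ≤ b ∧ ∀ k < g, X k + η ≤ X (k + 1) := by
  have h1 : ∀ᶠ η in nhdsWithin (0 : ℝ) (Ioi 0), ∀ k ∈ Finset.range g, X k + η ≤ X (k + 1) := by
    rw [Filter.eventually_all_finset]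
    intro k hk
    have hlt := h.lt_of_lt (Nat.lt_succ_self k) (Finset.mem_range.1 hk)
    filter_upwards [Ioo_mem_nhdsGT (sub_pos.2 hlt)] with η hη
    have := hη.2
    simp only [Nat.succ_eq_add_one] at this
    linarith
  have h2 : ∀ᶠ η in nhdsWithin (0 : ℝ) (Ioi 0), η ∈ Ioo 0 b := Ioo_mem_nhdsGT (h.pos hg)
  have h3 : ∀ᶠ η in nhdsWithin (0 : ℝ) (Ioi 0), η ∈ Ioo 0 (b - X ((g + 1) / 2)) :=
    Ioo_mem_nhdsGT (sub_pos.2 h.lt)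
  obtain ⟨η, h1, h2, h3⟩ := (h1.and (h2.and h3)).exists
  exact ⟨η, h2.1, h2.2.le, by linarith [h3.2], fun k hk => h1 k (Finset.mem_range.2 hk)⟩

/-- The path with parameter `s` goes around the horizontal edge between the two vertical ones: to
the left at distance `s` below its height, up past its left end, and to the right at distance `s`
above it. -/
theorem extremalLength_upper_lt_top (h : IsStair g X b) (hg : 1 ≤ g) {k : ℕ} (hk : k < g)
    (hA : vEdge g X k ⊆ A) (hB : vEdge g X (k + 1) ⊆ B) :
    extremalLength (upperDomain g X b)
      (singletons (arcsJoining (upperDomain g X b) A B)) < ∞ := by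
  obtain ⟨η, hη, hηb, -, hηX⟩ := h.exists_width hg
  have hx0 := h.nonneg hk.le
  have hx1 := hηX k hk
  have hxa := h.le (show k + 1 ≤ g from hk) le_rfl
  have hy0 := h.nonneg (Nat.sub_le g k)
  have hya := h.le (Nat.sub_le g k) le_rfl
  have hy1 := hηX (g - (k + 1)) (by omega)
  rw [show g - (k + 1) + 1 = g - k by omega] at hy1
  have hv : ∀ r, 0 < r → r < η → (⟨X k, -X (g - k) - r⟩ : ℂ) ∈ vEdge g X k := fun r h0 h1 =>
    ⟨rfl, by simp; linarith, fun h' => by simp; linarith [hηX _ h']⟩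
  have hv' : ∀ r, 0 < r → r < η → (⟨X (k + 1), -X (g - k) + r⟩ : ℂ) ∈ vEdge g X (k + 1) :=
    fun r h0 h1 => ⟨rfl, by simp; linarith, fun _ => by
      rw [show g - (k + 1) + 1 = g - k by omega]; simp; linarith⟩
  have hΩ : ∀ s, 0 < s → s < η / 2 → ∀ x y : ℝ, X k - s ≤ x → y ≤ -X (g - k) + s →
      (x < X k ∧ -X (g - k) - s ≤ y ∨ x < X (k + 1) ∧ -X (g - k) + s ≤ y) →
      (⟨x, y⟩ : ℂ) ∈ upperDomain g X b := by
    intro s h0 h1 x y hx hy hxy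
    refine ⟨?_, show -b < x by linarith, show y < b by linarith⟩
    rcases hxy with ⟨h2, h3⟩ | ⟨h2, h3⟩
    -- The witness must lie strictly below depth `s` but still on the edge. The condition `s < η /
    -- 2` gives `3 / 2 * s < η`.
    · refine ⟨_, vEdge_subset_stairs hk.le (hv (3 / 2 * s) (by linarith) (by linarith)), h2, ?_⟩
      change -X (g - k) - 3 / 2 * s < y
      linarith
    · refine ⟨_, vEdge_subset_stairs hk (hv' (s / 2) (by linarith) (by linarith)), h2, ?_⟩
      change -X (g - k) + s / 2 < y
      linarith
  refine extremalLength_lt_top_of_sweep (ι := Fin 3) (R := X g + b) (δ := η / 2)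
    (o := ![true, false, true])
    (τ := ![fun s => -X (g - k) - s, fun s => X k - s, fun s => -X (g - k) + s])
    (isOpen_upperDomain g X b).measurableSet (by linarith) (fun i => ?_) fun ρ s hs => ?_
  · fin_cases i
    exacts [measurePreserving_const_sub _, measurePreserving_const_sub _,
      measurePreserving_const_add _]
  · obtain ⟨h0, h1⟩ := hs
    have e1 := arcDist_start (ρ := ρ) (Ω := upperDomain g X b) (A := A) (R := X g + b)
      (c := X k) (d := X k - s) (q := -X (g - k) - s) true
      (abs_le.2 ⟨by linarith, by linarith⟩) (abs_le.2 ⟨by linarith, by linarith⟩) (by linarith)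
      (fun t ht htc => by
        rw [uIcc_of_ge (by linarith)] at ht
        exact hΩ s h0 h1 t _ ht.1 (by linarith) (Or.inl ⟨lt_of_le_of_ne ht.2 htc, le_rfl⟩))
      (hA (hv s h0 (by linarith)))
    have e2 := arcDist_step (ρ := ρ) (Ω := upperDomain g X b) (A := A) (R := X g + b)
      (c := -X (g - k) - s) (d := -X (g - k) + s) (q := X k - s) false
      (abs_le.2 ⟨by linarith, by linarith⟩) (abs_le.2 ⟨by linarith, by linarith⟩)
      (fun t ht => by
        rw [uIcc_of_le (by linarith)] at ht
        exact hΩ s h0 h1 _ t le_rfl ht.2 (Or.inl ⟨by linarith, ht.1⟩))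
    have e3 := arcDist_finish (ρ := ρ) (Ω := upperDomain g X b) (A := A) (B := B) (R := X g + b)
      (c := X k - s) (d := X (k + 1)) (q := -X (g - k) + s) true
      (abs_le.2 ⟨by linarith, by linarith⟩) (abs_le.2 ⟨by linarith, by linarith⟩) (by linarith)
      (fun t ht htc => by
        rw [uIcc_of_le (by linarith)] at ht
        exact hΩ s h0 h1 t _ ht.1 le_rfl (Or.inr ⟨lt_of_le_of_ne ht.2 htc, le_rfl⟩))
      (hB (hv' s h0 (by linarith)))
    rw [Fin.sum_univ_three]
    exact e3.trans (add_le_add (e2.trans (add_le_add e1 le_rfl)) le_rfl)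

/-- The path goes to the right at distance `s` below the horizontal edge, up past its right end, and
back at distance `s` above its height. -/
theorem extremalLength_lower_lt_top (h : IsStair g X b) (hg : 1 ≤ g) {k : ℕ} (hk : k < g)
    (hA : vEdge g X k ⊆ A) (hB : vEdge g X (k + 1) ⊆ B) :
    extremalLength (lowerDomain g X b)
      (singletons (arcsJoining (lowerDomain g X b) A B)) < ∞ := by
  obtain ⟨η, hη, hηb, hηc, hηX⟩ := h.exists_width hg
  have hx0 := h.nonneg hk.le
  have hx1 := hηX k hk
  have hxa := h.le (show k + 1 ≤ g from hk) le_rfl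
  have hy0 := h.nonneg (Nat.sub_le g k)
  have hya := h.le (Nat.sub_le g k) le_rfl
  have hy1 := hηX (g - (k + 1)) (by omega)
  rw [show g - (k + 1) + 1 = g - k by omega] at hy1
  have hv : ∀ r, 0 < r → r < η → (⟨X k, -X (g - k) - r⟩ : ℂ) ∈ vEdge g X k := fun r h0 h1 =>
    ⟨rfl, by simp; linarith, fun h' => by simp; linarith [hηX _ h']⟩
  have hv' : ∀ r, 0 < r → r < η → (⟨X (k + 1), -X (g - k) + r⟩ : ℂ) ∈ vEdge g X (k + 1) :=
    fun r h0 h1 => ⟨rfl, by simp; linarith, fun _ => by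
      rw [show g - (k + 1) + 1 = g - k by omega]; simp; linarith⟩
  -- The corridor avoids the removed corner quadrant: before the central vertex it stays to the left
  -- of `b`, and after it above `-b`.
  have hstrip : X (k + 1) + η ≤ b ∨ -b ≤ -X (g - k) - η := by
    rcases le_or_gt (k + 1) ((g + 1) / 2) with hle | hlt
    · left; linarith [h.le hle (by omega)]
    · right; linarith [h.le (show g - k ≤ (g + 1) / 2 by omega) (by omega)]
  have hΩ : ∀ s, 0 < s → s < η / 2 → ∀ x y : ℝ, x ≤ X (k + 1) + s → -X (g - k) - s ≤ y →
      (X k < x ∧ y ≤ -X (g - k) - s ∨ X (k + 1) < x ∧ y ≤ -X (g - k) + s) →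
      (⟨x, y⟩ : ℂ) ∈ lowerDomain g X b := by
    intro s h0 h1 x y hx hy hxy
    refine ⟨?_, ?_⟩
    · rcases hxy with ⟨h2, h3⟩ | ⟨h2, h3⟩
      · refine ⟨_, vEdge_subset_stairs hk.le (hv (s / 2) (by linarith) (by linarith)), h2, ?_⟩
        change y < -X (g - k) - s / 2
        linarith
      · refine ⟨_, vEdge_subset_stairs hk (hv' (3 / 2 * s) (by linarith) (by linarith)), h2, ?_⟩
        change y < -X (g - k) + 3 / 2 * s
        linarith
    · rcases hstrip with h4 | h4
      · left; change x < b; linarith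
      · right; change -b < y; linarith
  refine extremalLength_lt_top_of_sweep (ι := Fin 3) (R := X g + b) (δ := η / 2)
    (o := ![true, false, true])
    (τ := ![fun s => -X (g - k) - s, fun s => X (k + 1) + s, fun s => -X (g - k) + s])
    (isOpen_lowerDomain g X b).measurableSet (by linarith) (fun i => ?_) fun ρ s hs => ?_
  · fin_cases i
    exacts [measurePreserving_const_sub _, measurePreserving_const_add _,
      measurePreserving_const_add _]
  · obtain ⟨h0, h1⟩ := hs
    have e1 := arcDist_start (ρ := ρ) (Ω := lowerDomain g X b) (A := A) (R := X g + b)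
      (c := X k) (d := X (k + 1) + s) (q := -X (g - k) - s) true
      (abs_le.2 ⟨by linarith, by linarith⟩) (abs_le.2 ⟨by linarith, by linarith⟩) (by linarith)
      (fun t ht htc => by
        rw [uIcc_of_le (by linarith)] at ht
        exact hΩ s h0 h1 t _ ht.2 le_rfl (Or.inl ⟨lt_of_le_of_ne ht.1 (Ne.symm htc), le_rfl⟩))
      (hA (hv s h0 (by linarith)))
    have e2 := arcDist_step (ρ := ρ) (Ω := lowerDomain g X b) (A := A) (R := X g + b)
      (c := -X (g - k) - s) (d := -X (g - k) + s) (q := X (k + 1) + s) false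
      (abs_le.2 ⟨by linarith, by linarith⟩) (abs_le.2 ⟨by linarith, by linarith⟩)
      (fun t ht => by
        rw [uIcc_of_le (by linarith)] at ht
        exact hΩ s h0 h1 _ t le_rfl ht.1 (Or.inr ⟨by linarith, ht.2⟩))
    have e3 := arcDist_finish (ρ := ρ) (Ω := lowerDomain g X b) (A := A) (B := B) (R := X g + b)
      (c := X (k + 1) + s) (d := X (k + 1)) (q := -X (g - k) + s) true
      (abs_le.2 ⟨by linarith, by linarith⟩) (abs_le.2 ⟨by linarith, by linarith⟩) (by linarith)
      (fun t ht htc => by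
        rw [uIcc_of_ge (by linarith)] at ht
        exact hΩ s h0 h1 t _ ht.2 (by linarith)
          (Or.inr ⟨lt_of_le_of_ne ht.1 (Ne.symm htc), le_rfl⟩))
      (hB (hv' s h0 (by linarith)))
    rw [Fin.sum_univ_three]
    exact e3.trans (add_le_add (e2.trans (add_le_add e1 le_rfl)) le_rfl)

/-- Four legs lead left from the vertical ray, up, right above the whole staircase, and down to the
horizontal ray. They stay at distance `s < b` from the axes or beyond the staircase ends, so all of
the strip width is available. -/
theorem extremalLength_upper_ends_lt_top (h : IsStair g X b) (hg : 1 ≤ g)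
    (hA : vEdge g X 0 ⊆ A) (hB : hEdge g X g ⊆ B) :
    extremalLength (upperDomain g X b)
      (singletons (arcsJoining (upperDomain g X b) A B)) < ∞ := by
  have hb := h.pos hg
  have ha := h.nonneg (le_refl g)
  have hv : ∀ r, 0 < r → (⟨0, -X g - r⟩ : ℂ) ∈ vEdge g X 0 := fun r h0 =>
    ⟨h.zero.symm, by simp; linarith, fun h' => absurd h' (by omega)⟩
  have hw : ∀ r, 0 < r → (⟨X g + r, 0⟩ : ℂ) ∈ hEdge g X g := fun r h0 =>
    ⟨by simp [h.zero], by simp; linarith, fun h' => absurd h' (lt_irrefl _)⟩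
  have hΩ : ∀ s, 0 < s → s < b → ∀ x y : ℝ, -s ≤ x → y ≤ s →
      (x < 0 ∧ -X g - s ≤ y ∨ x ≤ X g + s ∧ 0 < y) →
      (⟨x, y⟩ : ℂ) ∈ upperDomain g X b := by
    intro s h0 h1 x y hx hy hxy
    refine ⟨?_, show -b < x by linarith, show y < b by linarith⟩
    rcases hxy with ⟨h2, h3⟩ | ⟨h2, h3⟩
    · refine ⟨_, vEdge_subset_stairs (Nat.zero_le g) (hv (2 * s) (by linarith)), h2, ?_⟩
      change -X g - 2 * s < y
      linarith
    · refine ⟨_, hEdge_subset_stairs le_rfl (hw (2 * s) (by linarith)), ?_, h3⟩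
      change x < X g + 2 * s
      linarith
  refine extremalLength_lt_top_of_sweep (ι := Fin 4) (R := X g + b) (δ := b)
    (o := ![true, false, true, false])
    (τ := ![fun s => -X g - s, fun s => 0 - s, fun s => 0 + s, fun s => X g + s])
    (isOpen_upperDomain g X b).measurableSet hb (fun i => ?_) fun ρ s hs => ?_
  · fin_cases i
    exacts [measurePreserving_const_sub _, measurePreserving_const_sub _,
      measurePreserving_const_add _, measurePreserving_const_add _]
  · obtain ⟨h0, h1⟩ := hs
    have e1 := arcDist_start (ρ := ρ) (Ω := upperDomain g X b) (A := A) (R := X g + b)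
      (c := 0) (d := 0 - s) (q := -X g - s) true
      (abs_le.2 ⟨by linarith, by linarith⟩) (abs_le.2 ⟨by linarith, by linarith⟩) (by linarith)
      (fun t ht htc => by
        rw [uIcc_of_ge (by linarith)] at ht
        exact hΩ s h0 h1 t _ (by linarith [ht.1]) (by linarith)
          (Or.inl ⟨lt_of_le_of_ne ht.2 htc, le_rfl⟩))
      (hA (hv s h0))
    have e2 := arcDist_step (ρ := ρ) (Ω := upperDomain g X b) (A := A) (R := X g + b)
      (c := -X g - s) (d := 0 + s) (q := 0 - s) false
      (abs_le.2 ⟨by linarith, by linarith⟩) (abs_le.2 ⟨by linarith, by linarith⟩)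
      (fun t ht => by
        rw [uIcc_of_le (by linarith)] at ht
        exact hΩ s h0 h1 _ t (by linarith) (by linarith [ht.2]) (Or.inl ⟨by linarith, ht.1⟩))
    have e3 := arcDist_step (ρ := ρ) (Ω := upperDomain g X b) (A := A) (R := X g + b)
      (c := 0 - s) (d := X g + s) (q := 0 + s) true
      (abs_le.2 ⟨by linarith, by linarith⟩) (abs_le.2 ⟨by linarith, by linarith⟩)
      (fun t ht => by
        rw [uIcc_of_le (by linarith)] at ht
        exact hΩ s h0 h1 t _ (by linarith [ht.1]) (by linarith)
          (Or.inr ⟨ht.2, by linarith⟩))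
    have e4 := arcDist_finish (ρ := ρ) (Ω := upperDomain g X b) (A := A) (B := B) (R := X g + b)
      (c := 0 + s) (d := 0) (q := X g + s) false
      (abs_le.2 ⟨by linarith, by linarith⟩) (abs_le.2 ⟨by linarith, by linarith⟩) (by linarith)
      (fun t ht htc => by
        rw [uIcc_of_ge (by linarith)] at ht
        exact hΩ s h0 h1 _ t (by linarith) (by linarith [ht.2])
          (Or.inr ⟨le_rfl, lt_of_le_of_ne ht.1 (Ne.symm htc)⟩))
      (hB (hw s h0))
    rw [Fin.sum_univ_four]
    exact e4.trans (add_le_add (e3.trans (add_le_add (e2.trans (add_le_add e1 le_rfl)) le_rfl))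
      le_rfl)

/-- There are points of the staircase close to the central vertex. -/
theorem exists_mem_stairs_near_center (h : IsStair g X b) (hg : 1 ≤ g) {e : ℝ}
    (he : X ((g + 1) / 2) < e) : ∃ w ∈ stairs g X, w.re = X ((g + 1) / 2) ∧ -e < w.im := by
  obtain ⟨η, hη, -, -, hηX⟩ := h.exists_width hg
  set r := min (η / 2) ((e - X ((g + 1) / 2)) / 2)
  have hr : 0 < r := lt_min (by linarith) (by linarith)
  have hr1 : r ≤ η / 2 := min_le_left _ _
  have hr2 : r ≤ (e - X ((g + 1) / 2)) / 2 := min_le_right _ _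
  have hle := h.le (show g - (g + 1) / 2 ≤ (g + 1) / 2 by omega) (by omega)
  refine ⟨⟨X ((g + 1) / 2), -X (g - (g + 1) / 2) - r⟩, vEdge_subset_stairs
    (k := (g + 1) / 2) (by omega) ⟨rfl, by simp; linarith, fun h' => ?_⟩, rfl, ?_⟩
  · simp
    linarith [hηX _ h']
  · change -e < -X (g - (g + 1) / 2) - r
    linarith

/-- The paths turn at `(c + s, -c - s)`, between the central vertex and the outer corner `(b, -b)`;
this is why `s` ranges up to `b - c`. -/
theorem extremalLength_lower_ends_lt_top (h : IsStair g X b) (hg : 1 ≤ g)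
    (hA : vEdge g X 0 ⊆ A) (hB : hEdge g X g ⊆ B) :
    extremalLength (lowerDomain g X b)
      (singletons (arcsJoining (lowerDomain g X b) A B)) < ∞ := by
  have hb := h.pos hg
  set c := X ((g + 1) / 2)
  have hc0 : 0 ≤ c := h.nonneg (by omega)
  have hca : c ≤ X g := h.le (by omega) le_rfl
  have hcb : 0 < b - c := sub_pos.2 h.lt
  have hv : ∀ r, 0 < r → (⟨0, -X g - r⟩ : ℂ) ∈ vEdge g X 0 := fun r h0 =>
    ⟨h.zero.symm, by simp; linarith, fun h' => absurd h' (by omega)⟩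
  have hw : ∀ r, 0 < r → (⟨X g + r, 0⟩ : ℂ) ∈ hEdge g X g := fun r h0 =>
    ⟨by simp [h.zero], by simp; linarith, fun h' => absurd h' (lt_irrefl _)⟩
  have hΩ : ∀ s, 0 < s → s < b - c → ∀ x y : ℝ, (x ≤ c + s ∨ -c - s ≤ y) →
      (0 < x ∧ y ≤ -X g - s ∨ c + s ≤ x ∧ y ≤ -c - s ∨ X g + s ≤ x ∧ y < 0) →
      (⟨x, y⟩ : ℂ) ∈ lowerDomain g X b := by
    intro s h0 h1 x y hxy' hxy
    refine ⟨?_, ?_⟩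
    · rcases hxy with ⟨h2, h3⟩ | ⟨h2, h3⟩ | ⟨h2, h3⟩
      · refine ⟨_, vEdge_subset_stairs (Nat.zero_le g) (hv (s / 2) (by linarith)), h2, ?_⟩
        change y < -X g - s / 2
        linarith
      · obtain ⟨w, hw, hw1, hw2⟩ :=
          h.exists_mem_stairs_near_center hg (show c < c + s by linarith)
        refine ⟨w, hw, ?_, ?_⟩
        · rw [hw1]; change c < x; linarith
        · change y < w.im; linarith
      · refine ⟨_, hEdge_subset_stairs le_rfl (hw (s / 2) (by linarith)), ?_, h3⟩
        change X g + s / 2 < x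
        linarith
    · rcases hxy' with h4 | h4
      · left; change x < b; linarith
      · right; change -b < y; linarith
  refine extremalLength_lt_top_of_sweep (ι := Fin 4) (R := X g + b) (δ := b - c)
    (o := ![true, false, true, false])
    (τ := ![fun s => -X g - s, fun s => c + s, fun s => -c - s, fun s => X g + s])
    (isOpen_lowerDomain g X b).measurableSet hcb (fun i => ?_) fun ρ s hs => ?_
  · fin_cases i
    exacts [measurePreserving_const_sub _, measurePreserving_const_add _,
      measurePreserving_const_sub _, measurePreserving_const_add _]
  · obtain ⟨h0, h1⟩ := hs
    have e1 := arcDist_start (ρ := ρ) (Ω := lowerDomain g X b) (A := A) (R := X g + b)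
      (c := 0) (d := c + s) (q := -X g - s) true
      (abs_le.2 ⟨by linarith, by linarith⟩) (abs_le.2 ⟨by linarith, by linarith⟩) (by linarith)
      (fun t ht htc => by
        rw [uIcc_of_le (by linarith)] at ht
        exact hΩ s h0 h1 t _ (Or.inl ht.2)
          (Or.inl ⟨lt_of_le_of_ne ht.1 (Ne.symm htc), le_rfl⟩))
      (hA (hv s h0))
    have e2 := arcDist_step (ρ := ρ) (Ω := lowerDomain g X b) (A := A) (R := X g + b)
      (c := -X g - s) (d := -c - s) (q := c + s) false
      (abs_le.2 ⟨by linarith, by linarith⟩) (abs_le.2 ⟨by linarith, by linarith⟩)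
      (fun t ht => by
        rw [uIcc_of_le (by linarith)] at ht
        exact hΩ s h0 h1 _ t (Or.inl le_rfl) (Or.inr (Or.inl ⟨le_rfl, ht.2⟩)))
    have e3 := arcDist_step (ρ := ρ) (Ω := lowerDomain g X b) (A := A) (R := X g + b)
      (c := c + s) (d := X g + s) (q := -c - s) true
      (abs_le.2 ⟨by linarith, by linarith⟩) (abs_le.2 ⟨by linarith, by linarith⟩)
      (fun t ht => by
        rw [uIcc_of_le (by linarith)] at ht
        exact hΩ s h0 h1 t _ (Or.inr le_rfl) (Or.inr (Or.inl ⟨ht.1, le_rfl⟩)))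
    have e4 := arcDist_finish (ρ := ρ) (Ω := lowerDomain g X b) (A := A) (B := B) (R := X g + b)
      (c := -c - s) (d := 0) (q := X g + s) false
      (abs_le.2 ⟨by linarith, by linarith⟩) (abs_le.2 ⟨by linarith, by linarith⟩) (by linarith)
      (fun t ht htc => by
        rw [uIcc_of_le (by linarith)] at ht
        exact hΩ s h0 h1 _ t (Or.inr ht.1)
          (Or.inr (Or.inr ⟨le_rfl, lt_of_le_of_ne ht.2 htc⟩)))
      (hB (hw s h0))
    rw [Fin.sum_univ_four]
    exact e4.trans (add_le_add (e3.trans (add_le_add (e2.trans (add_le_add e1 le_rfl)) le_rfl))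
      le_rfl)

theorem upperDomain_nonempty (h : IsStair g X b) (hg : 1 ≤ g) : (upperDomain g X b).Nonempty := by
  have hb := h.pos hg
  have ha := h.nonneg (le_refl g)
  refine ⟨⟨-(b / 2), -X g - 1⟩, ⟨⟨0, -X g - 2⟩, vEdge_subset_stairs (Nat.zero_le g)
    ⟨h.zero.symm, by simp, fun h' => absurd h' (by omega)⟩, ?_, ?_⟩, ?_, ?_⟩ <;> simp <;> linarith

theorem lowerDomain_nonempty (h : IsStair g X b) (hg : 1 ≤ g) : (lowerDomain g X b).Nonempty := by
  have hb := h.pos hg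
  refine ⟨⟨b / 2, -X g - 2⟩, ⟨⟨0, -X g - 1⟩, vEdge_subset_stairs (Nat.zero_le g)
    ⟨h.zero.symm, by simp, fun h' => absurd h' (by omega)⟩, ?_, ?_⟩, Or.inl ?_⟩ <;> simp <;>
    linarith

end IsStair

end Scherk
end



noncomputable section

namespace Scherk

/-! ### Bounded functions with bounded derivative -/

/-- Bounded continuously differentiable maps with bounded derivative. -/
def BoundedC1 {E F : Type*} [NormedAddCommGroup E] [NormedSpace ℝ E] [NormedAddCommGroup F]
    [NormedSpace ℝ F] (φ : E → F) : Prop :=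
  ContDiff ℝ 1 φ ∧ ∃ C, ∀ x, ‖φ x‖ ≤ C ∧ ‖fderiv ℝ φ x‖ ≤ C

namespace BoundedC1

variable {E F : Type*} [NormedAddCommGroup E] [NormedSpace ℝ E] [NormedAddCommGroup F]
  [NormedSpace ℝ F]

theorem const (c : F) : BoundedC1 fun _ : E => c :=
  ⟨contDiff_const, ‖c‖, fun x => ⟨le_rfl, by simp⟩⟩

theorem add {φ ψ : E → F} (hφ : BoundedC1 φ) (hψ : BoundedC1 ψ) :
    BoundedC1 fun x => φ x + ψ x := by
  obtain ⟨h1, C, hC⟩ := hφ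
  obtain ⟨h2, D, hD⟩ := hψ
  refine ⟨h1.add h2, C + D, fun x => ⟨(norm_add_le _ _).trans (add_le_add (hC x).1 (hD x).1), ?_⟩⟩
  rw [fderiv_fun_add (h1.differentiable one_ne_zero x) (h2.differentiable one_ne_zero x)]
  exact (norm_add_le _ _).trans (add_le_add (hC x).2 (hD x).2)

theorem smul {φ : E → ℝ} {ψ : E → F} (hφ : BoundedC1 φ) (hψ : BoundedC1 ψ) :
    BoundedC1 fun x => φ x • ψ x := by
  obtain ⟨h1, C, hC⟩ := hφ
  obtain ⟨h2, D, hD⟩ := hψ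
  have hC0 : ∀ x : E, 0 ≤ C := fun x => (norm_nonneg _).trans (hC x).1
  have hD0 : ∀ x : E, 0 ≤ D := fun x => (norm_nonneg _).trans (hD x).1
  refine ⟨h1.smul h2, 2 * (C * D), fun x => ⟨?_, ?_⟩⟩
  · rw [norm_smul]
    have := mul_le_mul (hC x).1 (hD x).1 (norm_nonneg _) (hC0 x)
    linarith [mul_nonneg (hC0 x) (hD0 x)]
  · rw [fderiv_fun_smul (h1.differentiable one_ne_zero x) (h2.differentiable one_ne_zero x)]
    refine (norm_add_le _ _).trans ?_
    rw [norm_smul, ContinuousLinearMap.norm_smulRight_apply]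
    have e1 := mul_le_mul (hC x).1 (hD x).2 (norm_nonneg _) (hC0 x)
    have e2 := mul_le_mul (hC x).2 (hD x).1 (norm_nonneg _) (hC0 x)
    linarith

theorem comp_clm {φ : ℝ → F} (hφ : BoundedC1 φ) (L : E →L[ℝ] ℝ) :
    BoundedC1 fun x => φ (L x) := by
  obtain ⟨h1, C, hC⟩ := hφ
  have hC0 : 0 ≤ C := (norm_nonneg _).trans (hC 0).1
  refine ⟨h1.comp L.contDiff, C + C * ‖L‖, fun x => ⟨?_, ?_⟩⟩
  · linarith [(hC (L x)).1, mul_nonneg hC0 (norm_nonneg L)]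
  · have hd : HasFDerivAt (fun x => φ (L x)) ((fderiv ℝ φ (L x)).comp L) x :=
      (h1.differentiable one_ne_zero (L x)).hasFDerivAt.comp x L.hasFDerivAt
    rw [hd.fderiv]
    refine (ContinuousLinearMap.opNorm_comp_le _ _).trans ?_
    linarith [mul_le_mul_of_nonneg_right (hC (L x)).2 (norm_nonneg L)]

theorem of_bounded {φ : ℝ → ℝ} (hφ : ContDiff ℝ 1 φ) {a b D : ℝ} (hD : ∀ t, |φ t| ≤ D)
    (h0 : ∀ t, t ∉ Icc a b → deriv φ t = 0) : BoundedC1 φ := by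
  obtain ⟨C, hC⟩ := isCompact_Icc.exists_bound_of_continuousOn (s := Icc a b)
    (hφ.continuous_deriv le_rfl).continuousOn
  refine ⟨hφ, max D (max C 0), fun t => ⟨(hD t).trans (le_max_left _ _), ?_⟩⟩
  rw [← norm_deriv_eq_norm_fderiv]
  by_cases ht : t ∈ Icc a b
  · exact (hC t ht).trans ((le_max_left _ _).trans (le_max_right _ _))
  · rw [h0 t ht, norm_zero]
    exact (le_max_right _ _).trans (le_max_right _ _)

end BoundedC1

theorem exists_cutoff {m n : ℝ} (h : m < n) : ∃ χ : ℝ → ℝ, BoundedC1 χ ∧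
    (∀ t ≤ m, χ t = 0) ∧ ∀ t, n ≤ t → χ t = 1 := by
  have hpos : 0 < n - m := sub_pos.2 h
  set χ : ℝ → ℝ := fun t => Real.smoothTransition ((t - m) / (n - m))
  have h0 : ∀ t ≤ m, χ t = 0 := fun t ht => Real.smoothTransition.zero_of_nonpos
    (div_nonpos_of_nonpos_of_nonneg (by linarith) hpos.le)
  have h1 : ∀ t, n ≤ t → χ t = 1 := fun t ht => Real.smoothTransition.one_of_one_le
    (by rw [le_div_iff₀ hpos]; linarith)
  refine ⟨χ, BoundedC1.of_bounded (a := m) (b := n) (D := 1)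
    (Real.smoothTransition.contDiff.comp (by fun_prop)) (fun t => ?_) fun t ht => ?_, h0, h1⟩
  · rw [abs_of_nonneg (Real.smoothTransition.nonneg _)]
    exact Real.smoothTransition.le_one _
  · rcases not_and_or.1 ht with ht | ht
    · have he : χ =ᶠ[nhds t] fun _ => (0 : ℝ) :=
        Filter.eventually_of_mem (Iio_mem_nhds (not_le.1 ht)) fun s hs => h0 s (le_of_lt hs)
      rw [he.deriv_eq, deriv_const]
    · have he : χ =ᶠ[nhds t] fun _ => (1 : ℝ) :=
        Filter.eventually_of_mem (Ioi_mem_nhds (not_le.1 ht)) fun s hs => h1 s (le_of_lt hs)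
      rw [he.deriv_eq, deriv_const]

section

variable {ι : Type*}

/-- With these values at the points, the coefficients of a deformation are exactly the displacements
of the points. -/
theorem exists_bumps [Fintype ι] [DecidableEq ι] {v : ι → ℝ} (hv : Function.Injective v) :
    ∃ B : ι → ℝ → ℝ, (∀ k, BoundedC1 (B k)) ∧ ∀ k j, B k (v j) = if k = j then 1 else 0 := by
  have hr : ∃ r > 0, ∀ q : ι × ι, q.1 ≠ q.2 → r < dist (v q.1) (v q.2) := by
    have h : ∀ᶠ r in nhdsWithin (0 : ℝ) (Ioi 0), ∀ q : ι × ι, q.1 ≠ q.2 →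
        r < dist (v q.1) (v q.2) := by
      rw [Filter.eventually_all]
      intro q
      by_cases hq : q.1 = q.2
      · simp [hq]
      · filter_upwards [Ioo_mem_nhdsGT (dist_pos.2 (hv.ne hq))] with r hr _
        exact hr.2
    obtain ⟨r, h1, h2⟩ := (h.and self_mem_nhdsWithin).exists
    exact ⟨r, h2, h1⟩
  obtain ⟨r, hr0, hr⟩ := hr
  let B : (k : ι) → ContDiffBump (v k) := fun k => ⟨r / 2, r, by linarith, by linarith⟩
  refine ⟨fun k => B k, fun k => BoundedC1.of_bounded (a := v k - r) (b := v k + r) (D := 1)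
    (B k).contDiff (fun t => ?_) fun t ht => ?_, fun k j => ?_⟩
  · rw [abs_of_nonneg (B k).nonneg]
    exact (B k).le_one
  · have ht' : r < dist t (v k) := by
      rw [Real.dist_eq]
      by_contra hn
      have := abs_le.1 (not_lt.1 hn)
      exact ht ⟨by linarith, by linarith⟩
    have he : (B k : ℝ → ℝ) =ᶠ[nhds t] fun _ => (0 : ℝ) := by
      have hopen : IsOpen {s | r < dist s (v k)} := isOpen_lt continuous_const (by fun_prop)
      filter_upwards [hopen.mem_nhds ht'] with s hs
      exact (B k).zero_of_le_dist (le_of_lt hs)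
    rw [he.deriv_eq, deriv_const]
  · split_ifs with hkj
    · subst hkj
      exact (B k).one_of_mem_closedBall (Metric.mem_closedBall_self (by positivity))
    · exact (B k).zero_of_le_dist (hr (j, k) (Ne.symm hkj)).le

/-- For small coefficients the perturbation and its derivative are bounded by `1 / 2`. The map is
then strictly increasing and unbounded in both directions. -/
theorem eventually_exists_orderIso [Fintype ι] {B : ι → ℝ → ℝ} (hB : ∀ k, BoundedC1 (B k)) :
    ∀ᶠ d in nhds (0 : ι → ℝ), ∃ f : ℝ ≃o ℝ, ∀ t, f t = t + ∑ k, d k * B k t := by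
  choose hd C hC using hB
  have hlim : Filter.Tendsto (fun d : ι → ℝ => ∑ k, |d k| * C k) (nhds 0) (nhds 0) := by
    have h : Continuous fun d : ι → ℝ => ∑ k, |d k| * C k := by fun_prop
    simpa using h.tendsto 0
  filter_upwards [hlim.eventually (gt_mem_nhds (show (0 : ℝ) < 1 / 2 by norm_num))] with d hsmall
  set f : ℝ → ℝ := fun t => t + ∑ k, d k * B k t
  have hderiv : ∀ t, HasDerivAt f (1 + ∑ k, d k * deriv (B k) t) t := fun t =>
    (hasDerivAt_id t).add (HasDerivAt.fun_sum fun k _ =>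
      ((hd k).differentiable one_ne_zero t).hasDerivAt.const_mul (d k))
  have hbound : ∀ c : ι → ℝ, (∀ k, |c k| ≤ C k) → |∑ k, d k * c k| < 1 / 2 := fun c hc => by
    refine (Finset.abs_sum_le_sum_abs _ _).trans_lt (lt_of_le_of_lt ?_ hsmall)
    refine Finset.sum_le_sum fun k _ => ?_
    rw [abs_mul]
    exact mul_le_mul_of_nonneg_left (hc k) (abs_nonneg _)
  have hmono : StrictMono f := strictMono_of_deriv_pos fun t => by
    rw [(hderiv t).deriv]
    have := abs_lt.1 (hbound (fun k => deriv (B k) t) fun k => by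
      rw [← Real.norm_eq_abs, norm_deriv_eq_norm_fderiv]; exact (hC k t).2)
    linarith
  have hval : ∀ t, |∑ k, d k * B k t| < 1 / 2 := fun t =>
    hbound (fun k => B k t) fun k => (hC k t).1
  have hcont : Continuous f := continuous_iff_continuousAt.2 fun t => (hderiv t).continuousAt
  have hsurj : Function.Surjective f := by
    refine hcont.surjective ?_ ?_
    · refine Filter.tendsto_atTop_mono (fun t => ?_)
        (Filter.tendsto_atTop_add_const_right _ (-(1 / 2) : ℝ) Filter.tendsto_id)
      have := abs_lt.1 (hval t)
      simp only [id, f]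
      linarith
    · refine Filter.tendsto_atBot_mono (fun t => ?_)
        (Filter.tendsto_atBot_add_const_right _ (1 / 2 : ℝ) Filter.tendsto_id)
      have := abs_lt.1 (hval t)
      simp only [id, f]
      linarith
  exact ⟨hmono.orderIsoOfSurjective f hsurj, fun t => rfl⟩

/-- The vector field that moves both coordinates symmetrically. -/
def stairField (B : ι → ℝ → ℝ) (k : ι) (z : ℂ) : ℂ := ⟨B k z.re, -B k (-z.im)⟩

theorem boundedC1_stairField {B : ι → ℝ → ℝ} (hB : ∀ k, BoundedC1 (B k)) (k : ι) :
    BoundedC1 (stairField B k) := by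
  have h := (((hB k).comp_clm Complex.reCLM).smul (BoundedC1.const (1 : ℂ))).add
    (((hB k).comp_clm (-Complex.imCLM)).smul (BoundedC1.const (-Complex.I)))
  have he : (fun z : ℂ => B k (Complex.reCLM z) • (1 : ℂ) +
      B k ((-Complex.imCLM) z) • -Complex.I) = stairField B k := by
    funext z
    exact Complex.ext (by simp [stairField]) (by simp [stairField])
  rwa [he] at h

theorem isDeformation_of_boundedC1 [Fintype ι] {Y : ι → ℂ → ℂ} (hY : ∀ k, BoundedC1 (Y k)) :
    ∃ C, IsDeformation Y C := by
  choose hd C hC using hY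
  refine ⟨∑ k, C k, hd, fun k z => ((hC k z).2).trans ?_⟩
  exact Finset.single_le_sum (f := C) (fun j _ => (norm_nonneg _).trans (hC j 0).1)
    (Finset.mem_univ k)

theorem deform_stairField [Fintype ι] {B : ι → ℝ → ℝ} {d : ι → ℝ} {f : ℝ ≃o ℝ}
    (hf : ∀ t, f t = t + ∑ k, d k * B k t) : deform (stairField B) d = stairMap f := by
  funext z
  apply Complex.ext
  · simp [deform, stairField, hf]
  · simp only [deform, stairField, stairMap_im, hf, Complex.add_im, Complex.im_sum,
      Complex.smul_im, smul_eq_mul, mul_neg, Finset.sum_neg_distrib]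
    ring

end

/-! ### Deformations of orthodisks -/

section

variable {g : ℕ}

/-- The field that moves the nodes away from the outer corner of the lower orthodisk, and moves
this corner along the axis of symmetry. -/
def cornerField (χ : ℝ → ℝ) (B : Option (Fin (g + 1)) → ℝ → ℝ) (k : Option (Fin (g + 1)))
    (z : ℂ) : ℂ :=
  k.elim ((χ z.re * χ (-z.im)) • (1 - Complex.I))
    fun j => (1 - χ z.re * χ (-z.im)) • stairField B (some j) z

theorem boundedC1_cornerField {χ : ℝ → ℝ} (hχ : BoundedC1 χ) {B : Option (Fin (g + 1)) → ℝ → ℝ}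
    (hB : ∀ k, BoundedC1 (B k)) (k : Option (Fin (g + 1))) : BoundedC1 (cornerField χ B k) := by
  have hκ : BoundedC1 fun z : ℂ => χ z.re * χ (-z.im) := by
    have := (hχ.comp_clm Complex.reCLM).smul (hχ.comp_clm (-Complex.imCLM))
    exact this
  cases k with
  | none => exact hκ.smul (BoundedC1.const _)
  | some j =>
    have h := ((BoundedC1.const (E := ℂ) (1 : ℝ)).add ((BoundedC1.const (-1 : ℝ)).smul hκ)).smul
      (boundedC1_stairField hB (some j))
    have he : (fun z : ℂ => (1 + (-1 : ℝ) • (χ z.re * χ (-z.im))) • stairField B (some j) z) =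
        cornerField χ B (some j) := by
      funext z
      simp [cornerField, sub_eq_add_neg]
    rwa [he] at h

/-- The displacements of the nodes of the staircase alone. -/
def innerPart (d : Option (Fin (g + 1)) → ℝ) (k : Option (Fin (g + 1))) : ℝ :=
  k.elim 0 fun j => d (some j)

theorem tendsto_innerPart :
    Filter.Tendsto (innerPart (g := g)) (nhds 0) (nhds 0) := by
  have hc : Continuous (innerPart (g := g)) := by
    refine continuous_pi fun k => ?_
    cases k <;> simp only [innerPart, Option.elim] <;> fun_prop
  have h0 : innerPart (g := g) 0 = 0 := by
    funext k
    cases k <;> rfl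
  simpa [h0] using hc.tendsto 0

theorem deform_cornerField_of_eq_zero {χ : ℝ → ℝ} {B : Option (Fin (g + 1)) → ℝ → ℝ}
    {d : Option (Fin (g + 1)) → ℝ} {z : ℂ} (h : χ z.re * χ (-z.im) = 0) :
    deform (cornerField χ B) d z =
      deform (stairField B) (innerPart d) z := by
  simp [innerPart, deform, cornerField, h, Fintype.sum_option]

theorem deform_cornerField_of_eq_one {χ : ℝ → ℝ} {B : Option (Fin (g + 1)) → ℝ → ℝ}
    {d : Option (Fin (g + 1)) → ℝ} {z : ℂ} (h : χ z.re * χ (-z.im) = 1) :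
    deform (cornerField χ B) d z = z + d none • (1 - Complex.I) := by
  simp [deform, cornerField, h, Fintype.sum_option]

/-- The quadrant that is removed from the region below the staircase. -/
def cornerQuadrant (b : ℝ) : Set ℂ := {z | b ≤ z.re ∧ z.im ≤ -b}

theorem lowerDomain_eq_sdiff (X : ℕ → ℝ) (b : ℝ) :
    lowerDomain g X b = below (stairs g X) \ cornerQuadrant b := by
  ext z
  simp only [lowerDomain, cornerQuadrant, mem_inter_iff, mem_union, mem_sdiff, mem_ofPred_eq,
    not_and_or, not_le]

/-- The domain is a difference of two sets. The image of the region below the staircase is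
determined by that of its complement, because `F` is bijective, and the removed quadrant is
translated along the axis of symmetry. -/
theorem image_lowerDomain {X X' : ℕ → ℝ} {b b' : ℝ} {f : ℝ ≃o ℝ} (hf : ∀ k ≤ g, f (X k) = X' k)
    {F : ℂ → ℂ} (hF : Function.Bijective F)
    (hout : ∀ z ∉ below (stairs g X), F z = stairMap f z)
    (hin : ∀ z ∈ cornerQuadrant b, F z = z + (b' - b) • (1 - Complex.I)) :
    F '' lowerDomain g X b = lowerDomain g X' b' := by
  have hcompl : F '' (below (stairs g X))ᶜ = stairMap f '' (below (stairs g X))ᶜ :=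
    image_congr fun z hz => hout z hz
  have h1 : F '' below (stairs g X) = below (stairs g X') := by
    rw [← compl_inj_iff, ← image_compl_eq hF, hcompl,
      image_compl_eq (stairMap f).bijective, stairMap_image_below, stairMap_image_stairs hf]
  have h2 : F '' cornerQuadrant b = cornerQuadrant b' := by
    rw [image_congr hin]
    ext w
    constructor
    · rintro ⟨z, ⟨hz1, hz2⟩, rfl⟩
      refine ⟨?_, ?_⟩ <;> simp <;> linarith
    · rintro ⟨hw1, hw2⟩
      refine ⟨w - (b' - b) • (1 - Complex.I), ⟨?_, ?_⟩, by simp⟩ <;> simp <;> linarith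
  rw [lowerDomain_eq_sdiff, image_sdiff hF.injective, h1, h2, lowerDomain_eq_sdiff]

/-- The nodes of the staircase, together with the abscissa of the outer boundary of the upper
orthodisk. -/
def nodes (X : ℕ → ℝ) (b : ℝ) (k : Option (Fin (g + 1))) : ℝ := k.elim (-b) fun j => X j

theorem IsStair.nodes_injective {X : ℕ → ℝ} {b : ℝ} (h : IsStair g X b) (hg : 1 ≤ g) :
    Function.Injective (nodes (g := g) X b) := by
  have hb := h.pos hg
  have h0 : ∀ j : Fin (g + 1), 0 ≤ X j := fun j => h.nonneg (Nat.lt_succ_iff.1 j.2)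
  rintro (_ | i) (_ | j) hij
  · rfl
  · simp only [nodes, Option.elim] at hij
    linarith [h0 j]
  · simp only [nodes, Option.elim] at hij
    linarith [h0 i]
  · congr 1
    exact Fin.ext (h.strictMonoOn.injOn (mem_Iic.2 (Nat.lt_succ_iff.1 i.2))
      (mem_Iic.2 (Nat.lt_succ_iff.1 j.2)) hij)

theorem analyticAt_displacement (s : ℝ) (p₀ : (Fin g → ℝ) × ℝ) :
    AnalyticAt ℝ (fun p (k : Option (Fin (g + 1))) =>
      k.elim (s * (p.2 - p₀.2)) fun j => node p j - node p₀ j) p₀ := by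
  rw [analyticAt_pi_iff]
  rintro (_ | j)
  · exact analyticAt_const.mul (analyticAt_snd.sub analyticAt_const)
  · exact (analyticAt_node j p₀).sub analyticAt_const

theorem displacement_self (s : ℝ) (p₀ : (Fin g → ℝ) × ℝ) :
    (fun k : Option (Fin (g + 1)) => k.elim (s * (p₀.2 - p₀.2)) fun j => node p₀ j - node p₀ j) =
      0 := by
  funext k
  cases k <;> simp

theorem eventually_of_displacement (s : ℝ) (p₀ : (Fin g → ℝ) × ℝ)
    {P : (Option (Fin (g + 1)) → ℝ) → Prop} (hP : ∀ᶠ d in nhds 0, P d) :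
    ∀ᶠ p in nhds p₀, P (fun k => k.elim (s * (p.2 - p₀.2)) fun j => node p j - node p₀ j) := by
  have hc := (analyticAt_displacement s p₀).continuousAt.tendsto
  rw [displacement_self] at hc
  exact hc.eventually hP

/-- Near `p₀`, the domains `Ω p` and the edges are images of those for `p₀` under deformations
that depend analytically on `p`. -/
def IsDeformable (Ω : (Fin g → ℝ) × ℝ → Set ℂ) (p₀ : (Fin g → ℝ) × ℝ) : Prop :=
  ∃ (Y : Option (Fin (g + 1)) → ℂ → ℂ) (C : ℝ)
    (x : (Fin g → ℝ) × ℝ → Option (Fin (g + 1)) → ℝ), IsDeformation Y C ∧ AnalyticAt ℝ x p₀ ∧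
    x p₀ = 0 ∧ ∀ᶠ p in nhds p₀, deform Y (x p) '' Ω p₀ = Ω p ∧
      ∀ j ≤ 2 * g + 1, deform Y (x p) '' edge p₀ j = edge p j

/-- The outer abscissa `-b` is negative and the nodes are not, so a single map of the line can move
all of them independently. -/
theorem isDeformable_upperOrthodisk (hg : 1 ≤ g) {p₀ : (Fin g → ℝ) × ℝ} (hp₀ : p₀ ∈ Delta g) :
    IsDeformable upperOrthodisk p₀ := by
  have h := isStair_node hp₀
  obtain ⟨B, hB, hBv⟩ := exists_bumps (h.nodes_injective hg)
  obtain ⟨C, hY⟩ := isDeformation_of_boundedC1 (boundedC1_stairField hB)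
  -- The factor `-1` appears because the point moved is `-b`.
  refine ⟨stairField B, C, _, hY, analyticAt_displacement (-1) p₀, displacement_self _ _, ?_⟩
  filter_upwards [eventually_of_displacement (-1) p₀ (eventually_exists_orderIso hB),
    (isOpen_Delta g).mem_nhds hp₀] with p ⟨f, hf⟩ hp
  have hfv : ∀ k : Option (Fin (g + 1)),
      f (nodes (node p₀) p₀.2 k) = nodes (node p) p.2 k := fun k => by
    rw [hf]
    simp only [hBv, mul_ite, mul_one, mul_zero, Finset.sum_ite_eq', Finset.mem_univ, if_true]
    cases k with
    | none => simp only [nodes, Option.elim]; ring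
    | some j => simp [nodes]
  have hfX : ∀ k ≤ g, f (node p₀ k) = node p k := fun k hk =>
    hfv (some ⟨k, Nat.lt_succ_of_le hk⟩)
  rw [deform_stairField hf, upperOrthodisk_eq hp₀, upperOrthodisk_eq hp]
  exact ⟨stairMap_image_upperDomain hfX (hfv none), fun j hj => stairMap_image_edge hp₀ hp hfX hj⟩

/-- Since `b` may equal a node, the outer corner is moved by a separate field, which is cut off
inside the region below the staircase. On the staircase itself the deformation is still of product
form. -/
theorem isDeformable_lowerOrthodisk (hg : 1 ≤ g) {p₀ : (Fin g → ℝ) × ℝ} (hp₀ : p₀ ∈ Delta g) :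
    IsDeformable lowerOrthodisk p₀ := by
  have h := isStair_node hp₀
  obtain ⟨B, hB, hBv⟩ := exists_bumps (h.nodes_injective hg)
  -- The cutoff lives where `x > m` and `-y > m`. As `m > c` this lies below the staircase, and as
  -- `m < b` the cutoff can equal 1 on the removed quadrant.
  obtain ⟨m, hcm, hmb⟩ := exists_between h.lt
  obtain ⟨χ, hχ, hχ0, hχ1⟩ := exists_cutoff hmb
  obtain ⟨C, hY⟩ := isDeformation_of_boundedC1 (boundedC1_cornerField hχ hB)
  have hcut : ∀ z ∉ below (stairs g (node p₀)), χ z.re * χ (-z.im) = 0 := by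
    intro z hz
    by_contra hne
    obtain ⟨h1, h2⟩ := mul_ne_zero_iff.1 hne
    have h1' : m < z.re := not_le.1 fun hle => h1 (hχ0 _ hle)
    have h2' : m < -z.im := not_le.1 fun hle => h2 (hχ0 _ hle)
    obtain ⟨w, hw, hw1, hw2⟩ := h.exists_mem_stairs_near_center hg hcm
    exact hz ⟨w, hw, by linarith, by linarith⟩
  refine ⟨cornerField χ B, C, _, hY, analyticAt_displacement 1 p₀, displacement_self _ _, ?_⟩
  have hzero : ∀ᶠ d in nhds (0 : Option (Fin (g + 1)) → ℝ), ∃ f : ℝ ≃o ℝ, ∀ t, f t =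
      t + ∑ k, innerPart d k * B k t :=
    tendsto_innerPart.eventually (eventually_exists_orderIso hB)
  filter_upwards [eventually_of_displacement 1 p₀ hzero,
    eventually_of_displacement 1 p₀ (eventually_norm_fderiv_deform hY),
    (isOpen_Delta g).mem_nhds hp₀] with p ⟨f, hf⟩ hsmall hp
  obtain ⟨G, hG⟩ := exists_isDiffeoPair (contDiff_deform hY _) fun z =>
    (hsmall z).trans (by norm_num)
  have hfX : ∀ k ≤ g, f (node p₀ k) = node p k := fun k hk => by
    have hn : node p₀ k = nodes (g := g) (node p₀) p₀.2 (some ⟨k, Nat.lt_succ_of_le hk⟩) := rfl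
    rw [hf, hn]
    simp only [hBv, mul_ite, mul_one, mul_zero, Finset.sum_ite_eq', Finset.mem_univ, if_true]
    simp [nodes, innerPart]
  have hout : ∀ z ∉ below (stairs g (node p₀)), deform (cornerField χ B) _ z = stairMap f z :=
    fun z hz => (deform_cornerField_of_eq_zero (hcut z hz)).trans
      (congrFun (deform_stairField hf) z)
  refine ⟨?_, fun j hj => ?_⟩
  · rw [lowerOrthodisk_eq hp₀, lowerOrthodisk_eq hp]
    refine image_lowerDomain hfX ⟨hG.left_inv.injective, hG.right_inv.surjective⟩ hout
      fun z hz => ?_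
    rw [deform_cornerField_of_eq_one (by
      rw [hχ1 _ hz.1, hχ1 _ (by linarith [hz.2]), one_mul])]
    simp
  · rw [← stairMap_image_edge hp₀ hp hfX hj]
    exact image_congr fun z hz =>
      hout z (h.stairs_subset_compl_below (edge_subset_stairs hp₀ hj hz))

end

end Scherk
end



noncomputable section

namespace Scherk

/-! ### Homotheties -/

theorem fderiv_real_smul (s : ℝ) (z : ℂ) :
    fderiv ℝ (fun z : ℂ => s • z) z = s • ContinuousLinearMap.id ℝ ℂ :=
  HasFDerivAt.fderiv ((hasFDerivAt_id (𝕜 := ℝ) z).const_smul s)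

theorem isDiffeoPair_smul {r : ℝ} (hr : 0 < r) :
    IsDiffeoPair (fun z => r • z) (fun z => r⁻¹ • z) (max r r⁻¹).toNNReal := by
  have hd : ∀ (s : ℝ) (z : ℂ), 0 < s → ‖fderiv ℝ (fun z : ℂ => s • z) z‖ ≤ s := by
    intro s z hs
    rw [fderiv_real_smul, norm_smul, Real.norm_of_nonneg hs.le]
    exact mul_le_of_le_one_right hs.le ContinuousLinearMap.norm_id_le
  refine ⟨by fun_prop, by fun_prop, fun z => by simp [hr.ne'],
    fun z => by simp [hr.ne'], fun z => ?_, fun z => ?_⟩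
  · exact (hd r z hr).trans ((le_max_left _ _).trans (Real.le_coe_toNNReal _))
  · exact (hd r⁻¹ z (inv_pos.2 hr)).trans ((le_max_right _ _).trans (Real.le_coe_toNNReal _))

section

variable {Ω A B : Set ℂ}

/-- Conformal invariance of the energy: the Jacobian `r ^ 2` cancels the square of the factor `r` in
the gradient. -/
theorem area_gradNorm_comp_smul (hΩ : MeasurableSet Ω) {r : ℝ} (hr : 0 < r) (u : ℂ → ℝ) :
    area (gradNorm fun z => u (r • z)) Ω = area (gradNorm u) ((fun z => r • z) '' Ω) := by
  rw [area, area, (isDiffeoPair_smul hr).lintegral_image hΩ]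
  refine lintegral_congr fun z => ?_
  have hdet : (fderiv ℝ (fun z : ℂ => r • z) z).det = r ^ 2 := by
    rw [fderiv_real_smul, det_eq]
    simp [sq]
  have hg : gradNorm (fun z => u (r • z)) z = ‖r‖₊ * gradNorm u (r • z) := by
    rw [gradNorm, gradNorm, ← nnnorm_smul]
    congr 1
    exact fderiv_comp_smul r
  rw [hdet, hg, abs_of_nonneg (sq_nonneg r), ENNReal.ofReal_pow hr.le, ENNReal.coe_mul, mul_pow,
    ← Real.enorm_eq_ofReal hr.le, enorm_eq_nnnorm]

theorem minEnergy_smul (hΩ : IsOpen Ω) {r : ℝ} (hr : 0 < r) :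
    minEnergy ((fun z => r • z) '' Ω) ((fun z => r • z) '' A) ((fun z => r • z) '' B) =
      minEnergy Ω A B := by
  have h := isDiffeoPair_smul hr
  refine le_antisymm (le_iInf₂ fun u hu => ?_) (le_iInf₂ fun u hu => ?_)
  · refine (iInf₂_le _ (h.isPotential_comp_inv hΩ hu)).trans_eq ?_
    rw [← area_gradNorm_comp_smul hΩ.measurableSet hr]
    simp [hr.ne']
  · refine (iInf₂_le _ (h.isPotential_comp hΩ hu)).trans_eq ?_
    exact area_gradNorm_comp_smul hΩ.measurableSet hr u

end

theorem stairMap_mulLeft {r : ℝ} (hr : 0 < r) :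
    (stairMap (OrderIso.mulLeft₀ r hr) : ℂ → ℂ) = fun z => r • z := by
  funext z
  apply Complex.ext <;> simp

/-! ### Families of orthodisks -/

section

variable {g : ℕ}

/-- The properties shared by the upper and lower orthodisks. -/
structure IsOrthodisk (Ω : (Fin g → ℝ) × ℝ → Set ℂ) : Prop where
  isOpen : ∀ p ∈ Delta g, IsOpen (Ω p)
  nonempty : ∀ p ∈ Delta g, (Ω p).Nonempty
  stairs_subset : ∀ p ∈ Delta g, stairs g (node p) ⊆ (Ω p)ᶜ
  mapsTo_reflect : ∀ p ∈ Delta g, MapsTo reflect (Ω p) (Ω p)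
  isBounded : ∀ p ∈ Delta g, ∀ M, Bornology.IsBounded (Ω p ∩ {z | |z.re + z.im| ≤ M})
  extremalLength_lt_top : ∀ p ∈ Delta g, ∀ k < g, ∀ A B, vEdge g (node p) k ⊆ A →
    vEdge g (node p) (k + 1) ⊆ B → extremalLength (Ω p) (singletons (arcsJoining (Ω p) A B)) < ∞
  extremalLength_ends_lt_top : ∀ p ∈ Delta g, ∀ A B, vEdge g (node p) 0 ⊆ A →
    hEdge g (node p) g ⊆ B → extremalLength (Ω p) (singletons (arcsJoining (Ω p) A B)) < ∞
  isDeformable : ∀ p ∈ Delta g, IsDeformable Ω p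
  smul : ∀ p ∈ Delta g, ∀ r : ℝ, 0 < r → Ω (r • p) = (fun z => r • z) '' Ω p

theorem isOrthodisk_upperOrthodisk (hg : 1 ≤ g) : IsOrthodisk (upperOrthodisk (g := g)) where
  isOpen p hp := by rw [upperOrthodisk_eq hp]; exact isOpen_upperDomain _ _ _
  nonempty p hp := by rw [upperOrthodisk_eq hp]; exact (isStair_node hp).upperDomain_nonempty hg
  stairs_subset p hp := by
    rw [upperOrthodisk_eq hp]; exact (isStair_node hp).stairs_subset_compl_upperDomain
  mapsTo_reflect p hp := by rw [upperOrthodisk_eq hp]; exact mapsTo_reflect_upperDomain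
  isBounded p hp := by
    rw [upperOrthodisk_eq hp]; exact (isStair_node hp).isBounded_upperDomain hg
  extremalLength_lt_top p hp k hk A B hA hB := by
    rw [upperOrthodisk_eq hp]; exact (isStair_node hp).extremalLength_upper_lt_top hg hk hA hB
  extremalLength_ends_lt_top p hp A B hA hB := by
    rw [upperOrthodisk_eq hp]; exact (isStair_node hp).extremalLength_upper_ends_lt_top hg hA hB
  isDeformable p hp := isDeformable_upperOrthodisk hg hp
  smul p hp r hr := by
    rw [upperOrthodisk_eq hp, upperOrthodisk_eq (smul_mem_Delta hp hr), ← stairMap_mulLeft hr]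
    exact (stairMap_image_upperDomain (fun k _ => by simp [node_smul]) (by simp)).symm

theorem isOrthodisk_lowerOrthodisk (hg : 1 ≤ g) : IsOrthodisk (lowerOrthodisk (g := g)) where
  isOpen p hp := by rw [lowerOrthodisk_eq hp]; exact isOpen_lowerDomain _ _ _
  nonempty p hp := by rw [lowerOrthodisk_eq hp]; exact (isStair_node hp).lowerDomain_nonempty hg
  stairs_subset p hp := by
    rw [lowerOrthodisk_eq hp]; exact (isStair_node hp).stairs_subset_compl_lowerDomain
  mapsTo_reflect p hp := by rw [lowerOrthodisk_eq hp]; exact mapsTo_reflect_lowerDomain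
  isBounded p hp := by
    rw [lowerOrthodisk_eq hp]; exact (isStair_node hp).isBounded_lowerDomain hg
  extremalLength_lt_top p hp k hk A B hA hB := by
    rw [lowerOrthodisk_eq hp]; exact (isStair_node hp).extremalLength_lower_lt_top hg hk hA hB
  extremalLength_ends_lt_top p hp A B hA hB := by
    rw [lowerOrthodisk_eq hp]; exact (isStair_node hp).extremalLength_lower_ends_lt_top hg hA hB
  isDeformable p hp := isDeformable_lowerOrthodisk hg hp
  smul p hp r hr := by
    rw [lowerOrthodisk_eq hp, lowerOrthodisk_eq (smul_mem_Delta hp hr), ← stairMap_mulLeft hr]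
    exact (stairMap_image_lowerDomain (fun k _ => by simp [node_smul]) (by simp)).symm

theorem isOrthodisk_OmegaGdh (hg : 1 ≤ g) : IsOrthodisk (OmegaGdh (g := g)) := by
  by_cases h : Even g
  · rw [show (OmegaGdh (g := g)) = upperOrthodisk from funext fun p => if_pos h]
    exact isOrthodisk_upperOrthodisk hg
  · rw [show (OmegaGdh (g := g)) = lowerOrthodisk from funext fun p => if_neg h]
    exact isOrthodisk_lowerOrthodisk hg

theorem isOrthodisk_OmegaInvGdh (hg : 1 ≤ g) : IsOrthodisk (OmegaInvGdh (g := g)) := by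
  by_cases h : Even g
  · rw [show (OmegaInvGdh (g := g)) = lowerOrthodisk from funext fun p => if_pos h]
    exact isOrthodisk_lowerOrthodisk hg
  · rw [show (OmegaInvGdh (g := g)) = upperOrthodisk from funext fun p => if_neg h]
    exact isOrthodisk_upperOrthodisk hg

/-- A union of edges. -/
def edges (p : (Fin g → ℝ) × ℝ) (S : Set ℕ) : Set ℂ := ⋃ j ∈ S, edge p j

theorem edges_subset_stairs {p : (Fin g → ℝ) × ℝ} (hp : p ∈ Delta g) {S : Set ℕ}
    (hS : S ⊆ Iic (2 * g + 1)) : edges p S ⊆ stairs g (node p) :=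
  iUnion₂_subset fun _ hj => edge_subset_stairs hp (hS hj)

theorem image_edges {p q : (Fin g → ℝ) × ℝ} {S : Set ℕ} (hS : S ⊆ Iic (2 * g + 1)) {F : ℂ → ℂ}
    (hF : ∀ j ≤ 2 * g + 1, F '' edge p j = edge q j) : F '' edges p S = edges q S := by
  rw [edges, edges, image_iUnion₂]
  exact iUnion₂_congr fun j hj => hF j (hS hj)

theorem edges_pair (p : (Fin g → ℝ) × ℝ) (i j : ℕ) : edges p {i, j} = edge p i ∪ edge p j := by
  simp [edges]

/-- A cycle whose extremal length is a multiple of that of the arcs joining two unions of edges. -/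
structure IsReduction (c : List (ℕ × ℕ)) (S T : Set ℕ) (κ : ℝ≥0)
    (Ω : (Fin g → ℝ) × ℝ → Set ℂ) : Prop where
  left_subset : S ⊆ Iic (2 * g + 1)
  right_subset : T ⊆ Iic (2 * g + 1)
  pos : 0 < κ
  eq_mul : ∀ p ∈ Delta g, extremalLength (Ω p) (cycleClass p (Ω p) c) =
    κ * extremalLength (Ω p) (singletons (arcsJoining (Ω p) (edges p S) (edges p T)))
  lt_top : ∀ p ∈ Delta g,
    extremalLength (Ω p) (singletons (arcsJoining (Ω p) (edges p S) (edges p T))) < ∞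
  exists_isPotential : ∀ p ∈ Delta g, ∃ u, IsPotential (Ω p) (edges p S) (edges p T) 1 u

namespace IsReduction

variable {c : List (ℕ × ℕ)} {S T : Set ℕ} {κ : ℝ≥0} {Ω : (Fin g → ℝ) × ℝ → Set ℂ}

theorem eq_inv_minEnergy (h : IsReduction c S T κ Ω) (hΩ : IsOrthodisk Ω)
    {p : (Fin g → ℝ) × ℝ} (hp : p ∈ Delta g) :
    extremalLength (Ω p) (cycleClass p (Ω p) c) =
      κ * (minEnergy (Ω p) (edges p S) (edges p T))⁻¹ := by
  rw [h.eq_mul p hp, extremalLength_eq_inv_minEnergy (hΩ.isOpen p hp) (hΩ.nonempty p hp)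
    ((edges_subset_stairs hp h.left_subset).trans (hΩ.stairs_subset p hp))
    ((edges_subset_stairs hp h.right_subset).trans (hΩ.stairs_subset p hp))]

theorem minEnergy_pos (h : IsReduction c S T κ Ω) (hΩ : IsOrthodisk Ω)
    {p : (Fin g → ℝ) × ℝ} (hp : p ∈ Delta g) :
    0 < minEnergy (Ω p) (edges p S) (edges p T) := by
  have hlt := h.lt_top p hp
  rw [extremalLength_eq_inv_minEnergy (hΩ.isOpen p hp) (hΩ.nonempty p hp)
    ((edges_subset_stairs hp h.left_subset).trans (hΩ.stairs_subset p hp))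
    ((edges_subset_stairs hp h.right_subset).trans (hΩ.stairs_subset p hp))] at hlt
  exact ENNReal.inv_lt_top.1 hlt

theorem minEnergy_lt_top (h : IsReduction c S T κ Ω) {p : (Fin g → ℝ) × ℝ} (hp : p ∈ Delta g) :
    minEnergy (Ω p) (edges p S) (edges p T) < ∞ := by
  obtain ⟨u, hu⟩ := h.exists_isPotential p hp
  exact (iInf₂_le u hu).trans_lt hu.area_lt_top

/-- Positivity comes from a potential of finite energy, finiteness from the sweeps. -/
theorem pos_and_lt_top (h : IsReduction c S T κ Ω) (hΩ : IsOrthodisk Ω)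
    {p : (Fin g → ℝ) × ℝ} (hp : p ∈ Delta g) :
    0 < extremalLength (Ω p) (cycleClass p (Ω p) c) ∧
      extremalLength (Ω p) (cycleClass p (Ω p) c) < ∞ := by
  rw [h.eq_inv_minEnergy hΩ hp]
  refine ⟨ENNReal.mul_pos (by simpa using h.pos.ne') ?_, ENNReal.mul_lt_top (by simp) ?_⟩
  · exact ENNReal.inv_ne_zero.2 (h.minEnergy_lt_top hp).ne
  · exact ENNReal.inv_lt_top.2 (h.minEnergy_pos hΩ hp)

theorem smul (h : IsReduction c S T κ Ω) (hΩ : IsOrthodisk Ω)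
    {p : (Fin g → ℝ) × ℝ} (hp : p ∈ Delta g) {r : ℝ} (hr : 0 < r) :
    extremalLength (Ω (r • p)) (cycleClass (r • p) (Ω (r • p)) c) =
      extremalLength (Ω p) (cycleClass p (Ω p) c) := by
  have hp' := smul_mem_Delta hp hr
  have hF : ∀ j ≤ 2 * g + 1, (fun z : ℂ => r • z) '' edge p j = edge (r • p) j := fun j hj => by
    rw [← stairMap_mulLeft hr]
    exact stairMap_image_edge hp hp' (fun k _ => by simp [node_smul]) hj
  rw [h.eq_inv_minEnergy hΩ hp', h.eq_inv_minEnergy hΩ hp, hΩ.smul p hp r hr,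
    ← image_edges h.left_subset hF, ← image_edges h.right_subset hF,
    minEnergy_smul (hΩ.isOpen p hp) hr]

/-- The least energy is an analytic function of the deformation coefficients, which are analytic in
the parameters. It is positive at `p₀`, so its reciprocal is analytic as well. -/
theorem analyticAt (h : IsReduction c S T κ Ω) (hΩ : IsOrthodisk Ω)
    {p₀ : (Fin g → ℝ) × ℝ} (hp₀ : p₀ ∈ Delta g) :
    AnalyticAt ℝ (fun p => (extremalLength (Ω p) (cycleClass p (Ω p) c)).toReal) p₀ := by
  obtain ⟨Y, C, x, hY, hx, hx0, hdef⟩ := hΩ.isDeformable p₀ hp₀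
  obtain ⟨u, hu⟩ := h.exists_isPotential p₀ hp₀
  obtain ⟨Λ, hΛ, hmin⟩ := exists_analyticAt_minEnergy (hΩ.isOpen p₀ hp₀) hY hu
  rw [← hx0] at hΛ hmin
  have hE : AnalyticAt ℝ (fun p => Λ (x p)) p₀ := hΛ.comp hx
  have hev : ∀ᶠ p in nhds p₀,
      minEnergy (Ω p) (edges p S) (edges p T) = ENNReal.ofReal (Λ (x p)) := by
    filter_upwards [hx.continuousAt.eventually hmin, hdef] with p h1 h2
    rwa [h2.1, image_edges h.left_subset h2.2, image_edges h.right_subset h2.2] at h1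
  have hpos : 0 < Λ (x p₀) := by
    have := h.minEnergy_pos hΩ hp₀
    rwa [hev.self_of_nhds, ENNReal.ofReal_pos] at this
  have hanal : AnalyticAt ℝ (fun p => (κ : ℝ) * (Λ (x p))⁻¹) p₀ :=
    analyticAt_const.mul (hE.inv hpos.ne')
  refine hanal.congr ?_
  filter_upwards [hev, (isOpen_Delta g).mem_nhds hp₀,
    hE.continuousAt.eventually (lt_mem_nhds hpos)] with p h1 h2 h3
  rw [h.eq_inv_minEnergy hΩ h2, h1, ENNReal.toReal_mul, ENNReal.toReal_inv,
    ENNReal.toReal_ofReal h3.le, ENNReal.coe_toReal]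

end IsReduction

/-! ### The cycles `δ` and `γ_i` -/

theorem diagonal_succ (p : (Fin g → ℝ) × ℝ) (j : ℕ) :
    (vertex p (j + 1)).re + (vertex p (j + 1)).im =
      (vertex p j).re + (vertex p j).im + segLength p j := by
  rw [vertex_succ_re, vertex_succ_im]
  split_ifs <;> ring

theorem diagonal_monotone {p : (Fin g → ℝ) × ℝ} (hp : p ∈ Delta g) {i j : ℕ} (hij : i ≤ j)
    (hj : j ≤ 2 * g) : (vertex p i).re + (vertex p i).im ≤ (vertex p j).re + (vertex p j).im := by
  induction j, hij using Nat.le_induction with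
  | base => exact le_rfl
  | succ j hij ih =>
    rw [diagonal_succ]
    linarith [ih (by omega), segLength_pos p hp.1 (show j < 2 * g by omega)]

theorem diagonal_center (p : (Fin g → ℝ) × ℝ) : (vertex p g).re + (vertex p g).im = 0 := by
  rw [vertex_im p (by omega), show 2 * g - g = g by omega, add_neg_cancel]

theorem diagonal_le_of_mem_edge {p : (Fin g → ℝ) × ℝ} (hp : p ∈ Delta g) {j : ℕ}
    (hj : j ≤ 2 * g) {z : ℂ} (hz : z ∈ edge p j) :
    z.re + z.im ≤ (vertex p j).re + (vertex p j).im := by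
  rcases Nat.eq_zero_or_pos j with rfl | hj0
  · rw [edge, if_pos rfl] at hz
    rw [vertex_zero]
    have := hz.1
    have := hz.2
    simp only
    linarith
  · rw [edge, if_neg hj0.ne', if_pos hj] at hz
    obtain ⟨s, t, hs, ht, hst, rfl⟩ := hz
    have := diagonal_monotone hp (Nat.sub_le j 1) hj
    simp only [Complex.add_re, Complex.add_im, Complex.smul_re, Complex.smul_im, smul_eq_mul]
    have hs' : t = 1 - s := by linarith
    subst hs'
    nlinarith

theorem le_diagonal_of_mem_edge {p : (Fin g → ℝ) × ℝ} (hp : p ∈ Delta g) {j : ℕ}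
    (hj : j + 1 ≤ 2 * g) {z : ℂ} (hz : z ∈ edge p (j + 1)) :
    (vertex p j).re + (vertex p j).im ≤ z.re + z.im := by
  rw [edge, if_neg (Nat.succ_ne_zero j), if_pos hj, Nat.add_sub_cancel] at hz
  obtain ⟨s, t, hs, ht, hst, rfl⟩ := hz
  have := diagonal_monotone hp (Nat.le_succ j) hj
  simp only [Complex.add_re, Complex.add_im, Complex.smul_re, Complex.smul_im, smul_eq_mul]
  have hs' : s = 1 - t := by linarith
  subst hs'
  nlinarith

theorem isReduction_cycleDelta (hg : 1 ≤ g) {Ω : (Fin g → ℝ) × ℝ → Set ℂ} (hΩ : IsOrthodisk Ω) :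
    IsReduction (cycleDelta g) {0} {2 * g + 1} 1 Ω where
  left_subset := by simp
  right_subset := by simp
  pos := one_pos
  eq_mul p hp := by
    rw [ENNReal.coe_one, one_mul]
    congr 1
    ext L
    simp only [cycleClass, cycleDelta, singletons, mem_ofPred_eq, edges, mem_singleton_iff,
      iUnion_iUnion_eq_left]
    constructor
    · intro h
      cases h with
      | cons h1 h2 => cases h2; exact ⟨_, h1, rfl⟩
    · rintro ⟨α, hα, rfl⟩
      exact List.Forall₂.cons hα List.Forall₂.nil
  lt_top p hp := hΩ.extremalLength_ends_lt_top p hp _ _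
    (by rw [← edge_even hp (Nat.zero_le g)]; simp [edges])
    (by rw [← edge_odd hp le_rfl]; simp [edges])
  exists_isPotential p hp := by
    have ha : 0 < cornerDist p := by
      rw [← node_last, ← node_zero p]
      exact (isStair_node hp).lt_of_lt (by omega) le_rfl
    refine exists_isPotential_of_separated ha (hΩ.isBounded p hp _) (fun z hz => ?_) fun z hz => ?_
    · simp only [edges, mem_singleton_iff, iUnion_iUnion_eq_left, edge, if_true] at hz
      linarith [hz.1, hz.2]
    · simp only [edges, mem_singleton_iff, iUnion_iUnion_eq_left] at hz
      rw [edge, if_neg (by omega), if_neg (by omega)] at hz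
      linarith [hz.1, hz.2]

/-- For `i ≤ g - 1` both edges lie where `x + y < 0`, so they are separated from their mirror images
by the axis. The values of `|x + y|` on the two symmetric unions are separated by the segment that
the cycle encircles. -/
theorem isReduction_cycleGamma {i : ℕ} (hi : i ∈ Finset.Icc 1 (g - 1))
    {Ω : (Fin g → ℝ) × ℝ → Set ℂ} (hΩ : IsOrthodisk Ω) :
    IsReduction (cycleGamma g i) {i - 1, 2 * g + 1 - (i - 1)} {i + 1, 2 * g + 1 - (i + 1)} 4 Ω := by
  rw [Finset.mem_Icc] at hi
  have hS : ∀ p ∈ Delta g, edges p {i - 1, 2 * g + 1 - (i - 1)} =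
      edge p (i - 1) ∪ reflect '' edge p (i - 1) := fun p hp => by
    rw [edges_pair, reflect_image_edge hp (by omega)]
  have hT : ∀ p ∈ Delta g, edges p {i + 1, 2 * g + 1 - (i + 1)} =
      edge p (i + 1) ∪ reflect '' edge p (i + 1) := fun p hp => by
    rw [edges_pair, reflect_image_edge hp (by omega)]
  have hneg : ∀ p ∈ Delta g, (vertex p (i - 1)).re + (vertex p (i - 1)).im <
      (vertex p i).re + (vertex p i).im ∧ (vertex p i).re + (vertex p i).im < 0 := fun p hp => by
    have h1 := diagonal_succ p (i - 1)
    rw [show i - 1 + 1 = i by omega] at h1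
    have h2 := diagonal_monotone hp (show i + 1 ≤ g by omega) (by omega)
    rw [diagonal_center, diagonal_succ] at h2
    exact ⟨by linarith [segLength_pos p hp.1 (show i - 1 < 2 * g by omega)],
      by linarith [segLength_pos p hp.1 (show i < 2 * g by omega)]⟩
  have hA : ∀ p ∈ Delta g, ∀ z ∈ edge p (i - 1),
      z.re + z.im ≤ (vertex p (i - 1)).re + (vertex p (i - 1)).im := fun p hp z hz =>
    diagonal_le_of_mem_edge hp (by omega) hz
  have hB : ∀ p ∈ Delta g, ∀ z ∈ edge p (i + 1),
      (vertex p i).re + (vertex p i).im ≤ z.re + z.im ∧ z.re + z.im < 0 := fun p hp z hz => by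
    refine ⟨le_diagonal_of_mem_edge hp (by omega) hz, ?_⟩
    rw [edge, if_neg (by omega), if_pos (by omega), Nat.add_sub_cancel] at hz
    obtain ⟨s, t, hs, ht, hst, rfl⟩ := hz
    have h1 := (hneg p hp).2
    have h2 := diagonal_monotone hp (show i + 1 ≤ g by omega) (by omega)
    rw [diagonal_center] at h2
    simp only [Complex.add_re, Complex.add_im, Complex.smul_re, Complex.smul_im, smul_eq_mul]
    nlinarith
  refine ⟨?_, ?_, by norm_num, fun p hp => ?_, fun p hp => ?_, fun p hp => ?_⟩
  · rintro j (rfl | rfl) <;> simp only [mem_Iic] <;> omega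
  · rintro j (rfl | rfl) <;> simp only [mem_Iic] <;> omega
  · rw [hS p hp, hT p hp, ENNReal.coe_ofNat, ← extremalLength_mirrorPairs
      (hΩ.isOpen p hp).measurableSet (hΩ.mapsTo_reflect p hp)
      (fun z hz => by linarith [hA p hp z hz, (hneg p hp).1, (hneg p hp).2])
      fun z hz => (hB p hp z hz).2]
    congr 1
    ext L
    rw [mirrorPairs, reflect_image_edge hp (by omega), reflect_image_edge hp (by omega),
      show 2 * g + 1 - (i + 1) = 2 * g + 1 - i - 1 by omega,
      show 2 * g + 1 - (i - 1) = 2 * g + 1 - i + 1 by omega]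
    constructor
    · intro h
      cases h with
      | cons h1 h2 =>
        cases h2 with
        | cons h3 h4 => cases h4; exact ⟨_, h1, _, h3, rfl⟩
    · rintro ⟨α, hα, β, hβ, rfl⟩
      exact List.Forall₂.cons hα (List.Forall₂.cons hβ List.Forall₂.nil)
  -- The sweeps join consecutive vertical edges. For odd `i` these are the given edges; for even `i`
  -- they are the mirror images, which come in the opposite order. One pair of edges in the unions
  -- suffices for an upper bound.
  · rcases Nat.even_or_odd' i with ⟨k, rfl | rfl⟩
    · rw [extremalLength_singletons_comm]
      refine hΩ.extremalLength_lt_top p hp (g - k) (by omega) _ _ ?_ ?_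
      · rw [← edge_even hp (by omega), edges_pair,
          show 2 * g + 1 - (2 * k + 1) = 2 * (g - k) by omega]
        exact subset_union_right
      · rw [← edge_even hp (by omega), edges_pair,
          show 2 * g + 1 - (2 * k - 1) = 2 * (g - k + 1) by omega]
        exact subset_union_right
    · refine hΩ.extremalLength_lt_top p hp k (by omega) _ _ ?_ ?_
      · rw [← edge_even hp (by omega), edges_pair, show 2 * k + 1 - 1 = 2 * k by omega]
        exact subset_union_left
      · rw [← edge_even hp (by omega), edges_pair, show 2 * k + 1 + 1 = 2 * (k + 1) by omega]
        exact subset_union_left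
  · obtain ⟨h1, h2⟩ := hneg p hp
    rw [hS p hp, hT p hp]
    refine exists_isPotential_of_abs (neg_nonneg.2 h2.le) (neg_lt_neg h1) (hΩ.isBounded p hp _)
      ?_ ?_
    · rintro z (hz | hz)
      · linarith [hA p hp z hz, neg_le_abs (z.re + z.im)]
      · have := hA p hp _ (mem_reflect_image.1 hz)
        simp only [reflect_re, reflect_im] at this
        linarith [le_abs_self (z.re + z.im)]
    · rintro z (hz | hz)
      · have := hB p hp z hz
        exact abs_le.2 ⟨by linarith [this.1], by linarith [this.2]⟩
      · have := hB p hp _ (mem_reflect_image.1 hz)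
        simp only [reflect_re, reflect_im] at this
        exact abs_le.2 ⟨by linarith [this.2], by linarith [this.1]⟩

theorem exists_isReduction (hg : 1 ≤ g) {c : List (ℕ × ℕ)} (hc : c ∈ chosenCycles g)
    {Ω : (Fin g → ℝ) × ℝ → Set ℂ} (hΩ : IsOrthodisk Ω) :
    ∃ S T κ, IsReduction c S T κ Ω := by
  rcases hc with rfl | ⟨i, hi, rfl⟩
  · exact ⟨_, _, _, isReduction_cycleDelta hg hΩ⟩
  · exact ⟨_, _, _, isReduction_cycleGamma hi hΩ⟩

/-! ### Extremal lengths and heights of the chosen cycles -/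

theorem analyticAt_extGdh (hg : 1 ≤ g) {c : List (ℕ × ℕ)} (hc : c ∈ chosenCycles g)
    {p : (Fin g → ℝ) × ℝ} (hp : p ∈ Delta g) :
    AnalyticAt ℝ (fun p => (extGdh c p).toReal) p := by
  obtain ⟨S, T, κ, h⟩ := exists_isReduction hg hc (isOrthodisk_OmegaGdh hg)
  exact h.analyticAt (isOrthodisk_OmegaGdh hg) hp

theorem analyticAt_extInvGdh (hg : 1 ≤ g) {c : List (ℕ × ℕ)} (hc : c ∈ chosenCycles g)
    {p : (Fin g → ℝ) × ℝ} (hp : p ∈ Delta g) :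
    AnalyticAt ℝ (fun p => (extInvGdh c p).toReal) p := by
  obtain ⟨S, T, κ, h⟩ := exists_isReduction hg hc (isOrthodisk_OmegaInvGdh hg)
  exact h.analyticAt (isOrthodisk_OmegaInvGdh hg) hp

theorem extGdh_pos_and_lt_top (hg : 1 ≤ g) {c : List (ℕ × ℕ)} (hc : c ∈ chosenCycles g)
    {p : (Fin g → ℝ) × ℝ} (hp : p ∈ Delta g) : 0 < extGdh c p ∧ extGdh c p < ∞ := by
  obtain ⟨S, T, κ, h⟩ := exists_isReduction hg hc (isOrthodisk_OmegaGdh hg)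
  exact h.pos_and_lt_top (isOrthodisk_OmegaGdh hg) hp

theorem extInvGdh_pos_and_lt_top (hg : 1 ≤ g) {c : List (ℕ × ℕ)} (hc : c ∈ chosenCycles g)
    {p : (Fin g → ℝ) × ℝ} (hp : p ∈ Delta g) : 0 < extInvGdh c p ∧ extInvGdh c p < ∞ := by
  obtain ⟨S, T, κ, h⟩ := exists_isReduction hg hc (isOrthodisk_OmegaInvGdh hg)
  exact h.pos_and_lt_top (isOrthodisk_OmegaInvGdh hg) hp

theorem cycleHeight_smul (hg : 1 ≤ g) {c : List (ℕ × ℕ)} (hc : c ∈ chosenCycles g)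
    {p : (Fin g → ℝ) × ℝ} (hp : p ∈ Delta g) {r : ℝ} (hr : 0 < r) :
    cycleHeight c (r • p) = cycleHeight c p := by
  obtain ⟨_, _, _, h⟩ := exists_isReduction hg hc (isOrthodisk_OmegaGdh hg)
  obtain ⟨_, _, _, h'⟩ := exists_isReduction hg hc (isOrthodisk_OmegaInvGdh hg)
  have e : extGdh c (r • p) = extGdh c p := h.smul (isOrthodisk_OmegaGdh hg) hp hr
  have e' : extInvGdh c (r • p) = extInvGdh c p := h'.smul (isOrthodisk_OmegaInvGdh hg) hp hr
  rw [cycleHeight, cycleHeight, e, e']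

theorem analyticAt_cycleHeight (hg : 1 ≤ g) {c : List (ℕ × ℕ)} (hc : c ∈ chosenCycles g)
    {p : (Fin g → ℝ) × ℝ} (hp : p ∈ Delta g) : AnalyticAt ℝ (cycleHeight c) p := by
  have h := analyticAt_extGdh hg hc hp
  have h' := analyticAt_extInvGdh hg hc hp
  have h0 : (extGdh c p).toReal ≠ 0 := by
    have := extGdh_pos_and_lt_top hg hc hp
    exact (ENNReal.toReal_pos this.1.ne' this.2.ne).ne'
  have h0' : (extInvGdh c p).toReal ≠ 0 := by
    have := extInvGdh_pos_and_lt_top hg hc hp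
    exact (ENNReal.toReal_pos this.1.ne' this.2.ne).ne'
  -- The absolute values are not analytic, but their squares are plain squares.
  have he : (cycleHeight c : (Fin g → ℝ) × ℝ → ℝ) = fun p =>
      (Real.exp (1 / (extGdh c p).toReal) - Real.exp (1 / (extInvGdh c p).toReal)) ^ 2 +
        (Real.exp (extGdh c p).toReal - Real.exp (extInvGdh c p).toReal) ^ 2 := by
    funext p
    rw [cycleHeight, sq_abs, sq_abs]
  rw [he]
  exact (((analyticAt_const.div h h0).rexp.sub (analyticAt_const.div h' h0').rexp).pow 2).add
    ((h.rexp.sub h'.rexp).pow 2)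

end

end Scherk
end



/-! ### The theorem -/

theorem mainTheorem9 (g : ℕ) (hg : 1 ≤ g) :
    (∀ c ∈ Scherk.chosenCycles g,
      (∀ p ∈ Scherk.Delta g,
        (0 < Scherk.extGdh c p ∧ Scherk.extGdh c p < ∞) ∧
        (0 < Scherk.extInvGdh c p ∧ Scherk.extInvGdh c p < ∞)) ∧
      AnalyticOnNhd ℝ (fun p => (Scherk.extGdh c p).toReal) (Scherk.Delta g) ∧
      AnalyticOnNhd ℝ (fun p => (Scherk.extInvGdh c p).toReal) (Scherk.Delta g)) ∧
    (∀ p ∈ Scherk.Delta g, ∀ r : ℝ, 0 < r → Scherk.height g (r • p) = Scherk.height g p) ∧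
    AnalyticOnNhd ℝ (Scherk.height g) (Scherk.Delta g) := by
  have hδ : Scherk.cycleDelta g ∈ Scherk.chosenCycles g := Or.inl rfl
  have hγ : ∀ i ∈ Finset.Icc 1 (g - 1), Scherk.cycleGamma g i ∈ Scherk.chosenCycles g :=
    fun i hi => Or.inr ⟨i, hi, rfl⟩
  refine ⟨fun c hc => ⟨fun p hp => ⟨Scherk.extGdh_pos_and_lt_top hg hc hp,
    Scherk.extInvGdh_pos_and_lt_top hg hc hp⟩, fun p hp => Scherk.analyticAt_extGdh hg hc hp,
    fun p hp => Scherk.analyticAt_extInvGdh hg hc hp⟩, fun p hp r hr => ?_, fun p hp => ?_⟩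
  · rw [Scherk.height, Scherk.height, Scherk.cycleHeight_smul hg hδ hp hr]
    congr 1
    exact Finset.sum_congr rfl fun i hi => Scherk.cycleHeight_smul hg (hγ i hi) hp hr
  · refine AnalyticAt.add ?_ (Scherk.analyticAt_cycleHeight hg hδ hp)
    exact Finset.analyticAt_fun_sum _ fun i hi => Scherk.analyticAt_cycleHeight hg (hγ i hi) hp
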